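/- Let $N\ge 1$, let $K=\mathrm{SO}(N)$ be the complex special orthogonal group, the fixed point group of the involution $\theta(g)=(g^{T})^{-1}$ of $G=\mathrm{SL}(N,\mathbb C)$, and let $\mathcal N_1$ be the variety of nilpotent symmetric complex $N\times N$ matrices (the nilpotent elements of the $(-1)$-eigenspace $\mathfrak g_1$ of $d\theta$ on $\mathfrak{sl}(N)$), on which $K$ acts by conjugation. Let $\mathcal A_N$ be the set of nilpotent orbital complexes, that is, of isomorphism classes of intersection cohomology complexes $\mathrm{IC}(\mathcal O,\mathcal E)$ on $\mathcal N_1$, where $\mathcal O$ is a $K$-orbit in $\mathcal N_1$ and $\mathcal E$ is an irreducible $K$-equivariant local system of finite-dimensional complex vector spaces on $\mathcal O$. Let $p(k)$ be the number of partitions of $k$ and $q(k)$ the number of $2$-regular partitions of $k$ (partitions with distinct parts), with $p(0)=q(0)=1$, and put $$d(k)=\sum_{s=0}^{k}q(s)\,q(2k+1-s),\qquad e(k)=\sum_{s=0}^{k-1}q(s)\,q(2k-s)+\frac{q(k)^2+3q(k)}{2}.$$ Let $\Sigma_N$ be the set of triples $(\nu;\mu^1,\mu^2)$ where, for some $0\le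 m\le [N/2]$ and $0\le k\le [N/2]-m$, $\nu$ is a partition of $m$, $\mu^1$ is a $2$-regular partition of $k$ and $\mu^2$ is a $2$-regular partition of $N-2m-k$; when $N$ is even, $(\nu;\mu^1,\mu^2)$ is identified with $(\nu;\mu^2,\mu^1)$ if $|\mu^1|=|\mu^2|$ and $\mu^1\ne\mu^2$, and each triple $(\nu;\mu,\mu)$ is counted twice, with the labels $\mathrm I$ and $\mathrm{II}$. Lemma. For every $n\ge 0$, $$|\mathcal A_{2n+1}|=\sum_{k=0}^{n}p(n-k)\,d(k)=|\Sigma_{2n+1}|,$$ and for every $n\ge 1$, $$|\mathcal A_{2n}|=\sum_{k=0}^{n}p(n-k)\,e(k)=|\Sigma_{2n}|.$$ -/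

import Mathlib

open CategoryTheory TopologicalSpace Matrix

noncomputable section

namespace NilpotentOrbitalComplexes

/-! ## Equivariant local systems -/

section LocalSystems

/-- A flat frame of rank `r` over the subset `U` of `X`, for a family `fiber` of complex vector
spaces whose total space carries a topology: `U` is open, and `b` identifies the part of the total
space over `U` with the product of `U` and the *discrete* space `ℂ^r`. -/
def IsFlatFrame {X : Type} [TopologicalSpace X] {fiber : X → Type}
    [∀ x, AddCommGroup (fiber x)] [∀ x, Module ℂ (fiber x)]
    [TopologicalSpace (Bundle.TotalSpace Unit fiber)]
    (U : Set X) {r : ℕ} (b : ∀ y : U, (Fin r → ℂ) ≃ₗ[ℂ] fiber y) : Prop :=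
  IsOpen U ∧ ∀ v : Fin r → ℂ,
    Topology.IsOpenEmbedding fun y : U => (⟨y, b y v⟩ : Bundle.TotalSpace Unit fiber)

/-- A local system of finite-dimensional complex vector spaces on `X`, given by its étale space:
the fibres are the stalks, the total space is a covering space of `X`, linearly in the fibres. -/
structure LocalSystem (X : Type) [TopologicalSpace X] where
  fiber : X → Type
  [addCommGroup : ∀ x, AddCommGroup (fiber x)]
  [module : ∀ x, Module ℂ (fiber x)]
  [topology : TopologicalSpace (Bundle.TotalSpace Unit fiber)]
  exists_frame : ∀ x : X, ∃ (U : Set X) (r : ℕ) (b : ∀ y : U, (Fin r → ℂ) ≃ₗ[ℂ] fiber y),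
    x ∈ U ∧ IsFlatFrame U b

attribute [instance] LocalSystem.addCommGroup LocalSystem.module LocalSystem.topology

/-- The étale space of a local system. -/
abbrev LocalSystem.Total {X : Type} [TopologicalSpace X] (L : LocalSystem X) : Type :=
  Bundle.TotalSpace Unit L.fiber

/-- A `K`-equivariant local system on a space `X` with an action of the topological group `K`:
a local system with an action of `K` on its étale space which is continuous, covers the action
on `X` and is linear in the fibres. -/
structure EquivariantLocalSystem (K : Type) [Group K] [TopologicalSpace K]
    (X : Type) [TopologicalSpace X] [MulAction K X] extends LocalSystem X where
  act : ∀ (k : K) (x : X), fiber x →ₗ[ℂ] fiber (k • x)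
  act_one : ∀ (x : X) (v : fiber x),
    (⟨(1 : K) • x, act 1 x v⟩ : Bundle.TotalSpace Unit fiber) = ⟨x, v⟩
  act_mul : ∀ (k l : K) (x : X) (v : fiber x),
    (⟨(k * l) • x, act (k * l) x v⟩ : Bundle.TotalSpace Unit fiber) =
      ⟨k • l • x, act k (l • x) (act l x v)⟩
  continuous_act : Continuous fun p : K × Bundle.TotalSpace Unit fiber =>
    (⟨p.1 • p.2.proj, act p.1 p.2.proj p.2.snd⟩ : Bundle.TotalSpace Unit fiber)

variable {K : Type} [Group K] [TopologicalSpace K] {X : Type} [TopologicalSpace X] [MulAction K X]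

/-- A family of subspaces of the fibres is a `K`-equivariant local subsystem if it is preserved by
`K` and is constant in suitable flat frames near every point. -/
def EquivariantLocalSystem.IsSubsystem (E : EquivariantLocalSystem K X)
    (W : ∀ x, Submodule ℂ (E.fiber x)) : Prop :=
  (∀ (k : K) (x : X) (v : E.fiber x), v ∈ W x → E.act k x v ∈ W (k • x)) ∧
  ∀ x : X, ∃ (U : Set X) (r : ℕ) (b : ∀ y : U, (Fin r → ℂ) ≃ₗ[ℂ] E.fiber y)
    (W₀ : Submodule ℂ (Fin r → ℂ)),
    x ∈ U ∧ IsFlatFrame U b ∧ ∀ y : U, W y = W₀.map (b y).toLinearMap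

/-- A `K`-equivariant local system is irreducible if it is nonzero and has no `K`-equivariant
local subsystems except zero and itself. -/
def EquivariantLocalSystem.IsIrreducible (E : EquivariantLocalSystem K X) : Prop :=
  (∃ x, Nontrivial (E.fiber x)) ∧
  ∀ W : ∀ x, Submodule ℂ (E.fiber x), E.IsSubsystem W → (∀ x, W x = ⊥) ∨ ∀ x, W x = ⊤

end LocalSystems

/-! ## The sheaf of sections of a local system -/

section Sections

variable {X : Type} [TopologicalSpace X] (L : LocalSystem X)

/-- A section over the open set `U` is continuous. -/
def LocalSystem.IsContinuousSection {U : Opens X} (s : ∀ x : U, L.fiber x) : Prop :=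
  Continuous fun x : U => (⟨x, s x⟩ : L.Total)

variable {L}

/-- A section that is locally constant in flat frames is continuous. -/
theorem LocalSystem.isContinuousSection_of_local {U : Opens X} {s : ∀ x : U, L.fiber x}
    (h : ∀ x : U, ∃ (V : Set X) (r : ℕ) (b : ∀ y : V, (Fin r → ℂ) ≃ₗ[ℂ] L.fiber y)
      (v : Fin r → ℂ), (x : X) ∈ V ∧ IsFlatFrame V b ∧
        ∀ᶠ y : U in nhds x, ∀ hy : (y : X) ∈ V, s y = b ⟨y, hy⟩ v) :
    L.IsContinuousSection s := by
  rw [LocalSystem.IsContinuousSection, continuous_iff_continuousAt]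
  intro x
  obtain ⟨V, r, b, v, hxV, ⟨hV, hb⟩, hs⟩ := h x
  have hV' : IsOpen {y : U | (y : X) ∈ V} := hV.preimage continuous_subtype_val
  have hon : ContinuousOn (fun y : U => (⟨y, s y⟩ : L.Total))
      ({y : U | (y : X) ∈ V} ∩ {y : U | ∀ hy : (y : X) ∈ V, s y = b ⟨y, hy⟩ v}) := by
    rw [continuousOn_iff_continuous_domRestrict]
    have : Continuous fun y : ({y : U | (y : X) ∈ V} ∩
        {y : U | ∀ hy : (y : X) ∈ V, s y = b ⟨y, hy⟩ v} : Set U) =>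
        (⟨y.1.1, b ⟨y.1.1, y.2.1⟩ v⟩ : L.Total) :=
      (hb v).continuous.comp
        (Continuous.subtype_mk (continuous_subtype_val.comp continuous_subtype_val) _)
    convert this using 1
    funext y
    simp only [Set.domRestrict_apply]
    rw [y.2.2 y.2.1]
  exact hon.continuousAt (Filter.inter_mem (hV'.mem_nhds hxV) hs)

/-- A continuous section is locally constant in every flat frame. -/
theorem LocalSystem.IsContinuousSection.eventually_eq {U : Opens X} {s : ∀ x : U, L.fiber x}
    (hs : L.IsContinuousSection s) {V : Set X} {r : ℕ}
    {b : ∀ y : V, (Fin r → ℂ) ≃ₗ[ℂ] L.fiber y} (hb : IsFlatFrame V b) (x : U) (hx : (x : X) ∈ V) :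
    ∀ᶠ y : U in nhds x, ∀ hy : (y : X) ∈ V, s y = b ⟨y, hy⟩ ((b ⟨x, hx⟩).symm (s x)) := by
  have hopen := ((hb.2 ((b ⟨x, hx⟩).symm (s x))).isOpen_range).preimage hs
  have hmem := hopen.mem_nhds (x := x) ⟨⟨x, hx⟩, by simp⟩
  filter_upwards [hmem] with y hy hyV
  obtain ⟨z, hz⟩ := hy
  obtain ⟨z, hzV⟩ := z
  simp only [Bundle.TotalSpace.mk.injEq] at hz
  obtain ⟨rfl, hz⟩ := hz
  exact (eq_of_heq hz).symm

theorem LocalSystem.IsContinuousSection.zero (U : Opens X) :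
    L.IsContinuousSection (0 : ∀ x : U, L.fiber x) :=
  LocalSystem.isContinuousSection_of_local fun x => by
    obtain ⟨V, r, b, hx, hb⟩ := L.exists_frame x
    exact ⟨V, r, b, 0, hx, hb, Filter.Eventually.of_forall fun y hy => by simp⟩

theorem LocalSystem.IsContinuousSection.add {U : Opens X} {s t : ∀ x : U, L.fiber x}
    (hs : L.IsContinuousSection s) (ht : L.IsContinuousSection t) :
    L.IsContinuousSection (s + t) :=
  LocalSystem.isContinuousSection_of_local fun x => by
    obtain ⟨V, r, b, hx, hb⟩ := L.exists_frame x
    refine ⟨V, r, b, (b ⟨x, hx⟩).symm (s x) + (b ⟨x, hx⟩).symm (t x), hx, hb, ?_⟩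
    filter_upwards [hs.eventually_eq hb x hx, ht.eventually_eq hb x hx] with y h₁ h₂ hy
    rw [Pi.add_apply, h₁ hy, h₂ hy, map_add]

theorem LocalSystem.IsContinuousSection.smul {U : Opens X} {s : ∀ x : U, L.fiber x} (c : ℂ)
    (hs : L.IsContinuousSection s) : L.IsContinuousSection (c • s) :=
  LocalSystem.isContinuousSection_of_local fun x => by
    obtain ⟨V, r, b, hx, hb⟩ := L.exists_frame x
    refine ⟨V, r, b, c • (b ⟨x, hx⟩).symm (s x), hx, hb, ?_⟩
    filter_upwards [hs.eventually_eq hb x hx] with y h₁ hy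
    rw [Pi.smul_apply, h₁ hy, map_smul]

variable (L)

/-- Continuity of sections, as a local predicate. -/
def LocalSystem.continuousSections :
    TopCat.LocalPredicate (X := TopCat.of X) L.fiber where
  pred {_} s := L.IsContinuousSection s
  res i _ h := Continuous.comp h (Opens.isOpenEmbedding_of_le i.le).continuous
  locality {U} s h := by
    refine continuous_iff_continuousAt.2 fun x => ?_
    obtain ⟨V, hx, i, hs⟩ := h x
    exact ((Opens.isOpenEmbedding_of_le i.le).continuousAt_iff (x := ⟨x, hx⟩)).1
      (Continuous.continuousAt hs)

/-- The vector space of continuous sections over the open set `U`. -/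
def LocalSystem.sections (U : Opens X) : Submodule ℂ (∀ x : U, L.fiber x) where
  carrier := {s | L.IsContinuousSection s}
  zero_mem' := LocalSystem.IsContinuousSection.zero U
  add_mem' hs ht := hs.add ht
  smul_mem' c _ hs := hs.smul c

/-- The presheaf of continuous sections of a local system. -/
def LocalSystem.presheaf : TopCat.Presheaf (ModuleCat.{0} ℂ) (TopCat.of X) where
  obj U := ModuleCat.of ℂ (L.sections U.unop)
  map i := ModuleCat.ofHom
    { toFun := fun s => ⟨fun x => s.1 ⟨x.1, i.unop.le x.2⟩, L.continuousSections.res i.unop s.1 s.2⟩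
      map_add' := fun _ _ => rfl
      map_smul' := fun _ _ => rfl }

/-- The locally constant sheaf of continuous sections of a local system. -/
def LocalSystem.sheaf : TopCat.Sheaf (ModuleCat.{0} ℂ) (TopCat.of X) :=
  ⟨L.presheaf, (TopCat.Presheaf.isSheaf_iff_isSheaf_comp (CategoryTheory.forget (ModuleCat.{0} ℂ))
    L.presheaf).2 (TopCat.subpresheafToTypes.isSheaf L.continuousSections)⟩

end Sections

/-! ## Intermediate extensions -/

section Extension

/-- Sheaves of complex vector spaces. -/
abbrev ComplexSheaf (X : TopCat.{0}) := TopCat.Sheaf (ModuleCat.{0} ℂ) X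

instance (X : TopCat.{0}) : HasDerivedCategory.{1} (ComplexSheaf X) :=
  HasDerivedCategory.standard _

/-- The functor `j_* j^*` for the inclusion `j` of an open subset `U` of `X`. -/
def openExtension {X : TopCat.{0}} (U : Opens X) : ComplexSheaf X ⥤ ComplexSheaf X :=
  U.isOpenEmbedding.sheafPullback (ModuleCat.{0} ℂ) ⋙
    TopCat.Sheaf.pushforward (ModuleCat.{0} ℂ) U.inclusion'

instance {X : TopCat.{0}} (U : Opens X) : (openExtension U).Additive where
  map_add := by intros; rfl

/-- The functor `τ_{≤ m} Rj_* j^*` for the inclusion `j` of an open subset `U` of `X`. -/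
def truncatedExtension {X : TopCat.{0}} (U : Opens X) (m : ℤ) :
    DerivedCategory.Plus (ComplexSheaf X) ⥤ DerivedCategory.Plus (ComplexSheaf X) :=
  (openExtension U).rightDerivedFunctorPlus ⋙ DerivedCategory.Plus.TStructure.t.truncLE m

/-- Deligne's iterated extension
`τ_{≤ -1} Rj_{0*} j_0^* τ_{≤ -2} Rj_{1*} j_1^* ⋯ τ_{≤ -d} Rj_{d-1*} j_{d-1}^* F`,
where `j_k` is the inclusion of `U k`. -/
def deligneExtension {X : TopCat.{0}} (U : ℕ → Opens X) :
    ℕ → DerivedCategory.Plus (ComplexSheaf X) → DerivedCategory.Plus (ComplexSheaf X)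
  | 0, F => F
  | d + 1, F => deligneExtension U d ((truncatedExtension (U d) (-((d : ℤ) + 1))).obj F)

end Extension

/-! ## The symmetric pair `(SL(N), SO(N))` -/

/-- The group `K = SO(N)`: the fixed points in `G = SL(N, ℂ)` of the involution `g ↦ (gᵀ)⁻¹`. -/
def SO (N : ℕ) : Subgroup (SpecialLinearGroup (Fin N) ℂ) where
  carrier := {g | g.1ᵀ * g.1 = 1}
  one_mem' := by
    change (1 : Matrix (Fin N) (Fin N) ℂ)ᵀ * 1 = 1
    simp
  mul_mem' {g h} hg hh := by
    change (g.1 * h.1)ᵀ * (g.1 * h.1) = 1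
    change g.1ᵀ * g.1 = 1 at hg
    change h.1ᵀ * h.1 = 1 at hh
    calc (g.1 * h.1)ᵀ * (g.1 * h.1) = h.1ᵀ * (g.1ᵀ * g.1) * h.1 := by
          rw [transpose_mul]; noncomm_ring
      _ = 1 := by rw [hg, Matrix.mul_one, hh]
  inv_mem' {g} hg := by
    change g.1ᵀ * g.1 = 1 at hg
    change (g⁻¹).1ᵀ * (g⁻¹).1 = 1
    have h₁ : g.1 * (g⁻¹).1 = 1 := congrArg Subtype.val (mul_inv_cancel g)
    rw [← left_inv_eq_right_inv hg h₁, transpose_transpose]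
    exact mul_eq_one_comm.1 hg

/-- The matrix of an element of `SO(N)`. -/
def SO.mat {N : ℕ} (k : SO N) : Matrix (Fin N) (Fin N) ℂ := k.1.1

theorem SO.mat_mul {N : ℕ} (k l : SO N) : SO.mat (k * l) = SO.mat k * SO.mat l := rfl

theorem SO.mat_one {N : ℕ} : SO.mat (1 : SO N) = 1 := rfl

theorem SO.transpose_mul_self {N : ℕ} (k : SO N) : (SO.mat k)ᵀ * SO.mat k = 1 := k.2

theorem SO.inv_mul_self {N : ℕ} (k : SO N) : SO.mat k⁻¹ * SO.mat k = 1 := by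
  rw [← SO.mat_mul, inv_mul_cancel, SO.mat_one]

theorem SO.mat_inv {N : ℕ} (k : SO N) : SO.mat k⁻¹ = (SO.mat k)ᵀ :=
  (left_inv_eq_right_inv (SO.transpose_mul_self k) (mul_eq_one_comm.1 (SO.inv_mul_self k))).symm

/-- The `(-1)`-eigenspace `𝔤₁` of the differential `x ↦ -xᵀ` of the involution on `𝔰𝔩(N)`. -/
def g1 (N : ℕ) : Set (Matrix (Fin N) (Fin N) ℂ) := {x | x.trace = 0 ∧ xᵀ = x}

/-- The cone `𝒩₁` of nilpotent elements of `𝔤₁`. -/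
def NilCone (N : ℕ) : Type := {x : Matrix (Fin N) (Fin N) ℂ // x ∈ g1 N ∧ IsNilpotent x}

instance (N : ℕ) : TopologicalSpace (NilCone N) :=
  inferInstanceAs (TopologicalSpace {x : Matrix (Fin N) (Fin N) ℂ // x ∈ g1 N ∧ IsNilpotent x})

theorem conj_mem_nilCone {N : ℕ} (k : SO N) {x : Matrix (Fin N) (Fin N) ℂ}
    (hx : x ∈ g1 N ∧ IsNilpotent x) :
    SO.mat k * x * SO.mat k⁻¹ ∈ g1 N ∧ IsNilpotent (SO.mat k * x * SO.mat k⁻¹) := by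
  obtain ⟨⟨htr, hsymm⟩, m, hm⟩ := hx
  refine ⟨⟨?_, ?_⟩, m, ?_⟩
  · rw [Matrix.trace_mul_comm, ← Matrix.mul_assoc, SO.inv_mul_self, Matrix.one_mul, htr]
  · rw [SO.mat_inv, transpose_mul, transpose_mul, transpose_transpose, hsymm, Matrix.mul_assoc]
  · have h : ∀ j : ℕ, (SO.mat k * x * SO.mat k⁻¹) ^ j = SO.mat k * x ^ j * SO.mat k⁻¹ := by
      intro j
      induction j with
      | zero => simpa using (mul_eq_one_comm.1 (SO.inv_mul_self k)).symm
      | succ j ih =>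
        rw [pow_succ, ih, pow_succ]
        calc SO.mat k * x ^ j * SO.mat k⁻¹ * (SO.mat k * x * SO.mat k⁻¹)
            = SO.mat k * x ^ j * (SO.mat k⁻¹ * SO.mat k) * x * SO.mat k⁻¹ := by noncomm_ring
          _ = SO.mat k * (x ^ j * x) * SO.mat k⁻¹ := by rw [SO.inv_mul_self]; noncomm_ring
    rw [h, hm]; simp

/-- The adjoint action of `SO(N)` on `𝒩₁`. -/
instance (N : ℕ) : MulAction (SO N) (NilCone N) where
  smul k x := ⟨SO.mat k * x.1 * SO.mat k⁻¹, conj_mem_nilCone k x.2⟩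
  one_smul x := Subtype.ext <| by
    change SO.mat (1 : SO N) * x.1 * SO.mat (1 : SO N)⁻¹ = x.1
    simp [SO.mat_one]
  mul_smul k l x := Subtype.ext <| by
    change SO.mat (k * l) * x.1 * SO.mat (k * l)⁻¹ =
      SO.mat k * (SO.mat l * x.1 * SO.mat l⁻¹) * SO.mat k⁻¹
    simp [SO.mat_mul, Matrix.mul_assoc]

/-- The differential `A ↦ [A, x]` at the identity of the orbit map `k ↦ k • x`, for `A ∈ 𝔰𝔬(N)`. -/
def orbitDifferential {N : ℕ} (x : Matrix (Fin N) (Fin N) ℂ) :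
    LieAlgebra.Orthogonal.so (Fin N) ℂ →ₗ[ℂ] Matrix (Fin N) (Fin N) ℂ where
  toFun A := A.1 * x - x * A.1
  map_add' A B := by simp [add_mul, mul_add]; abel
  map_smul' c A := by simp [smul_sub]

/-- The complex dimension of the `SO(N)`-orbit of `x`. -/
def orbitDim {N : ℕ} (x : NilCone N) : ℕ :=
  Module.finrank ℂ (LinearMap.range (orbitDifferential x.1))

theorem lt_orbitDim_iff {N : ℕ} (k : ℕ) (x : NilCone N) :
    k < orbitDim x ↔ ∃ f : Fin (k + 1) → LieAlgebra.Orthogonal.so (Fin N) ℂ,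
      LinearIndependent ℂ fun i => orbitDifferential x.1 (f i) := by
  constructor
  · intro h
    obtain ⟨g, hg⟩ := exists_linearIndependent_of_le_finrank (R := ℂ)
      (M := LinearMap.range (orbitDifferential x.1)) (n := k + 1) h
    choose f hf using fun i => (g i).2
    refine ⟨f, ?_⟩
    have := hg.map' (Submodule.subtype _) (Submodule.ker_subtype _)
    have hfg : (fun i => orbitDifferential x.1 (f i)) =
        (LinearMap.range (orbitDifferential x.1)).subtype ∘ g := funext hf
    rw [hfg]
    exact this
  · rintro ⟨f, hf⟩
    have h : LinearIndependent ℂ fun i =>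
        (⟨orbitDifferential x.1 (f i), f i, rfl⟩ : LinearMap.range (orbitDifferential x.1)) :=
      LinearIndependent.of_comp (Submodule.subtype _) hf
    have := h.fintype_card_le_finrank
    simpa [orbitDim] using this

attribute [local instance] Matrix.normedAddCommGroup Matrix.normedSpace in
theorem isOpen_setOf_linearIndependent_matrix {N k : ℕ} :
    IsOpen {f : Fin k → Matrix (Fin N) (Fin N) ℂ | LinearIndependent ℂ f} :=
  isOpen_setOfPred_linearIndependent

theorem isOpen_lt_orbitDim {N : ℕ} (k : ℕ) : IsOpen {x : NilCone N | k < orbitDim x} := by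
  have h : {x : NilCone N | k < orbitDim x} =
      ⋃ f : Fin (k + 1) → LieAlgebra.Orthogonal.so (Fin N) ℂ,
        {x : NilCone N | LinearIndependent ℂ fun i => orbitDifferential x.1 (f i)} := by
    ext x
    simpa using lt_orbitDim_iff k x
  rw [h]
  refine isOpen_iUnion fun f => isOpen_setOf_linearIndependent_matrix.preimage
    (f := fun (x : NilCone N) i => orbitDifferential x.1 (f i)) ?_
  refine continuous_pi fun i => ?_
  have hx : Continuous fun x : NilCone N => x.1 := continuous_subtype_val
  exact (continuous_const.matrix_mul hx).sub (hx.matrix_mul continuous_const)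

/-- The open union of the `SO(N)`-orbits of dimension greater than `k` in `𝒩₁`. -/
def largeOrbits (N k : ℕ) : Opens (TopCat.of (NilCone N)) :=
  ⟨{x : NilCone N | k < orbitDim x}, isOpen_lt_orbitDim k⟩

/-- The set of `SO(N)`-orbits in `𝒩₁`. -/
abbrev NilpotentOrbit (N : ℕ) : Type := MulAction.orbitRel.Quotient (SO N) (NilCone N)

/-- The complex dimension of a nilpotent `SO(N)`-orbit. -/
def NilpotentOrbit.dim {N : ℕ} (O : NilpotentOrbit N) : ℕ := orbitDim O.out

/-- The inclusion of an orbit into `𝒩₁`. -/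
def NilpotentOrbit.inclusion {N : ℕ} (O : NilpotentOrbit N) :
    TopCat.of O.orbit ⟶ TopCat.of (NilCone N) :=
  TopCat.ofHom ⟨Subtype.val, continuous_subtype_val⟩

/-- The intersection cohomology complex `IC(𝒪, ℰ)` on `𝒩₁`, normalised to be perverse: its
restriction to `𝒪` is `ℰ[dim 𝒪]`. It is given by Deligne's formula for the stratification
of `𝒩₁` by the unions of the orbits of the same dimension. -/
def IC {N : ℕ} (O : NilpotentOrbit N) (E : EquivariantLocalSystem (SO N) O.orbit) :
    DerivedCategory.Plus (ComplexSheaf (TopCat.of (NilCone N))) :=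
  deligneExtension (largeOrbits N) O.dim
    ((DerivedCategory.Plus.singleFunctor _ (-(O.dim : ℤ))).obj
      ((TopCat.Sheaf.pushforward (ModuleCat.{0} ℂ) O.inclusion).obj E.sheaf))

/-- The set `𝒜_N` of nilpotent orbital complexes: the isomorphism classes of the complexes
`IC(𝒪, ℰ)`, for `𝒪` an `SO(N)`-orbit in `𝒩₁` and `ℰ` an irreducible `SO(N)`-equivariant local
system on `𝒪`. -/
def nilpotentOrbitalComplexes (N : ℕ) :
    Set (Quotient (isIsomorphicSetoid
      (DerivedCategory.Plus (ComplexSheaf (TopCat.of (NilCone N)))))) :=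
  {c | ∃ (O : NilpotentOrbit N) (E : EquivariantLocalSystem (SO N) O.orbit),
    E.IsIrreducible ∧ c = ⟦IC O E⟧}

/-! ## Partitions and the set `Σ_N` -/

/-- The number of partitions of `k`. -/
def p (k : ℕ) : ℕ := Fintype.card (Nat.Partition k)

/-- The number of 2-regular partitions of `k`: those in which every part occurs less than twice. -/
def q (k : ℕ) : ℕ := (Nat.Partition.countRestricted k 2).card

def d (k : ℕ) : ℕ := ∑ s ∈ Finset.range (k + 1), q s * q (2 * k + 1 - s)

/-- The division by two is exact. -/
def e (k : ℕ) : ℕ := ∑ s ∈ Finset.range k, q s * q (2 * k - s) + (q k ^ 2 + 3 * q k) / 2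

/-- The two labels `I` and `II`. -/
inductive Label
  | I
  | II

/-- A triple `(ν; μ¹, μ²)` with `ν` a partition of `m`, `0 ≤ m ≤ [N/2]`, with `μ¹` a 2-regular
partition of `k`, `0 ≤ k ≤ [N/2] - m`, and `μ²` a 2-regular partition of `N - 2m - k`; it carries
a label exactly when `μ¹ = μ²`. -/
structure LabelledTriple (N : ℕ) where
  ν : Σ m, Nat.Partition m
  μ₁ : Σ k, Nat.Partition k
  μ₂ : Σ l, Nat.Partition l
  ν_le : ν.1 ≤ N / 2
  μ₁_le : μ₁.1 ≤ N / 2 - ν.1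
  μ₂_eq : μ₂.1 = N - 2 * ν.1 - μ₁.1
  μ₁_regular : μ₁.2 ∈ Nat.Partition.countRestricted μ₁.1 2
  μ₂_regular : μ₂.2 ∈ Nat.Partition.countRestricted μ₂.1 2
  label : Option Label
  label_isSome : label.isSome ↔ μ₁ = μ₂

/-- The triples `(ν; μ¹, μ²)` and `(ν; μ², μ¹)` are identified if `|μ¹| = |μ²|`. -/
def tripleSetoid (N : ℕ) : Setoid (LabelledTriple N) where
  r s t := s = t ∨ (s.μ₁.1 = s.μ₂.1 ∧ s.ν = t.ν ∧ s.μ₁ = t.μ₂ ∧ s.μ₂ = t.μ₁ ∧ s.label = t.label)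
  iseqv :=
    { refl := fun _ => .inl rfl
      symm := by
        rintro s t (rfl | ⟨h, h₁, h₂, h₃, h₄⟩)
        · exact .inl rfl
        · exact .inr ⟨by rw [← h₂, ← h₃, h], h₁.symm, h₃.symm, h₂.symm, h₄.symm⟩
      trans := by
        rintro s t u (rfl | ⟨h, h₁, h₂, h₃, h₄⟩) h'
        · exact h'
        · rcases h' with rfl | ⟨_, h₁', h₂', h₃', h₄'⟩
          · exact .inr ⟨h, h₁, h₂, h₃, h₄⟩
          · left
            obtain ⟨⟩ := s
            obtain ⟨⟩ := u
            simp only [LabelledTriple.mk.injEq]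
            exact ⟨h₁.trans h₁', h₂.trans h₃', h₃.trans h₂', h₄.trans h₄'⟩ }

/-- The set `Σ_N`. -/
def SigmaSet (N : ℕ) : Type := Quotient (tripleSetoid N)

end NilpotentOrbitalComplexes

end

/-! The set of complexes is put in bijection with pairs (orbit, character of the component group of
a stabilizer), these pairs are counted by Jordan type, and the count is matched with the labelled
triples through a generating function.

Geometry. In Deligne's formula no truncation reaches degree `-dim O`, so the lowest cohomology sheaf
of IC(O, E) is the ordinary direct image of E (`IC_lowest`). An isomorphism of complexes therefore
gives an isomorphism of direct images. Distinct orbits are told apart by an open set meeting only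
one of them, and on one orbit the character is recovered because SO(N) is connected
(`HasCharacter.eq_of_pushforward_iso`). Conversely, the component groups are abelian, so irreducible
equivariant systems are lines given by characters, and each character occurs (`charSystem`).

Linear algebra. A nilpotent self-adjoint endomorphism of a complex quadratic space is an orthogonal
sum of cyclic modules in normal position, so O(N)-orbits correspond to partitions of N. The
O(N)-stabilizer is generated by reflections in nondegenerate cyclic submodules. Reflections of equal
length lie in one component, and they are detected by determinants on multiplicity spaces, so the
component group is a sign group with one factor for each distinct part. A reflection of length i has
determinant (-1)^i. If some part is odd, there is one SO(N)-orbit and half of the signs survive. If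
all parts are even, there are two orbits and all signs survive. With a(λ) the number of distinct
parts, twice the number of complexes is the sum of 2^a(λ) over all λ plus three times the same sum
over the λ with even parts (`two_mul_ncard_nilpotentOrbitalComplexes`).

Combinatorics. Let P and Q be the generating functions of p and q. The generating function of 2^a(λ)
is the product of (1+t^i)/(1-t^i), which is Q(t)P(t) = Q(t)²P(t²). Its coefficients count ordered
triples (ν; μ¹, μ²). The sum over even partitions of 2n counts the triples with μ¹ = μ². Since each
diagonal triple counts twice in Σ_N and the others are paired by exchange, twice |Σ_N| is given by
the same expression (`two_mul_card_sigmaSet`). -/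

noncomputable section

namespace NilpotentOrbitalComplexes

/-! ### Lowest cohomology of derived functors and truncations. -/

section LowestCohomology
open DerivedCategory

variable {C D : Type*} [Category* C] [Category* D] [Abelian C] [Abelian D]
  [HasDerivedCategory C] [HasDerivedCategory D]

-- The differential into degree `n` vanishes, so the homology there is the kernel of the outgoing
-- differential, and a left exact functor preserves kernels.
omit [HasDerivedCategory C] [HasDerivedCategory D] in
theorem nonempty_map_homology_iso_of_isStrictlyGE (F : C ⥤ D) [F.Additive]
    [Limits.PreservesFiniteLimits F] (K : CochainComplex C ℤ) (n : ℤ) [K.IsStrictlyGE n] :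
    Nonempty (((F.mapHomologicalComplex (.up ℤ)).obj K).homology n ≅ F.obj (K.homology n)) := by
  have hf : (K.sc n).f = 0 :=
    (K.isZero_of_isStrictlyGE n _ (by simp)).eq_of_src _ _
  have : F.PreservesLeftHomologyOf (K.sc n) :=
    F.preservesLeftHomology_of_zero_f (K.sc n) hf
  exact ⟨(K.sc n).mapHomologyIso F⟩

/-- A left exact functor commutes with the lowest cohomology object under right derivation. -/
theorem rightDerivedFunctorPlus_lowest (F : C ⥤ D) [F.Additive] [EnoughInjectives C]
    [Limits.PreservesFiniteLimits F] (G : DerivedCategory.Plus C) (n : ℤ) [G.IsGE n] :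
    (F.rightDerivedFunctorPlus.obj G).IsGE n ∧
    Nonempty ((Plus.homologyFunctor D n).obj (F.rightDerivedFunctorPlus.obj G) ≅
      F.obj ((Plus.homologyFunctor C n).obj G)) := by
  -- A bounded below complex of injectives in degrees `≥ n`. On it the derived functor is computed
  -- termwise.
  obtain ⟨L, hL, ⟨e⟩⟩ := Plus.exists_injective_nonempty_iso G n
  let K := (InjectiveObject.ι C).mapCochainComplexPlus.obj L
  have hK : K.obj.IsStrictlyGE n := by
    change CochainComplex.IsStrictlyGE (((InjectiveObject.ι C).mapHomologicalComplex _).obj L.obj) n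
    infer_instance
  let a := asIso (F.rightDerivedFunctorPlusUnit.app ((HomotopyCategory.Plus.quotient C).obj K))
  have hFK : CochainComplex.IsStrictlyGE ((F.mapHomologicalComplex (.up ℤ)).obj K.obj) n :=
    inferInstance
  let b : Plus.ι.obj (F.rightDerivedFunctorPlus.obj G) ≅
      Q.obj ((F.mapHomologicalComplex (.up ℤ)).obj K.obj) :=
    Plus.ι.mapIso ((F.rightDerivedFunctorPlus.mapIso e).symm ≪≫ a.symm) ≪≫
      (quotientCompQhIso D).app _
  let c : Plus.ι.obj G ≅ Q.obj K.obj :=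
    Plus.ι.mapIso e.symm ≪≫ (quotientCompQhIso C).app _
  refine ⟨?_, ?_⟩
  · rw [← Plus.isGE_ι_obj_iff]
    exact TStructure.t.isGE_of_iso b.symm n
  · obtain ⟨f⟩ := nonempty_map_homology_iso_of_isStrictlyGE F K.obj n
    exact ⟨(homologyFunctor D n).mapIso b ≪≫ (homologyFunctorFactors D n).app _ ≪≫ f ≪≫
      F.mapIso (((homologyFunctor C n).mapIso c ≪≫ (homologyFunctorFactors C n).app _).symm)⟩

/-- Truncation does not change the lowest cohomology object. -/
theorem nonempty_homology_truncLE_iso (G : DerivedCategory.Plus C) (n m : ℤ) (h : n ≤ m)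
    [G.IsGE n] :
    ((Plus.TStructure.t.truncLE m).obj G).IsGE n ∧
    Nonempty ((Plus.homologyFunctor C n).obj ((Plus.TStructure.t.truncLE m).obj G) ≅
      (Plus.homologyFunctor C n).obj G) := by
  refine ⟨inferInstanceAs (Plus.TStructure.t.IsGE ((Plus.TStructure.t.truncLT (m + 1)).obj G) n), ?_⟩
  let T := (Plus.TStructure.t.triangleLTGE (m + 1)).obj G
  have hT : Plus.ι.mapTriangle.obj T ∈ Pretriangulated.distinguishedTriangles :=
    Plus.ι.map_distinguished _ (Plus.TStructure.t.triangleLTGE_distinguished (m + 1) G)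
  have h3 : Plus.IsGE T.obj₃ (m + 1) := inferInstance
  -- The third vertex of the truncation triangle lives in degrees `> m ≥ n`, so the long exact
  -- sequence is squeezed by zeros at `n - 1` and `n`.
  have z (i : ℤ) (hi : i < m + 1) : Limits.IsZero ((homologyFunctor C i).obj (Plus.ι.obj T.obj₃)) :=
    Plus.isZero_homology_of_isGE T.obj₃ (m + 1) i hi
  have hmono : Mono ((homologyFunctor C n).map (Plus.ι.mapTriangle.obj T).mor₁) := by
    refine (HomologySequence.mono_homologyMap_mor₁_iff _ hT (n - 1) n (by lia)).2 ?_
    exact (z (n - 1) (by lia)).eq_of_src _ _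
  have hepi : Epi ((homologyFunctor C n).map (Plus.ι.mapTriangle.obj T).mor₁) := by
    refine (HomologySequence.epi_homologyMap_mor₁_iff _ hT n).2 ?_
    exact (z n (by lia)).eq_of_tgt _ _
  have := isIso_of_mono_of_epi ((homologyFunctor C n).map (Plus.ι.mapTriangle.obj T).mor₁)
  exact ⟨@asIso _ _ _ _ _ this⟩

theorem nonempty_homology_singleFunctor_iso (S : C) (n : ℤ) :
    Nonempty ((Plus.homologyFunctor C n).obj ((Plus.singleFunctor C n).obj S) ≅ S) := by
  let K := (HomologicalComplex.single C (ComplexShape.up ℤ) n).obj S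
  exact ⟨(homologyFunctor C n).mapIso ((singleFunctorIsoCompQ C n).app S) ≪≫
    (homologyFunctorFactors C n).app _ ≪≫
    HomologicalComplex.singleObjHomologySelfIso _ _ S⟩

end LowestCohomology

/-! ### Deligne's iterated extension in the lowest degree. -/

section Extension
open DerivedCategory

variable {X : TopCat.{0}}

/-- Restriction to an open subset is a right adjoint (of extension by zero), and so is direct image.
-/
instance (U : Opens X) : Limits.PreservesFiniteLimits (openExtension U) := by
  unfold openExtension
  have : (U.isOpenEmbedding.sheafPullback (ModuleCat.{0} ℂ)).IsRightAdjoint := by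
    have := Topology.IsOpenEmbedding.functor_isContinuous U.isOpenEmbedding
    exact (U.isOpenEmbedding.functor.sheafAdjunctionContinuous (ModuleCat.{0} ℂ)
      (Opens.grothendieckTopology _) (Opens.grothendieckTopology _)).isRightAdjoint
  infer_instance

/-- The bound `n ≤ -d` keeps all the truncations from touching degree `n`. Each step then only
replaces the lowest sheaf by its ordinary extension `j_* j^*`, which leaves `S` unchanged by
assumption. -/
theorem deligneExtension_lowest (U : ℕ → Opens X) (S : ComplexSheaf X) (n : ℤ) :
    ∀ (d : ℕ) (_ : n ≤ -d) (_ : ∀ k < d, Nonempty ((openExtension (U k)).obj S ≅ S))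
      (G : DerivedCategory.Plus (ComplexSheaf X)) (_ : G.IsGE n)
      (_ : Nonempty ((Plus.homologyFunctor _ n).obj G ≅ S)),
      (deligneExtension U d G).IsGE n ∧
        Nonempty ((Plus.homologyFunctor _ n).obj (deligneExtension U d G) ≅ S)
  | 0, _, _, G, hG, h => ⟨hG, h⟩
  | d + 1, hd, hU, G, hG, ⟨h⟩ => by
    obtain ⟨h1, ⟨e1⟩⟩ := rightDerivedFunctorPlus_lowest (openExtension (U d)) G n
    obtain ⟨h2, ⟨e2⟩⟩ := nonempty_homology_truncLE_iso
      ((openExtension (U d)).rightDerivedFunctorPlus.obj G) n (-((d : ℤ) + 1)) (by push_cast at hd; lia)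
    obtain ⟨e3⟩ := hU d (by lia)
    exact deligneExtension_lowest U S n d (by push_cast at hd; lia) (fun k hk => hU k (by lia)) _ h2
      ⟨e2 ≪≫ e1 ≪≫ (openExtension (U d)).mapIso h ≪≫ e3⟩

end Extension

section Extension
open DerivedCategory

/-- `j_* j^*` does not change a sheaf which is pushed forward from a space mapping into the open
subset. -/
def openExtensionPushforwardIso {X Y : TopCat.{0}} (U : Opens X) (f : Y ⟶ X)
    (hf : ∀ y, f y ∈ U) (F : ComplexSheaf Y) :
    (openExtension U).obj ((TopCat.Sheaf.pushforward (ModuleCat.{0} ℂ) f).obj F) ≅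
      (TopCat.Sheaf.pushforward (ModuleCat.{0} ℂ) f).obj F :=
  (fullyFaithfulSheafToPresheaf _ _).preimageIso <|
    -- Both sides evaluate `F` on a preimage under `f`, of `V ∩ U` and of `V`. These agree since `f`
    -- lands in `U`.
    NatIso.ofComponents (fun V => F.1.mapIso (eqToIso (by
      refine congrArg Opposite.op (Opens.ext (Set.ext fun y => ?_))
      constructor
      · rintro ⟨z, hz, hzy⟩
        change f y ∈ V.unop
        have : z.1 = f y := hzy
        rw [← this]
        exact hz
      · intro hy
        exact ⟨⟨f y, hf y⟩, hy, rfl⟩))) (by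
      intro V W i
      change F.1.map _ ≫ F.1.map _ = F.1.map _ ≫ F.1.map _
      rw [← F.1.map_comp, ← F.1.map_comp]
      rfl)

end Extension

/-! ### Recovering the direct image of the local system from its complex. -/

section Orbits

variable {N : ℕ}

/-- Conjugation by an element of `SO(N)`, as a linear automorphism of the matrices. -/
def conjLinear (k : SO N) : Matrix (Fin N) (Fin N) ℂ →ₗ[ℂ] Matrix (Fin N) (Fin N) ℂ where
  toFun a := SO.mat k * a * SO.mat k⁻¹
  map_add' a b := by rw [mul_add, add_mul]
  map_smul' c a := by simp

theorem conjLinear_injective (k : SO N) : Function.Injective (conjLinear k) := by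
  intro a b h
  have h' : SO.mat k⁻¹ * (SO.mat k * a * SO.mat k⁻¹) * SO.mat k =
    SO.mat k⁻¹ * (SO.mat k * b * SO.mat k⁻¹) * SO.mat k := by
      change SO.mat k * a * SO.mat k⁻¹ = SO.mat k * b * SO.mat k⁻¹ at h
      rw [h]
  have e : ∀ c, SO.mat k⁻¹ * (SO.mat k * c * SO.mat k⁻¹) * SO.mat k = c := by
    intro c
    calc SO.mat k⁻¹ * (SO.mat k * c * SO.mat k⁻¹) * SO.mat k =
      (SO.mat k⁻¹ * SO.mat k) * c * (SO.mat k⁻¹ * SO.mat k) := by noncomm_ring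
      _ = c := by rw [SO.inv_mul_self]; simp
  rwa [e, e] at h'

theorem smul_val (k : SO N) (x : NilCone N) : (k • x).1 = SO.mat k * x.1 * SO.mat k⁻¹ := rfl

/-- Conjugation by `k` preserves 𝔰𝔬(N) and turns `[A, x]` into the bracket of the conjugates, so it
embeds one tangent space in the other. -/
theorem orbitDim_le_smul (k : SO N) (x : NilCone N) : orbitDim x ≤ orbitDim (k • x) := by
  have h : Submodule.map (conjLinear k) (LinearMap.range (orbitDifferential x.1)) ≤
      LinearMap.range (orbitDifferential (k • x).1) := by
    rintro _ ⟨_, ⟨A, rfl⟩, rfl⟩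
    have hA : SO.mat k * A.1 * SO.mat k⁻¹ ∈ LieAlgebra.Orthogonal.so (Fin N) ℂ := by
      have := A.2
      rw [LieAlgebra.Orthogonal.mem_so] at this ⊢
      rw [SO.mat_inv, transpose_mul, transpose_mul, this, transpose_transpose]
      noncomm_ring
    refine ⟨⟨_, hA⟩, ?_⟩
    change SO.mat k * A.1 * SO.mat k⁻¹ * (SO.mat k * x.1 * SO.mat k⁻¹) -
      SO.mat k * x.1 * SO.mat k⁻¹ * (SO.mat k * A.1 * SO.mat k⁻¹) =
      SO.mat k * (A.1 * x.1 - x.1 * A.1) * SO.mat k⁻¹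
    calc _ = SO.mat k * A.1 * (SO.mat k⁻¹ * SO.mat k) * x.1 * SO.mat k⁻¹ -
      SO.mat k * x.1 * (SO.mat k⁻¹ * SO.mat k) * A.1 * SO.mat k⁻¹ := by noncomm_ring
      _ = _ := by rw [SO.inv_mul_self]; noncomm_ring
  have h2 := Submodule.finrank_mono h
  exact (LinearEquiv.finrank_eq
    (Submodule.equivMapOfInjective (conjLinear k) (conjLinear_injective k) _)).le.trans h2

theorem orbitDim_smul (k : SO N) (x : NilCone N) : orbitDim (k • x) = orbitDim x := by
  refine le_antisymm ?_ (orbitDim_le_smul k x)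
  simpa using orbitDim_le_smul k⁻¹ (k • x)

theorem NilpotentOrbit.orbitDim_eq {O : NilpotentOrbit N} {y : NilCone N} (hy : y ∈ O.orbit) :
    orbitDim y = O.dim := by
  have h : y ∈ MulAction.orbit (SO N) O.out := by
    rwa [← MulAction.orbitRel.Quotient.orbit_eq_orbit_out O Quotient.out_eq'] 
  obtain ⟨k, rfl⟩ := h
  exact orbitDim_smul k _

open DerivedCategory

/-- The pushforward to `𝒩₁` of the sheaf of sections of a local system on an orbit. -/
def pushforwardSheaf (O : NilpotentOrbit N) (L : LocalSystem O.orbit) :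
    ComplexSheaf (TopCat.of (NilCone N)) :=
  (TopCat.Sheaf.pushforward (ModuleCat.{0} ℂ) O.inclusion).obj L.sheaf

/-- The lowest cohomology sheaf of `IC(𝒪, ℰ)`. -/
theorem IC_lowest (O : NilpotentOrbit N) (E : EquivariantLocalSystem (SO N) O.orbit) :
    (IC O E).IsGE (-(O.dim : ℤ)) ∧
      Nonempty ((Plus.homologyFunctor _ (-(O.dim : ℤ))).obj (IC O E) ≅
        pushforwardSheaf O E.toLocalSystem) := by
  refine deligneExtension_lowest (largeOrbits N) _ _ O.dim le_rfl ?_ _ inferInstance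
    (nonempty_homology_singleFunctor_iso _ _)
  intro k hk
  -- Only indices `k < dim O` occur, and for these the whole orbit lies in the open set `largeOrbits
  -- N k`.
  refine ⟨openExtensionPushforwardIso _ O.inclusion ?_ _⟩
  intro y
  change k < orbitDim y.1
  rwa [NilpotentOrbit.orbitDim_eq y.2]

/-- Otherwise the second complex would have no cohomology in degree `-dim O`, where the first has a
nonzero sheaf. -/
theorem dim_eq_of_IC_iso {O O' : NilpotentOrbit N} {E : EquivariantLocalSystem (SO N) O.orbit}
    {E' : EquivariantLocalSystem (SO N) O'.orbit} (e : IC O E ≅ IC O' E')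
    (h : ¬ Limits.IsZero (pushforwardSheaf O E.toLocalSystem)) : O'.dim ≥ O.dim := by
  by_contra! hlt
  obtain ⟨h1, ⟨i1⟩⟩ := IC_lowest O E
  obtain ⟨h2, ⟨i2⟩⟩ := IC_lowest O' E'
  exact h ((Plus.isZero_homology_of_isGE (IC O' E') (-(O'.dim : ℤ)) (-(O.dim : ℤ)) (by lia)).of_iso
    (i1.symm ≪≫ (Plus.homologyFunctor _ _).mapIso e))

theorem nonempty_pushforwardSheaf_iso {O O' : NilpotentOrbit N}
    {E : EquivariantLocalSystem (SO N) O.orbit}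
    {E' : EquivariantLocalSystem (SO N) O'.orbit} (e : IC O E ≅ IC O' E')
    (h : ¬ Limits.IsZero (pushforwardSheaf O E.toLocalSystem))
    (h' : ¬ Limits.IsZero (pushforwardSheaf O' E'.toLocalSystem)) :
    Nonempty (pushforwardSheaf O E.toLocalSystem ≅ pushforwardSheaf O' E'.toLocalSystem) := by
  have hd : O.dim = O'.dim := le_antisymm (dim_eq_of_IC_iso e h) (dim_eq_of_IC_iso e.symm h')
  obtain ⟨-, ⟨i1⟩⟩ := IC_lowest O E
  obtain ⟨-, ⟨i2⟩⟩ := IC_lowest O' E'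
  rw [← hd] at i2
  exact ⟨i1.symm ≪≫ (Plus.homologyFunctor _ _).mapIso e ≪≫ i2⟩

/-- The complex uses only the sheaf of sections. The group action on the local system does not enter
its construction. -/
theorem nonempty_IC_iso {O : NilpotentOrbit N} {E E' : EquivariantLocalSystem (SO N) O.orbit}
    (h : Nonempty (E.sheaf ≅ E'.sheaf)) : Nonempty (IC O E ≅ IC O E') := by
  obtain ⟨e⟩ := h
  have key : ∀ (U : ℕ → Opens (TopCat.of (NilCone N))) (d : ℕ)
      (F G : DerivedCategory.Plus (ComplexSheaf (TopCat.of (NilCone N)))),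
      Nonempty (F ≅ G) → Nonempty (deligneExtension U d F ≅ deligneExtension U d G) := by
    intro U d
    induction d with
    | zero => exact fun F G h => h
    | succ d ih => exact fun F G ⟨h⟩ => ih _ _ ⟨(truncatedExtension _ _).mapIso h⟩
  exact key _ _ _ _ ⟨Functor.mapIso _ (Functor.mapIso _ e)⟩

end Orbits

/-! ## Self-adjoint nilpotent endomorphisms of quadratic spaces -/

section JordanSystems

variable {V : Type*} [AddCommGroup V] [Module ℂ V]

/-- A nondegenerate symmetric form together with a nilpotent self-adjoint endomorphism. -/
structure SymmPair (B : LinearMap.BilinForm ℂ V) (x : Module.End ℂ V) : Prop where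
  symm : ∀ u v, B u v = B v u
  nondeg : ∀ u, (∀ v, B u v = 0) → u = 0
  selfadj : ∀ u v, B (x u) v = B u (x v)
  nilp : IsNilpotent x

variable {B : LinearMap.BilinForm ℂ V} {x : Module.End ℂ V}

theorem SymmPair.selfadj_pow (h : SymmPair B x) (k : ℕ) (u v : V) :
    B ((x ^ k) u) v = B u ((x ^ k) v) := by
  induction k generalizing u v with
  | zero => rfl
  | succ k ih => rw [pow_succ, Module.End.mul_apply, ih, h.selfadj, ← Module.End.mul_apply,
      ← pow_succ', pow_succ]

theorem pow_apply_pow (k l : ℕ) (u : V) : (x ^ k) ((x ^ l) u) = (x ^ (k + l)) u := by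
  rw [pow_add, Module.End.mul_apply]

theorem pow_apply_eq_zero {m k : ℕ} {u : V} (h : (x ^ m) u = 0) (hk : m ≤ k) : (x ^ k) u = 0 := by
  obtain ⟨c, rfl⟩ := Nat.exists_eq_add_of_le' hk
  rw [pow_add, Module.End.mul_apply, h, map_zero]

/-- Generators of cyclic submodules, of length `j a + 1`, which are pairwise orthogonal and on which
the form is in normal position. -/
structure JordanSystem {ι : Type} [DecidableEq ι] (B : LinearMap.BilinForm ℂ V) (x : Module.End ℂ V)
    (j : ι → ℕ) (v : ι → V) : Prop where
  kill : ∀ a, (x ^ (j a + 1)) (v a) = 0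
  gram : ∀ a b k, B (v a) ((x ^ k) (v b)) = if a = b ∧ k = j a then 1 else 0

/-- The indices of the vectors `x ^ l • v a`. -/
abbrev JordanIndex {ι : Type} (j : ι → ℕ) : Type := Σ a, Fin (j a + 1)

/-- The vectors `x ^ l • v a`. -/
def jordanVec {ι : Type} {j : ι → ℕ} (x : Module.End ℂ V) (v : ι → V) (p : JordanIndex j) : V :=
  (x ^ (p.2 : ℕ)) (v p.1)

variable {ι : Type} [DecidableEq ι] {j : ι → ℕ} {v : ι → V}

theorem JordanSystem.gram' (hS : SymmPair B x) (h : JordanSystem B x j v) (a b : ι) (k l : ℕ) :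
    B ((x ^ k) (v a)) ((x ^ l) (v b)) = if a = b ∧ k + l = j a then 1 else 0 := by
  rw [hS.selfadj_pow, pow_apply_pow, h.gram]

/-- Reversing each chain yields the dual family. This gives both linear independence and an explicit
formula for coordinates. -/
theorem JordanSystem.gram_rev (hS : SymmPair B x) (h : JordanSystem B x j v)
    (p q : JordanIndex j) :
    B (jordanVec x v p) ((x ^ (j q.1 - q.2)) (v q.1)) = if p = q then 1 else 0 := by
  obtain ⟨a, k⟩ := p
  obtain ⟨b, l⟩ := q
  rw [jordanVec, h.gram' hS]
  by_cases hab : a = b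
  · subst hab
    have : ((k : ℕ) + (j a - l) = j a) ↔ k = l := by
      rw [Fin.ext_iff]; have := l.2; omega
    simp [this]
  · simp [hab]

variable [Fintype ι]

theorem JordanSystem.sum_gram_rev (hS : SymmPair B x) (h : JordanSystem B x j v)
    (c : JordanIndex j → ℂ) (q : JordanIndex j) :
    B (∑ p, c p • jordanVec x v p) ((x ^ (j q.1 - q.2)) (v q.1)) = c q := by
  rw [map_sum, LinearMap.sum_apply]
  simp [h.gram_rev hS]

theorem JordanSystem.linearIndependent (hS : SymmPair B x) (h : JordanSystem B x j v) :
    LinearIndependent ℂ (jordanVec (j := j) x v) := by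
  rw [Fintype.linearIndependent_iff]
  intro c hc q
  rw [← h.sum_gram_rev hS c q, hc, map_zero, LinearMap.zero_apply]

omit [DecidableEq ι] in
theorem card_jordanIndex : Fintype.card (JordanIndex j) = ∑ a, (j a + 1) := by
  simp [JordanIndex]

variable [FiniteDimensional ℂ V]

theorem JordanSystem.sum_le (hS : SymmPair B x) (h : JordanSystem B x j v) :
    ∑ a, (j a + 1) ≤ Module.finrank ℂ V := by
  rw [← card_jordanIndex]
  exact (h.linearIndependent hS).fintype_card_le_finrank

omit [FiniteDimensional ℂ V] in
/-- A nonzero `x`-stable subspace on which the form is nondegenerate contains a vector that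
generates a nondegenerate cyclic submodule of maximal length. -/
theorem SymmPair.exists_aniso (hS : SymmPair B x) (W : Submodule ℂ V)
    (hW : ∀ w ∈ W, x w ∈ W) (hne : W ≠ ⊥) (hnd : ∀ w ∈ W, (∀ w' ∈ W, B w w' = 0) → w = 0) :
    ∃ j : ℕ, (∀ w ∈ W, (x ^ (j + 1)) w = 0) ∧ ∃ v ∈ W, B v ((x ^ j) v) ≠ 0 := by
  classical
  have hpow : ∀ k, ∀ w ∈ W, (x ^ k) w ∈ W := by
    intro k
    induction k with
    | zero => intro w hw; simpa using hw
    | succ k ih => intro w hw; rw [pow_succ', Module.End.mul_apply]; exact hW _ (ih w hw)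
  have hex : ∃ m, ∀ w ∈ W, (x ^ m) w = 0 := by
    obtain ⟨m, hm⟩ := hS.nilp
    exact ⟨m, fun w _ => by rw [hm]; rfl⟩
  -- `j + 1` is the nilpotency index of `x` on `W`. It is positive because `W` is nonzero.
  obtain ⟨j, hj⟩ : ∃ j, Nat.find hex = j + 1 := by
    refine Nat.exists_eq_succ_of_ne_zero fun h0 => hne ?_
    rw [Submodule.eq_bot_iff]
    intro w hw
    have := Nat.find_spec hex w hw
    rw [h0] at this
    simpa using this
  refine ⟨j, fun w hw => by rw [← hj]; exact Nat.find_spec hex w hw, ?_⟩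
  have hmin := Nat.find_min hex (m := j) (by omega)
  push Not at hmin
  obtain ⟨w, hw, hw0⟩ := hmin
  obtain ⟨w', hw', hww'⟩ : ∃ w' ∈ W, B ((x ^ j) w) w' ≠ 0 := by
    by_contra! hcon
    exact hw0 (hnd _ (hpow j w hw) hcon)
  -- Polarization: the symmetric form `B u (x^j w)` is nonzero on `W`, so it cannot vanish on the
  -- diagonal.
  by_contra! hcon
  have e1 := hcon w hw
  have e2 := hcon w' hw'
  have e3 := hcon (w + w') (W.add_mem hw hw')
  rw [map_add, map_add, map_add, LinearMap.add_apply, LinearMap.add_apply, e1, e2,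
    hS.symm w' , hS.selfadj_pow] at e3
  rw [hS.selfadj_pow] at hww'
  apply hww'
  linear_combination e3 / 2

omit [FiniteDimensional ℂ V] in
/-- A vector generating a nondegenerate cyclic submodule can be put in normal position. -/
theorem SymmPair.exists_normal (hS : SymmPair B x) (W : Submodule ℂ V)
    (hW : ∀ w ∈ W, x w ∈ W) {j : ℕ} (u : V) (hu : u ∈ W) (hu0 : (x ^ (j + 1)) u = 0)
    (huj : B u ((x ^ j) u) ≠ 0) :
    ∃ v ∈ W, (x ^ (j + 1)) v = 0 ∧ ∀ k, B v ((x ^ k) v) = if k = j then 1 else 0 := by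
  have hpow : ∀ k, ∀ w ∈ W, (x ^ k) w ∈ W := by
    intro k
    induction k with
    | zero => intro w hw; simpa using hw
    | succ k ih => intro w hw; rw [pow_succ', Module.End.mul_apply]; exact hW _ (ih w hw)
  -- The unwanted values `B v (x^k v)` are killed from the top downwards. After `m` rounds those
  -- with `j - m ≤ k < j` are gone.
  have key : ∀ m, ∃ v ∈ W, (x ^ (j + 1)) v = 0 ∧ B v ((x ^ j) v) = 1 ∧
      ∀ k, k < j → j ≤ k + m → B v ((x ^ k) v) = 0 := by
    intro m
    induction m with
    | zero =>
      -- A square root of the leading value, used to rescale it to 1.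
      obtain ⟨c, hc⟩ := IsAlgClosed.exists_pow_nat_eq (B u ((x ^ j) u)) (n := 2) (by norm_num)
      have hc0 : c ≠ 0 := by rintro rfl; apply huj; rw [← hc]; simp
      refine ⟨c⁻¹ • u, W.smul_mem _ hu, by rw [map_smul, hu0, smul_zero], ?_, fun k hk hk' => by omega⟩
      rw [map_smul, map_smul, map_smul, LinearMap.smul_apply, ← hc, smul_eq_mul, smul_eq_mul]
      field_simp
    | succ m ih =>
      obtain ⟨v, hv, hv0, hv1, hvk⟩ := ih
      by_cases hm : m + 1 ≤ j
      · obtain ⟨i, rfl⟩ : ∃ i, j = i + (m + 1) := ⟨j - (m + 1), by omega⟩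
        have hz : ∀ k, i + (m + 1) < k → (x ^ k) v = 0 := fun k hk => pow_apply_eq_zero hv0 (by omega)
        have hexp : ∀ (a : ℂ) k, B (v + a • (x ^ (m + 1)) v) ((x ^ k) (v + a • (x ^ (m + 1)) v)) =
            B v ((x ^ k) v) + 2 * a * B v ((x ^ (k + (m + 1))) v)
              + a ^ 2 * B v ((x ^ (k + (m + 1) + (m + 1))) v) := by
          intro a k
          simp only [map_add, map_smul, LinearMap.add_apply, LinearMap.smul_apply, smul_eq_mul,
            hS.selfadj_pow, pow_apply_pow]
          rw [show m + 1 + k = k + (m + 1) by ring, show m + 1 + (k + (m + 1)) = k + (m + 1) + (m + 1) by ring]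
          ring
        -- Adding `a • x^(m+1) v` changes the value at `i = j - m - 1` by `2a`. The quadratic term
        -- sits beyond `j` there, and the values above `i` do not change.
        refine ⟨v + (-(B v ((x ^ i) v)) / 2) • (x ^ (m + 1)) v,
          W.add_mem hv (W.smul_mem _ (hpow _ _ hv)), ?_, ?_, ?_⟩
        · rw [map_add, map_smul, hv0, pow_apply_pow,
            hz (i + (m + 1) + 1 + (m + 1)) (by omega)]; simp
        · rw [hexp, hv1, hz (i + (m + 1) + (m + 1)) (by omega),
            hz (i + (m + 1) + (m + 1) + (m + 1)) (by omega)]; simp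
        · intro k hk hk'
          rw [hexp, hz (k + (m + 1) + (m + 1)) (by omega)]
          rcases Nat.lt_or_ge i k with hik | hik
          · rw [hvk k hk (by omega), hz (k + (m + 1)) (by omega)]; simp
          · obtain rfl : k = i := by omega
            rw [hv1]; simp; ring
      · exact ⟨v, hv, hv0, hv1, fun k hk hk' => hvk k hk (by omega)⟩
  obtain ⟨v, hv, hv0, hv1, hvk⟩ := key j
  refine ⟨v, hv, hv0, fun k => ?_⟩
  split_ifs with hk
  · rw [hk, hv1]
  · rcases Nat.lt_or_ge k j with h | h
    · exact hvk k h (by omega)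
    · rw [pow_apply_eq_zero hv0 (by omega), map_zero]

omit [FiniteDimensional ℂ V] in
/-- A Jordan system that is not full can be extended. -/
theorem JordanSystem.exists_extension (hS : SymmPair B x) (h : JordanSystem B x j v)
    (hlt : ∑ a, (j a + 1) < Module.finrank ℂ V) :
    ∃ (j₀ : ℕ) (v₀ : V), JordanSystem B x (fun o : Option ι => o.elim j₀ j)
      (fun o : Option ι => o.elim v₀ v) := by
  let W : Submodule ℂ V := ⨅ (a : ι) (k : ℕ), LinearMap.ker (B.flip ((x ^ k) (v a)))
  have hW : ∀ w, w ∈ W ↔ ∀ a k, B w ((x ^ k) (v a)) = 0 := by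
    intro w
    simp [W, Submodule.mem_iInf, LinearMap.mem_ker]
  -- Orthogonal projection to the span of the system, written in the dual family. `W` is the
  -- orthogonal complement of this span.
  let pr : V → V := fun u => ∑ p : JordanIndex j, B u ((x ^ (j p.1 - p.2)) (v p.1)) • jordanVec x v p
  have hdec : ∀ u, u - pr u ∈ W := by
    intro u
    rw [hW]
    intro a k
    by_cases hk : k ≤ j a
    · have := h.sum_gram_rev hS (fun p => B u ((x ^ (j p.1 - p.2)) (v p.1)))
        ⟨a, ⟨j a - k, by omega⟩⟩
      simp only [Nat.sub_sub_self hk] at this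
      rw [map_sub, LinearMap.sub_apply, this, sub_self]
    · rw [pow_apply_eq_zero (h.kill a) (by omega), map_zero]
  have hprW : ∀ w ∈ W, ∀ u, B w (pr u) = 0 := by
    intro w hw u
    simp only [pr, map_sum, map_smul]
    refine Finset.sum_eq_zero fun p _ => ?_
    rw [jordanVec, (hW w).1 hw, smul_zero]
  have hWx : ∀ w ∈ W, x w ∈ W := by
    intro w hw
    rw [hW] at hw ⊢
    intro a k
    rw [hS.selfadj, ← Module.End.mul_apply, ← pow_succ', hw]
  have hne : W ≠ ⊥ := by
    intro hbot
    have hspan : Submodule.span ℂ (Set.range (jordanVec (j := j) x v)) = ⊤ := by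
      rw [eq_top_iff]
      rintro u -
      have hu := hdec u
      rw [hbot, Submodule.mem_bot, sub_eq_zero] at hu
      rw [hu]
      exact Submodule.sum_mem _ fun p _ => Submodule.smul_mem _ _ (Submodule.subset_span ⟨p, rfl⟩)
    have := finrank_range_le_card (R := ℂ) (jordanVec (j := j) x v)
    rw [Set.finrank, hspan, finrank_top, card_jordanIndex] at this
    omega
  -- The form is nondegenerate on `W`: any `u` differs from an element of `W` by `pr u`, which is
  -- orthogonal to `W`.
  obtain ⟨j₀, hj₀, u, hu, huj⟩ := hS.exists_aniso W hWx hne (by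
    intro w hw hww
    refine hS.nondeg w fun u => ?_
    rw [← sub_add_cancel u (pr u), map_add, hprW w hw, hww _ (hdec u), add_zero])
  obtain ⟨v₀, hv₀, h0, h1⟩ := hS.exists_normal W hWx u hu (hj₀ u hu) huj
  rw [hW] at hv₀
  refine ⟨j₀, v₀, ⟨?_, ?_⟩⟩
  · rintro (_ | a)
    · exact h0
    · exact h.kill a
  · rintro (_ | a) (_ | b) k
    · simpa using h1 k
    · simpa using hv₀ b k
    · simpa [hS.symm (v a), hS.selfadj_pow] using hv₀ a k
    · simpa using h.gram a b k

/-- Every Jordan system is contained in a full one. -/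
theorem JordanSystem.exists_full (hS : SymmPair B x) (h : JordanSystem B x j v) :
    ∃ (κ : Type) (_ : Fintype κ) (_ : DecidableEq κ) (j' : κ → ℕ) (v' : κ → V),
      JordanSystem B x j' v' ∧ ∑ a, (j' a + 1) = Module.finrank ℂ V ∧ ∀ a, ∃ a', j' a' = j a := by
  obtain ⟨n, hn⟩ : ∃ n, Module.finrank ℂ V - ∑ a, (j a + 1) = n := ⟨_, rfl⟩
  induction n using Nat.strong_induction_on generalizing ι with
  | _ n ih =>
    rcases (h.sum_le hS).lt_or_eq with hlt | heq
    · obtain ⟨j₀, v₀, h'⟩ := h.exists_extension hS hlt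
      have hsum : ∑ o : Option ι, ((fun o : Option ι => o.elim j₀ j) o + 1) =
        j₀ + 1 + ∑ a, (j a + 1) := by rw [Fintype.sum_option]; rfl
      obtain ⟨κ, i1, i2, j', v', h1, h2, h3⟩ := ih _ (by rw [hsum]; omega) h' rfl
      exact ⟨κ, i1, i2, j', v', h1, h2, fun a => h3 (some a)⟩
    · exact ⟨ι, inferInstance, inferInstance, j, v, h, heq, fun a => ⟨a, rfl⟩⟩

end JordanSystems

/-! ### Jordan bases, ranks of powers and the classification up to isometry. -/

section FullJordanSystems

variable {V : Type*} [AddCommGroup V] [Module ℂ V] [FiniteDimensional ℂ V]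
  {B : LinearMap.BilinForm ℂ V} {x : Module.End ℂ V}
  {ι : Type} [DecidableEq ι] [Fintype ι] {j : ι → ℕ} {v : ι → V}

/-- The basis given by a full Jordan system. -/
def JordanSystem.basis (hS : SymmPair B x) (h : JordanSystem B x j v)
    (hfull : ∑ a, (j a + 1) = Module.finrank ℂ V) : Module.Basis (JordanIndex j) ℂ V :=
  Module.Basis.mk (h.linearIndependent hS)
    ((h.linearIndependent hS).span_eq_top_of_card_eq_finrank'
      (by rw [card_jordanIndex, hfull])).ge

theorem JordanSystem.basis_apply (hS : SymmPair B x) (h : JordanSystem B x j v)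
    (hfull : ∑ a, (j a + 1) = Module.finrank ℂ V) (p : JordanIndex j) :
    h.basis hS hfull p = jordanVec x v p := by
  simp [JordanSystem.basis]

theorem JordanSystem.expand (hS : SymmPair B x) (h : JordanSystem B x j v)
    (hfull : ∑ a, (j a + 1) = Module.finrank ℂ V) (u : V) :
    u = ∑ p : JordanIndex j, B u ((x ^ (j p.1 - p.2)) (v p.1)) • jordanVec x v p := by
  have hu := ((h.basis hS hfull).sum_repr u).symm
  simp only [h.basis_apply hS hfull] at hu
  conv_lhs => rw [hu]
  refine Finset.sum_congr rfl fun p _ => ?_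
  congr 1
  conv_rhs => rw [hu]
  rw [h.sum_gram_rev hS]

/-- Applying `x^k` drops the first `k` vectors of every chain. Truncated subtraction accounts for
chains that disappear. -/
theorem JordanSystem.finrank_range_pow (hS : SymmPair B x) (h : JordanSystem B x j v)
    (hfull : ∑ a, (j a + 1) = Module.finrank ℂ V) (k : ℕ) :
    Module.finrank ℂ (LinearMap.range (x ^ k)) = ∑ a, (j a + 1 - k) := by
  let f : (Σ a, Fin (j a + 1 - k)) → JordanIndex j := fun q => ⟨q.1, ⟨q.2 + k, by omega⟩⟩
  have hf : Function.Injective f := by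
    rintro ⟨a, l⟩ ⟨b, m⟩ hab
    simp only [f, Sigma.mk.injEq] at hab
    obtain ⟨rfl, hab⟩ := hab
    simpa [Fin.ext_iff] using hab
  have hli := (h.linearIndependent hS).comp f hf
  have hr : LinearMap.range (x ^ k) = Submodule.span ℂ (Set.range (jordanVec x v ∘ f)) := by
    apply le_antisymm
    · rintro _ ⟨u, rfl⟩
      rw [h.expand hS hfull u, map_sum]
      refine Submodule.sum_mem _ fun p _ => ?_
      rw [map_smul]
      refine Submodule.smul_mem _ _ ?_
      rw [jordanVec, pow_apply_pow]
      by_cases hp : (p.2 : ℕ) + k ≤ j p.1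
      · refine Submodule.subset_span ⟨⟨p.1, ⟨p.2, by omega⟩⟩, ?_⟩
        simp [f, jordanVec, add_comm]
      · rw [pow_apply_eq_zero (h.kill p.1) (by omega)]
        exact Submodule.zero_mem _
    · rw [Submodule.span_le]
      rintro _ ⟨q, rfl⟩
      refine ⟨(x ^ (q.2 : ℕ)) (v q.1), ?_⟩
      rw [pow_apply_pow]
      simp [f, jordanVec, add_comm]
  rw [hr, finrank_span_eq_card hli]
  simp

omit [DecidableEq ι] in
/-- The lengths in two full Jordan systems agree if the powers have the same ranks. -/
theorem exists_equiv_of_sum_eq {κ : Type} [Fintype κ] {j' : κ → ℕ}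
    (h : ∀ k, ∑ a, (j a + 1 - k) = ∑ b, (j' b + 1 - k)) : ∃ e : ι ≃ κ, ∀ a, j' (e a) = j a := by
  classical
  -- The number of chains of length `k + 1` is a second difference of the ranks, written without
  -- subtraction.
  have hcard : ∀ {τ : Type} [Fintype τ] (i : τ → ℕ) (k : ℕ),
      Fintype.card {a // i a = k} + 2 * ∑ a, (i a + 1 - (k + 1)) =
        ∑ a, (i a + 1 - k) + ∑ a, (i a + 1 - (k + 2)) := by
    intro τ _ i k
    rw [Fintype.card_subtype, Finset.card_filter, Finset.mul_sum, ← Finset.sum_add_distrib,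
      ← Finset.sum_add_distrib]
    refine Finset.sum_congr rfl fun a _ => ?_
    split_ifs <;> omega
  have hc : ∀ k, Fintype.card {a // j a = k} = Fintype.card {b // j' b = k} := by
    intro k
    have h1 := hcard j k
    have h2 := hcard j' k
    rw [h, h, h] at h1
    omega
  refine ⟨(Equiv.sigmaFiberEquiv j).symm.trans
    ((Equiv.sigmaCongrRight fun k => Fintype.equivOfCardEq (hc k)).trans
      (Equiv.sigmaFiberEquiv j')), fun a => ?_⟩
  simp only [Equiv.trans_apply, Equiv.sigmaFiberEquiv, Equiv.coe_fn_symm_mk, Equiv.coe_fn_mk,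
    Equiv.sigmaCongrRight_apply]
  exact (Fintype.equivOfCardEq (hc (j a)) ⟨a, rfl⟩).2

/-- Two pairs with full Jordan systems of the same lengths are isometric. -/
theorem JordanSystem.exists_isometry {V' : Type*} [AddCommGroup V'] [Module ℂ V']
    [FiniteDimensional ℂ V'] {B' : LinearMap.BilinForm ℂ V'} {x' : Module.End ℂ V'}
    {κ : Type} [DecidableEq κ] [Fintype κ] {j' : κ → ℕ} {v' : κ → V'}
    (hS : SymmPair B x) (h : JordanSystem B x j v)
    (hfull : ∑ a, (j a + 1) = Module.finrank ℂ V)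
    (hS' : SymmPair B' x') (h' : JordanSystem B' x' j' v')
    (hfull' : ∑ a, (j' a + 1) = Module.finrank ℂ V')
    (e : ι ≃ κ) (he : ∀ a, j' (e a) = j a) :
    ∃ g : V ≃ₗ[ℂ] V', (∀ u w, B' (g u) (g w) = B u w) ∧ ∀ u, g (x u) = x' (g u) := by
  let E : JordanIndex j ≃ JordanIndex j' := Equiv.sigmaCongr e
    (fun a => finCongr (by rw [he]))
  let g := (h.basis hS hfull).equiv (h'.basis hS' hfull') E
  have hg : ∀ a l, g ((x ^ l) (v a)) = (x' ^ l) (v' (e a)) := by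
    intro a l
    by_cases hl : l < j a + 1
    · have h1 : (x ^ l) (v a) = h.basis hS hfull ⟨a, ⟨l, hl⟩⟩ := by
        rw [h.basis_apply]; rfl
      rw [h1, Module.Basis.equiv_apply, h'.basis_apply]
      rfl
    · rw [pow_apply_eq_zero (h.kill a) (by omega), map_zero,
        pow_apply_eq_zero (h'.kill (e a)) (by rw [he]; omega)]
  refine ⟨g, ?_, ?_⟩
  · have : B'.compl₁₂ g.toLinearMap g.toLinearMap = B := by
      refine (h.basis hS hfull).ext fun p => (h.basis hS hfull).ext fun q => ?_
      rw [LinearMap.compl₁₂_apply, h.basis_apply, h.basis_apply, jordanVec, jordanVec,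
        LinearEquiv.coe_coe, hg, hg, h.gram' hS, h'.gram' hS', he]
      simp
    intro u w
    rw [← this]; rfl
  · have : g.toLinearMap ∘ₗ x = x' ∘ₗ g.toLinearMap := by
      refine (h.basis hS hfull).ext fun p => ?_
      rw [h.basis_apply, jordanVec, LinearMap.comp_apply, LinearMap.comp_apply,
        LinearEquiv.coe_coe, hg, ← Module.End.mul_apply, ← Module.End.mul_apply, ← pow_succ',
        ← pow_succ', hg]
    intro u
    exact LinearMap.congr_fun this u

omit [FiniteDimensional ℂ V] [Fintype ι] in
/-- Isometric pairs have Jordan systems of the same lengths. -/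
theorem JordanSystem.map {V' : Type*} [AddCommGroup V'] [Module ℂ V']
    {B' : LinearMap.BilinForm ℂ V'} {x' : Module.End ℂ V'} (h : JordanSystem B x j v)
    (g : V ≃ₗ[ℂ] V') (hg : ∀ u w, B' (g u) (g w) = B u w) (hx : ∀ u, g (x u) = x' (g u)) :
    JordanSystem B' x' j (fun a => g (v a)) := by
  have hpow : ∀ k u, (x' ^ k) (g u) = g ((x ^ k) u) := by
    intro k
    induction k with
    | zero => intro u; rfl
    | succ k ih => intro u; rw [pow_succ, Module.End.mul_apply, ← hx, ih, pow_succ,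
        Module.End.mul_apply]
  exact ⟨fun a => by rw [hpow, h.kill, map_zero], fun a b k => by rw [hpow, hg, h.gram]⟩

/-- Every finite family of lengths is realised. -/
theorem exists_model {ι : Type} [DecidableEq ι] [Fintype ι] (j : ι → ℕ) :
    ∃ (B : LinearMap.BilinForm ℂ (JordanIndex j → ℂ)) (x : Module.End ℂ (JordanIndex j → ℂ))
      (v : ι → JordanIndex j → ℂ), SymmPair B x ∧ JordanSystem B x j v := by
  let b := Pi.basisFun ℂ (JordanIndex j)
  -- A shift on every block. The form is the antidiagonal one, which makes the shift self-adjoint.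
  let x : Module.End ℂ (JordanIndex j → ℂ) := b.constr ℂ fun p =>
    if h : (p.2 : ℕ) + 1 < j p.1 + 1 then b ⟨p.1, ⟨p.2 + 1, h⟩⟩ else 0
  let B : LinearMap.BilinForm ℂ (JordanIndex j → ℂ) := b.constr ℂ fun p =>
    b.constr ℂ fun q => if p.1 = q.1 ∧ (p.2 : ℕ) + q.2 = j p.1 then (1 : ℂ) else 0
  have hB : ∀ p q, B (b p) (b q) = if p.1 = q.1 ∧ (p.2 : ℕ) + q.2 = j p.1 then (1 : ℂ) else 0 := by
    intro p q
    simp only [B, Module.Basis.constr_basis]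
  have hx : ∀ p : JordanIndex j, x (b p) =
      if h : (p.2 : ℕ) + 1 < j p.1 + 1 then b ⟨p.1, ⟨p.2 + 1, h⟩⟩ else 0 := by
    intro p
    simp only [x, Module.Basis.constr_basis]
  have hpow : ∀ a l, (x ^ l) (b ⟨a, 0⟩) = if h : l < j a + 1 then b ⟨a, ⟨l, h⟩⟩ else 0 := by
    intro a l
    induction l with
    | zero => rw [dif_pos (by omega)]; rfl
    | succ l ih =>
      rw [pow_succ', Module.End.mul_apply, ih]
      by_cases h : l < j a + 1
      · rw [dif_pos h, hx]
      · rw [dif_neg h, dif_neg (by omega), map_zero]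
  have hb : ∀ p : JordanIndex j, b p = (x ^ (p.2 : ℕ)) (b ⟨p.1, 0⟩) := by
    intro p
    rw [hpow, dif_pos p.2.2]
  have hself : ∀ u v, B (x u) v = B u (x v) := by
    have : LinearMap.comp B x = LinearMap.compl₂ B x := by
      refine b.ext fun p => b.ext fun q => ?_
      rw [LinearMap.comp_apply, LinearMap.compl₂_apply, hx, hx]
      obtain ⟨a, k⟩ := p
      obtain ⟨c, l⟩ := q
      by_cases hac : a = c
      · subst hac
        split_ifs with h1 h2 h2
        · rw [hB, hB]
          simp only [true_and]
          congr 1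
          rw [eq_iff_iff]
          omega
        · rw [hB, map_zero, if_neg]
          simp only [true_and]
          simp only at h2
          omega
        · rw [hB, map_zero, LinearMap.zero_apply, if_neg]
          simp only [true_and]
          simp only at h1
          omega
        · simp
      · split_ifs with h1 h2 h2 <;> simp [hB, hac]
    intro u v
    exact LinearMap.congr_fun₂ this u v
  have hnil : x ^ (∑ a, (j a + 1)) = 0 := by
    refine b.ext fun p => ?_
    rw [hb p, pow_apply_pow, hpow, dif_neg, LinearMap.zero_apply]
    have := Finset.single_le_sum (f := fun a => j a + 1) (fun _ _ => by omega) (Finset.mem_univ p.1)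
    omega
  refine ⟨B, x, fun a => b ⟨a, 0⟩, ⟨?_, ?_, hself, ⟨_, hnil⟩⟩, ⟨?_, ?_⟩⟩
  · have : B = LinearMap.flip B := by
      refine b.ext fun p => b.ext fun q => ?_
      rw [LinearMap.flip_apply, hB, hB]
      congr 1
      rw [eq_iff_iff]
      constructor
      · rintro ⟨h1, h2⟩; exact ⟨h1.symm, by have := congrArg j h1; omega⟩
      · rintro ⟨h1, h2⟩; exact ⟨h1.symm, by have := congrArg j h1; omega⟩
    intro u v
    exact LinearMap.congr_fun₂ this u v
  · intro u hu
    rw [← b.sum_repr u]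
    refine Finset.sum_eq_zero fun p _ => ?_
    -- The mirror position in the block is dual to `p`, so this pairing reads off the coordinate of
    -- `u` at `p`.
    have h1 := hu (b ⟨p.1, ⟨j p.1 - p.2, by omega⟩⟩)
    rw [← b.sum_repr u, map_sum, LinearMap.sum_apply, Finset.sum_eq_single p] at h1
    · rw [map_smul, LinearMap.smul_apply, hB, if_pos ⟨rfl, by simp; omega⟩] at h1
      rw [show b.repr u p = 0 by simpa using h1, zero_smul]
    · intro q _ hq
      rw [map_smul, LinearMap.smul_apply, hB, if_neg, smul_zero]
      rintro ⟨h2, h3⟩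
      apply hq
      obtain ⟨a, k⟩ := p
      obtain ⟨c, l⟩ := q
      simp only at h2
      subst h2
      simp only at h3
      congr 1
      ext
      omega
    · simp
  · intro a
    rw [hpow, dif_neg (by omega)]
  · intro a c k
    rw [hpow]
    split_ifs with h1 h2 h2
    · rw [hB, if_pos]; exact ⟨h2.1, by simpa using h2.2⟩
    · rw [hB, if_neg]; simpa using h2
    · exfalso; obtain ⟨rfl, rfl⟩ := h2; omega
    · simp

end FullJordanSystems

/-! ### Reflections in nondegenerate cyclic submodules. -/

section Reflections

variable {V : Type*} [AddCommGroup V] [Module ℂ V]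

/-- The vector `v` generates a nondegenerate cyclic submodule of length `j + 1`. -/
def Aniso (B : LinearMap.BilinForm ℂ V) (x : Module.End ℂ V) (j : ℕ) (v : V) : Prop :=
  (x ^ (j + 1)) v = 0 ∧ B v ((x ^ j) v) ≠ 0

/-- The Gram polynomial of the cyclic submodule generated by `v`. -/
def cyclicGram (B : LinearMap.BilinForm ℂ V) (x : Module.End ℂ V) (j : ℕ) (v : V) :
    Module.End ℂ V :=
  ∑ k ∈ Finset.range (j + 1), B v ((x ^ k) v) • x ^ (j - k)

/-- The orthogonal projection to the cyclic submodule generated by `v`, up to multiplication by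
the Gram polynomial. -/
def cyclicMap (B : LinearMap.BilinForm ℂ V) (x : Module.End ℂ V) (j : ℕ) (v : V) :
    Module.End ℂ V :=
  ∑ k ∈ Finset.range (j + 1), ((B v).comp (x ^ k)).smulRight ((x ^ (j - k)) v)

/-- The orthogonal projection to the cyclic submodule generated by `v`. -/
def cyclicProj (B : LinearMap.BilinForm ℂ V) (x : Module.End ℂ V) (j : ℕ) (v : V) :
    Module.End ℂ V :=
  Ring.inverse (cyclicGram B x j v) * cyclicMap B x j v

/-- The isometry which is `-1` on the cyclic submodule generated by `v` and `1` on its orthogonal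
complement. -/
def cyclicRefl (B : LinearMap.BilinForm ℂ V) (x : Module.End ℂ V) (j : ℕ) (v : V) :
    Module.End ℂ V :=
  1 - (2 : ℂ) • cyclicProj B x j v

/-- The isometries commuting with `x`. -/
structure IsCentralIsometry (B : LinearMap.BilinForm ℂ V) (x g : Module.End ℂ V) : Prop where
  isometry : ∀ u w, B (g u) (g w) = B u w
  comm : Commute g x

variable {B : LinearMap.BilinForm ℂ V} {x : Module.End ℂ V} {j : ℕ} {v : V}

theorem cyclicMap_apply (w : V) : cyclicMap B x j v w =
    ∑ k ∈ Finset.range (j + 1), B v ((x ^ k) w) • (x ^ (j - k)) v := by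
  simp [cyclicMap, LinearMap.sum_apply]

theorem cyclicGram_apply (w : V) : cyclicGram B x j v w =
    ∑ k ∈ Finset.range (j + 1), B v ((x ^ k) v) • (x ^ (j - k)) w := by
  simp [cyclicGram, LinearMap.sum_apply]

theorem cyclicMap_self : cyclicMap B x j v v = cyclicGram B x j v v := by
  rw [cyclicMap_apply, cyclicGram_apply]

theorem commute_ringInverse {R : Type*} [Ring R] {a b : R} (h : Commute a b) :
    Commute a (Ring.inverse b) := by
  by_cases hb : IsUnit b
  · obtain ⟨u, rfl⟩ := hb
    rw [Ring.inverse_unit]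
    exact h.units_inv_right
  · rw [Ring.inverse_non_unit _ hb]
    exact Commute.zero_right a

theorem commute_cyclicGram {g : Module.End ℂ V} (hg : Commute g x) :
    Commute g (cyclicGram B x j v) :=
  Commute.sum_right _ _ _ fun k _ => (hg.pow_right (j - k)).smul_right _

/-- The term `k = j` is a nonzero scalar. All the others are multiples of the nilpotent `x` and
commute with it. -/
theorem isUnit_cyclicGram (hS : SymmPair B x) (hv : Aniso B x j v) :
    IsUnit (cyclicGram B x j v) := by
  rw [cyclicGram, Finset.sum_range_succ, Nat.sub_self, pow_zero]
  have hfac : ∑ k ∈ Finset.range j, B v ((x ^ k) v) • x ^ (j - k) =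
      x * ∑ k ∈ Finset.range j, B v ((x ^ k) v) • x ^ (j - k - 1) := by
    rw [Finset.mul_sum]
    refine Finset.sum_congr rfl fun k hk => ?_
    rw [mul_smul_comm, ← pow_succ', show j - k - 1 + 1 = j - k by
      have := Finset.mem_range.1 hk; omega]
  have hn : IsNilpotent (∑ k ∈ Finset.range j, B v ((x ^ k) v) • x ^ (j - k)) := by
    rw [hfac]
    refine Commute.isNilpotent_mul_right ?_ hS.nilp
    exact Commute.sum_right _ _ _ fun k _ => ((Commute.refl x).pow_right _).smul_right _
  have hu : IsUnit (B v ((x ^ j) v) • (1 : Module.End ℂ V)) := by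
    rw [← Algebra.algebraMap_eq_smul_one]
    exact (IsUnit.mk0 _ hv.2).map _
  refine hn.isUnit_add_right_of_commute hu ?_
  exact (Commute.one_right _).smul_right _

theorem commute_inverse_cyclicGram {g : Module.End ℂ V} (hg : Commute g x) :
    Commute g (Ring.inverse (cyclicGram B x j v)) :=
  commute_ringInverse (commute_cyclicGram hg)

/-- The substitution `k ↦ j - k` exchanges the functional and the vector in each summand. -/
theorem cyclicMap_selfadj (hS : SymmPair B x) (u w : V) :
    B (cyclicMap B x j v u) w = B u (cyclicMap B x j v w) := by
  rw [cyclicMap_apply, cyclicMap_apply, map_sum, LinearMap.sum_apply, map_sum,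
    ← Finset.sum_range_reflect]
  refine Finset.sum_congr rfl fun k hk => ?_
  have hk := Finset.mem_range.1 hk
  rw [map_smul, LinearMap.smul_apply, map_smul, smul_eq_mul, smul_eq_mul,
    show j + 1 - 1 - k = j - k by omega, show j - (j - k) = k by omega, hS.selfadj_pow k v w,
    hS.symm v, hS.selfadj_pow]
  ring

theorem cyclicGram_selfadj (hS : SymmPair B x) (u w : V) :
    B (cyclicGram B x j v u) w = B u (cyclicGram B x j v w) := by
  rw [cyclicGram_apply, cyclicGram_apply, map_sum, LinearMap.sum_apply, map_sum]
  refine Finset.sum_congr rfl fun k hk => ?_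
  rw [map_smul, LinearMap.smul_apply, map_smul, hS.selfadj_pow]

theorem cyclicGram_inverse_apply (hS : SymmPair B x) (hv : Aniso B x j v) (u : V) :
    cyclicGram B x j v (Ring.inverse (cyclicGram B x j v) u) = u := by
  rw [← Module.End.mul_apply, Ring.mul_inverse_cancel _ (isUnit_cyclicGram hS hv),
    Module.End.one_apply]

theorem inverse_cyclicGram_apply (hS : SymmPair B x) (hv : Aniso B x j v) (u : V) :
    Ring.inverse (cyclicGram B x j v) (cyclicGram B x j v u) = u := by
  rw [← Module.End.mul_apply, Ring.inverse_mul_cancel _ (isUnit_cyclicGram hS hv),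
    Module.End.one_apply]

theorem inverse_cyclicGram_selfadj (hS : SymmPair B x) (hv : Aniso B x j v) (u w : V) :
    B (Ring.inverse (cyclicGram B x j v) u) w = B u (Ring.inverse (cyclicGram B x j v) w) := by
  conv_lhs => rw [← cyclicGram_inverse_apply hS hv w]
  rw [← cyclicGram_selfadj hS, cyclicGram_inverse_apply hS hv]

/-- Composing with `x` on either side shifts the summation index by one. The two boundary terms
vanish because `x^(j+1)` kills `v`. -/
theorem commute_cyclicMap (hS : SymmPair B x) (hv : Aniso B x j v) :
    Commute x (cyclicMap B x j v) := by
  ext w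
  rw [Module.End.mul_apply, Module.End.mul_apply, cyclicMap_apply, cyclicMap_apply, map_sum,
    Finset.sum_range_succ', Finset.sum_range_succ]
  have h1 : B v ((x ^ j) (x w)) = 0 := by
    rw [← Module.End.mul_apply, ← pow_succ, ← hS.selfadj_pow, hv.1, map_zero, LinearMap.zero_apply]
  have h2 : x ((x ^ (j - 0)) v) = 0 := by
    rw [← Module.End.mul_apply, ← pow_succ', Nat.sub_zero, hv.1]
  rw [h1, zero_smul, add_zero, map_smul, h2, smul_zero, add_zero]
  refine Finset.sum_congr rfl fun k hk => ?_
  have hk := Finset.mem_range.1 hk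
  rw [map_smul, ← Module.End.mul_apply, ← Module.End.mul_apply, ← pow_succ', ← pow_succ,
    show j - (k + 1) + 1 = j - k by omega]

theorem cyclicProj_apply (w : V) : cyclicProj B x j v w =
    Ring.inverse (cyclicGram B x j v) (cyclicMap B x j v w) := rfl

theorem commute_cyclicProj (hS : SymmPair B x) (hv : Aniso B x j v) :
    Commute x (cyclicProj B x j v) :=
  (commute_inverse_cyclicGram (Commute.refl x)).mul_right (commute_cyclicMap hS hv)

theorem cyclicProj_self (hS : SymmPair B x) (hv : Aniso B x j v) : cyclicProj B x j v v = v := by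
  rw [cyclicProj_apply, cyclicMap_self, inverse_cyclicGram_apply hS hv]

theorem cyclicProj_pow_self (hS : SymmPair B x) (hv : Aniso B x j v) (k : ℕ) :
    cyclicProj B x j v ((x ^ k) v) = (x ^ k) v := by
  rw [← Module.End.mul_apply, ← ((commute_cyclicProj hS hv).pow_left k).eq, Module.End.mul_apply,
    cyclicProj_self hS hv]

/-- Once the inverse Gram polynomial is moved to the right, the image visibly lies in the span of
the `x^k v`. Taking `W` to be a kernel or a range extends properties of the chain to the whole
image. -/
theorem cyclicProj_mem (hS : SymmPair B x) {W : Submodule ℂ V} (h : ∀ k, (x ^ k) v ∈ W) (w : V)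
    (hv : Aniso B x j v) : cyclicProj B x j v w ∈ W := by
  have hcomm : Commute (Ring.inverse (cyclicGram B x j v)) (cyclicMap B x j v) := by
    have : Commute (cyclicGram B x j v) (cyclicMap B x j v) :=
      (commute_cyclicGram (commute_cyclicMap hS hv).symm).symm
    exact (commute_ringInverse this.symm).symm
  rw [cyclicProj, hcomm.eq, Module.End.mul_apply, cyclicMap_apply]
  exact Submodule.sum_mem _ fun k _ => Submodule.smul_mem _ _ (h _)

theorem cyclicProj_idem (hS : SymmPair B x) (hv : Aniso B x j v) (w : V) :
    cyclicProj B x j v (cyclicProj B x j v w) = cyclicProj B x j v w := by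
  have := cyclicProj_mem hS (W := LinearMap.ker (cyclicProj B x j v - 1)) (v := v) (j := j)
    (fun k => by
      rw [LinearMap.mem_ker, LinearMap.sub_apply, cyclicProj_pow_self hS hv, Module.End.one_apply,
        sub_self]) w hv
  rwa [LinearMap.mem_ker, LinearMap.sub_apply, Module.End.one_apply, sub_eq_zero] at this

theorem cyclicProj_selfadj (hS : SymmPair B x) (hv : Aniso B x j v) (u w : V) :
    B (cyclicProj B x j v u) w = B u (cyclicProj B x j v w) := by
  have hcomm : Commute (Ring.inverse (cyclicGram B x j v)) (cyclicMap B x j v) := by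
    have : Commute (cyclicGram B x j v) (cyclicMap B x j v) :=
      (commute_cyclicGram (commute_cyclicMap hS hv).symm).symm
    exact (commute_ringInverse this.symm).symm
  rw [cyclicProj_apply, inverse_cyclicGram_selfadj hS hv, cyclicMap_selfadj hS,
    ← Module.End.mul_apply, ← hcomm.eq]
  rfl

theorem cyclicProj_eq_zero {w : V} (h : ∀ k, B v ((x ^ k) w) = 0) : cyclicProj B x j v w = 0 := by
  rw [cyclicProj_apply, cyclicMap_apply]
  simp [h]

theorem cyclicRefl_apply (w : V) : cyclicRefl B x j v w = w - (2 : ℂ) • cyclicProj B x j v w := by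
  simp [cyclicRefl]

theorem cyclicRefl_self (hS : SymmPair B x) (hv : Aniso B x j v) : cyclicRefl B x j v v = -v := by
  rw [cyclicRefl_apply, cyclicProj_self hS hv, two_smul]; abel

theorem cyclicRefl_eq_self {w : V} (h : ∀ k, B v ((x ^ k) w) = 0) : cyclicRefl B x j v w = w := by
  rw [cyclicRefl_apply, cyclicProj_eq_zero h, smul_zero, sub_zero]

theorem cyclicRefl_involutive (hS : SymmPair B x) (hv : Aniso B x j v) (w : V) :
    cyclicRefl B x j v (cyclicRefl B x j v w) = w := by
  rw [cyclicRefl_apply, cyclicRefl_apply, map_sub, map_smul, cyclicProj_idem hS hv]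
  module

theorem cyclicRefl_mul_self (hS : SymmPair B x) (hv : Aniso B x j v) :
    cyclicRefl B x j v * cyclicRefl B x j v = 1 := by
  ext w
  exact cyclicRefl_involutive hS hv w

/-- A self-adjoint involution is an isometry, and the projection commutes with `x`. -/
theorem cyclicRefl_isCentralIsometry (hS : SymmPair B x) (hv : Aniso B x j v) :
    IsCentralIsometry B x (cyclicRefl B x j v) := by
  refine ⟨fun u w => ?_, ?_⟩
  · have : ∀ u w, B (cyclicRefl B x j v u) w = B u (cyclicRefl B x j v w) := by
      intro u w
      rw [cyclicRefl_apply, cyclicRefl_apply, map_sub, map_sub, LinearMap.sub_apply, map_smul,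
        map_smul, LinearMap.smul_apply, cyclicProj_selfadj hS hv]
    rw [this, cyclicRefl_involutive hS hv]
  · exact ((Commute.one_right x).sub_right ((commute_cyclicProj hS hv).smul_right _)).symm

theorem IsCentralIsometry.mul {g h : Module.End ℂ V} (hg : IsCentralIsometry B x g)
    (hh : IsCentralIsometry B x h) : IsCentralIsometry B x (g * h) :=
  ⟨fun u w => by rw [Module.End.mul_apply, Module.End.mul_apply, hg.isometry, hh.isometry],
    hg.comm.mul_left hh.comm⟩

theorem IsCentralIsometry.pow_apply {g : Module.End ℂ V} (hg : IsCentralIsometry B x g) (k : ℕ)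
    (w : V) : (x ^ k) (g w) = g ((x ^ k) w) := by
  rw [← Module.End.mul_apply, ← (hg.comm.pow_right k).eq, Module.End.mul_apply]

theorem IsCentralIsometry.aniso {g : Module.End ℂ V} (hg : IsCentralIsometry B x g)
    (hv : Aniso B x j v) : Aniso B x j (g v) := by
  refine ⟨by rw [hg.pow_apply, hv.1, map_zero], ?_⟩
  rw [hg.pow_apply, hg.isometry]
  exact hv.2

/-- Reflections are permuted by conjugation. -/
theorem IsCentralIsometry.mul_cyclicRefl {g : Module.End ℂ V} (hg : IsCentralIsometry B x g) :
    g * cyclicRefl B x j v = cyclicRefl B x j (g v) * g := by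
  -- The Gram polynomial depends on `v` only through the values `B v (x^k v)`, which `g` preserves.
  have hT : cyclicGram B x j (g v) = cyclicGram B x j v := by
    simp only [cyclicGram, hg.pow_apply, hg.isometry]
  have hA : cyclicMap B x j (g v) * g = g * cyclicMap B x j v := by
    ext w
    simp only [Module.End.mul_apply, cyclicMap_apply, hg.pow_apply, hg.isometry, map_sum, map_smul]
  rw [cyclicRefl, cyclicRefl, mul_sub, sub_mul, mul_one, one_mul, mul_smul_comm, smul_mul_assoc,
    cyclicProj, cyclicProj, hT, mul_assoc, hA, ← mul_assoc, ← mul_assoc,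
    (commute_inverse_cyclicGram hg.comm).eq]

end Reflections

/-! ### Generation of the centralizer by reflections, and their determinants. -/

section Generation

variable {V : Type*} [AddCommGroup V] [Module ℂ V]
  {B : LinearMap.BilinForm ℂ V} {x : Module.End ℂ V} {j : ℕ} {v : V}

/-- The reflections attached to nondegenerate cyclic submodules. -/
def reflections (B : LinearMap.BilinForm ℂ V) (x : Module.End ℂ V) : Set (Module.End ℂ V) :=
  {s | ∃ j v, Aniso B x j v ∧ s = cyclicRefl B x j v}

/-- The Cartan–Dieudonné argument. The values of `B u (x^j u)` at `g v - v` and `g v + v` add up to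
four times the value at `v`, so one of the two vectors is anisotropic. Reflection in the difference
sends `g v` to `v`. Reflection in the sum sends `g v` to `-v`, and reflection in `v` repairs the
sign. -/
theorem exists_reflection_word (hS : SymmPair B x) {W : Submodule ℂ V}
    (hW : ∀ w ∈ W, x w ∈ W) (hj : ∀ w ∈ W, (x ^ (j + 1)) w = 0) (hv : Aniso B x j v) (hvW : v ∈ W)
    {g : Module.End ℂ V} (hg : IsCentralIsometry B x g) (hgv : g v ∈ W) :
    ∃ s t : Module.End ℂ V, t ∈ Submonoid.closure (reflections B x) ∧ t * s = 1 ∧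
      IsCentralIsometry B x s ∧ s (g v) = v ∧ ∀ u, (∀ w ∈ W, B w u = 0) → s u = u := by
  have hpow : ∀ k, ∀ w ∈ W, (x ^ k) w ∈ W := by
    intro k
    induction k with
    | zero => intro w hw; simpa using hw
    | succ k ih => intro w hw; rw [pow_succ', Module.End.mul_apply]; exact hW _ (ih w hw)
  have hfix : ∀ w ∈ W, ∀ u, (∀ w ∈ W, B w u = 0) → cyclicRefl B x j w u = u := by
    intro w hw u hu
    refine cyclicRefl_eq_self fun k => ?_
    rw [← hS.selfadj_pow]
    exact hu _ (hpow k w hw)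
  -- The cyclic modules of the two vectors are orthogonal, so each vector is fixed by the reflection
  -- in the other.
  have horth : ∀ k, B (g v - v) ((x ^ k) (g v + v)) = 0 ∧ B (g v + v) ((x ^ k) (g v - v)) = 0 := by
    intro k
    have h1 : B (g v) ((x ^ k) (g v)) = B v ((x ^ k) v) := by rw [hg.pow_apply, hg.isometry]
    have h2 : B (g v) ((x ^ k) v) = B v ((x ^ k) (g v)) := by rw [hS.symm, hS.selfadj_pow]
    constructor <;>
    · simp only [map_add, map_sub, LinearMap.add_apply, LinearMap.sub_apply, h1, h2]
      ring
  by_cases h : B (g v - v) ((x ^ j) (g v - v)) = 0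
  · have hu : Aniso B x j (g v + v) := by
      refine ⟨hj _ (W.add_mem hgv hvW), ?_⟩
      have h1 : B (g v) ((x ^ j) (g v)) = B v ((x ^ j) v) := by rw [hg.pow_apply, hg.isometry]
      intro h'
      apply hv.2
      simp only [map_add, map_sub, LinearMap.add_apply, LinearMap.sub_apply, h1] at h h'
      linear_combination (h + h') / 4
    refine ⟨cyclicRefl B x j v * cyclicRefl B x j (g v + v),
      cyclicRefl B x j (g v + v) * cyclicRefl B x j v,
      Submonoid.mul_mem _ (Submonoid.subset_closure ⟨j, _, hu, rfl⟩)
        (Submonoid.subset_closure ⟨j, _, hv, rfl⟩), ?_,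
      (cyclicRefl_isCentralIsometry hS hv).mul (cyclicRefl_isCentralIsometry hS hu), ?_, ?_⟩
    · rw [mul_assoc, ← mul_assoc (cyclicRefl B x j v), cyclicRefl_mul_self hS hv, one_mul,
        cyclicRefl_mul_self hS hu]
    · have h1 := cyclicRefl_self hS hu
      have h2 : cyclicRefl B x j (g v + v) (g v - v) = g v - v :=
        cyclicRefl_eq_self fun k => (horth k).2
      have h3 : cyclicRefl B x j (g v + v) (g v) = -v := by
        rw [map_add] at h1
        rw [map_sub] at h2
        have : (2 : ℂ) • cyclicRefl B x j (g v + v) (g v) = (2 : ℂ) • (-v) := by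
          rw [two_smul, two_smul]
          calc _ = (cyclicRefl B x j (g v + v) (g v) + cyclicRefl B x j (g v + v) v) +
            (cyclicRefl B x j (g v + v) (g v) - cyclicRefl B x j (g v + v) v) := by abel
            _ = _ := by rw [h1, h2]; abel
        exact smul_right_injective V (two_ne_zero' ℂ) this
      rw [Module.End.mul_apply, h3, map_neg, cyclicRefl_self hS hv, neg_neg]
    · intro u hu'
      rw [Module.End.mul_apply, hfix _ (W.add_mem hgv hvW) u hu', hfix v hvW u hu']
  · have hu : Aniso B x j (g v - v) := ⟨hj _ (W.sub_mem hgv hvW), h⟩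
    refine ⟨cyclicRefl B x j (g v - v), cyclicRefl B x j (g v - v),
      Submonoid.subset_closure ⟨j, _, hu, rfl⟩, cyclicRefl_mul_self hS hu,
      cyclicRefl_isCentralIsometry hS hu, ?_, hfix _ (W.sub_mem hgv hvW)⟩
    have h1 := cyclicRefl_self hS hu
    have h2 : cyclicRefl B x j (g v - v) (g v + v) = g v + v :=
      cyclicRefl_eq_self fun k => (horth k).1
    rw [map_sub] at h1
    rw [map_add] at h2
    have : (2 : ℂ) • cyclicRefl B x j (g v - v) (g v) = (2 : ℂ) • v := by
      rw [two_smul, two_smul]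
      calc _ = (cyclicRefl B x j (g v - v) (g v) + cyclicRefl B x j (g v - v) v) +
        (cyclicRefl B x j (g v - v) (g v) - cyclicRefl B x j (g v - v) v) := by abel
        _ = _ := by rw [h1, h2]; abel
    exact smul_right_injective V (two_ne_zero' ℂ) this

variable [FiniteDimensional ℂ V]

/-- The isometries commuting with `x` are products of reflections. -/
theorem IsCentralIsometry.mem_closure (hS : SymmPair B x) {g : Module.End ℂ V}
    (hg : IsCentralIsometry B x g) : g ∈ Submonoid.closure (reflections B x) := by
  -- Induction on the rank of a self-adjoint projection `Q` commuting with `x` such that `g` is the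
  -- identity on its kernel.
  suffices H : ∀ (n : ℕ) (Q : Module.End ℂ V), Q * Q = Q → Commute Q x →
      (∀ u w, B (Q u) w = B u (Q w)) → Module.finrank ℂ (LinearMap.range Q) = n →
      ∀ g, IsCentralIsometry B x g → (∀ u, Q u = 0 → g u = u) →
        g ∈ Submonoid.closure (reflections B x) from
    H _ 1 (mul_one _) (Commute.one_left _) (fun _ _ => rfl) rfl g hg (fun u hu => by
      rw [Module.End.one_apply] at hu; rw [hu, map_zero])
  intro n
  induction n using Nat.strong_induction_on with
  | _ n ih =>
  intro Q hQ hQx hQa hn g hg hgQ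
  have hQQ : ∀ u, Q (Q u) = Q u := fun u => by rw [← Module.End.mul_apply, hQ]
  have hmem : ∀ w, w ∈ LinearMap.range Q ↔ Q w = w :=
    fun w => ⟨by rintro ⟨u, rfl⟩; exact hQQ u, fun h => ⟨w, h⟩⟩
  have hQpow : ∀ k w, Q ((x ^ k) w) = (x ^ k) (Q w) := fun k w => by
    rw [← Module.End.mul_apply, (hQx.pow_right k).eq, Module.End.mul_apply]
  have hWx : ∀ w ∈ LinearMap.range Q, x w ∈ LinearMap.range Q := by
    intro w hw
    rw [hmem] at hw ⊢
    rw [← Module.End.mul_apply, hQx.eq, Module.End.mul_apply, hw]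
  by_cases hbot : LinearMap.range Q = ⊥
  · have : g = 1 := by
      ext u
      exact hgQ u (by simp [LinearMap.range_eq_bot.1 hbot])
    rw [this]
    exact Submonoid.one_mem _
  obtain ⟨j, hj, v, hvW, hvj⟩ := hS.exists_aniso (LinearMap.range Q) hWx hbot (by
    intro w hw hww
    refine hS.nondeg w fun u => ?_
    rw [← (hmem w).1 hw, hQa]
    exact hww _ ⟨u, rfl⟩)
  have hv : Aniso B x j v := ⟨hj v hvW, hvj⟩
  have hQv : Q v = v := (hmem v).1 hvW
  -- `g` fixes the kernel of `Q`, to which `v` is orthogonal. Hence `g v` is orthogonal to it as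
  -- well.
  have hgvW : g v ∈ LinearMap.range Q := by
    rw [hmem, ← sub_eq_zero]
    refine hS.nondeg _ fun u => ?_
    have h1 : g (u - Q u) = u - Q u := hgQ _ (by rw [map_sub, hQQ, sub_self])
    have h2 : B (g v) (u - Q u) = 0 := by
      rw [← h1, hg.isometry, map_sub, ← hQa, hQv, sub_self]
    rw [map_sub, LinearMap.sub_apply, hQa, ← neg_sub, ← map_sub, h2, neg_zero]
  obtain ⟨s, t, ht, hts, hs, hsv, hsfix⟩ := exists_reflection_word hS hWx hj hv hvW hg hgvW
  let P := cyclicProj B x j v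
  have hQP : Q * P = P := by
    ext w
    have := cyclicProj_mem hS (W := LinearMap.range Q) (v := v) (j := j)
      (fun k => by rw [hmem, hQpow, hQv]) w hv
    exact (hmem _).1 this
  have hPQ : P * Q = P := by
    ext w
    rw [← sub_eq_zero]
    refine hS.nondeg _ fun u => ?_
    rw [map_sub, LinearMap.sub_apply, Module.End.mul_apply, cyclicProj_selfadj hS hv, hQa,
      cyclicProj_selfadj hS hv, ← Module.End.mul_apply, hQP, sub_self]
  have hPP : P * P = P := by
    ext w
    exact cyclicProj_idem hS hv w
  have hPv : P v = v := cyclicProj_self hS hv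
  have hg' : IsCentralIsometry B x (s * g) := hs.mul hg
  have hlt : Module.finrank ℂ (LinearMap.range (Q - P)) < n := by
    rw [← hn]
    refine Submodule.finrank_lt_finrank_of_lt (lt_of_le_of_ne ?_ ?_)
    · rintro _ ⟨u, rfl⟩
      refine ⟨u - P u, ?_⟩
      rw [map_sub, LinearMap.sub_apply, ← Module.End.mul_apply, hQP]
    · intro heq
      have : v ∈ LinearMap.range (Q - P) := by rw [heq]; exact hvW
      obtain ⟨u, hu⟩ := this
      have h0 : P v = 0 := by
        rw [← hu, LinearMap.sub_apply, map_sub, ← Module.End.mul_apply, ← Module.End.mul_apply,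
          hPQ, hPP, sub_self]
      apply hvj
      rw [← hPv, h0]
      simp
  -- `s * g` fixes the cyclic module of `v` in addition to the kernel of `Q`, so the smaller
  -- projection `Q - P` serves for it.
  have hmain := ih _ hlt (Q - P) (by rw [sub_mul, mul_sub, mul_sub, hQ, hQP, hPQ, hPP]; abel)
    (hQx.sub_left (commute_cyclicProj hS hv).symm)
    (fun u w => by rw [LinearMap.sub_apply, LinearMap.sub_apply, map_sub, map_sub,
      LinearMap.sub_apply, hQa, cyclicProj_selfadj hS hv]) rfl (s * g) hg' (by
    intro u hu
    rw [LinearMap.sub_apply, sub_eq_zero] at hu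
    have h1 : (s * g) (P u) = P u := by
      have := cyclicProj_mem hS (W := LinearMap.ker (s * g - 1)) (v := v) (j := j)
        (fun k => by
          rw [LinearMap.mem_ker, LinearMap.sub_apply, ← hg'.pow_apply, Module.End.mul_apply, hsv,
            Module.End.one_apply, sub_self]) u hv
      rwa [LinearMap.mem_ker, LinearMap.sub_apply, Module.End.one_apply, sub_eq_zero] at this
    have h2 : g (u - Q u) = u - Q u := hgQ _ (by rw [map_sub, hQQ, sub_self])
    have h3 : s (u - Q u) = u - Q u := hsfix _ (by
      intro w hw
      rw [map_sub, ← hQa, (hmem w).1 hw, sub_self])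
    calc (s * g) u = (s * g) (Q u) + s (g (u - Q u)) := by
          rw [show s (g (u - Q u)) = (s * g) (u - Q u) from rfl, ← map_add]; simp
      _ = Q u + (u - Q u) := by rw [h2, h3, hu, h1]
      _ = u := by abel)
  have : g = t * (s * g) := by rw [← mul_assoc, hts, one_mul]
  rw [this]
  exact Submonoid.mul_mem _ ht hmain

/-- The determinant of a reflection. -/
theorem det_cyclicRefl (hS : SymmPair B x) (hv : Aniso B x j v) :
    LinearMap.det (cyclicRefl B x j v) = (-1) ^ (j + 1) := by
  let P := cyclicProj B x j v
  have hP : LinearMap.IsProj (LinearMap.range P) P :=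
    ⟨fun u => ⟨u, rfl⟩, by rintro _ ⟨u, rfl⟩; exact cyclicProj_idem hS hv u⟩
  have hrank : Module.finrank ℂ (LinearMap.range P) = j + 1 := by
    have hPW : ∀ w ∈ LinearMap.range P, x w ∈ LinearMap.range P := by
      rintro _ ⟨u, rfl⟩
      exact ⟨x u, by rw [← Module.End.mul_apply, ← (commute_cyclicProj hS hv).eq]; rfl⟩
    have hpow : ∀ k, ∀ w ∈ LinearMap.range P, (x ^ k) w ∈ LinearMap.range P := by
      intro k
      induction k with
      | zero => intro w hw; simpa using hw
      | succ k ih => intro w hw; rw [pow_succ', Module.End.mul_apply]; exact hPW _ (ih w hw)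
    apply le_antisymm
    · have hle : LinearMap.range P ≤
          Submodule.span ℂ (Set.range fun k : Fin (j + 1) => (x ^ (k : ℕ)) v) := by
        rintro _ ⟨u, rfl⟩
        refine cyclicProj_mem hS (fun k => ?_) u hv
        by_cases hk : k < j + 1
        · exact Submodule.subset_span ⟨⟨k, hk⟩, rfl⟩
        · rw [pow_apply_eq_zero hv.1 (by omega)]
          exact Submodule.zero_mem _
      refine (Submodule.finrank_mono hle).trans ((finrank_range_le_card _).trans ?_)
      simp
    -- A vector in normal position inside the range is a one-chain Jordan system, whose independence
    -- is already known.
    · obtain ⟨w, hw, hw0, hw1⟩ := hS.exists_normal (LinearMap.range P) hPW v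
        ⟨v, cyclicProj_self hS hv⟩ hv.1 hv.2
      have hJ : JordanSystem B x (fun _ : Unit => j) (fun _ => w) :=
        ⟨fun _ => hw0, fun a b k => by simp [hw1]⟩
      have hli := hJ.linearIndependent hS
      have hli' : LinearIndependent ℂ (fun p : JordanIndex (fun _ : Unit => j) =>
          (⟨jordanVec x (fun _ => w) p, hpow _ _ hw⟩ : LinearMap.range P)) :=
        LinearIndependent.of_comp (Submodule.subtype _) hli
      have := hli'.fintype_card_le_finrank
      rw [card_jordanIndex] at this
      simpa using this
  -- In the decomposition into range and kernel of `P`, the reflection is -1 on the range and 1 on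
  -- the kernel.
  have hconj : cyclicRefl B x j v =
      ((LinearMap.range P).prodEquivOfIsCompl (LinearMap.ker P) hP.isCompl).conj
        (LinearMap.prodMap (-1 : Module.End ℂ (LinearMap.range P)) 1) := by
    have h1 : LinearMap.prodMap (-1 : Module.End ℂ (LinearMap.range P))
        (1 : Module.End ℂ (LinearMap.ker P)) = 1 - (2 : ℂ) • LinearMap.prodMap LinearMap.id 0 := by
      ext u
      · simp; rw [two_smul]; abel
      · simp
      · simp
      · simp
    rw [h1, map_sub, map_smul, ← hP.eq_conj_prodMap, cyclicRefl]
    congr 1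
    exact (LinearEquiv.conj_id _).symm
  rw [hconj, LinearEquiv.conj_apply, LinearMap.comp_assoc, LinearMap.det_conj, LinearMap.det_prodMap, map_one, mul_one,
    show (-1 : Module.End ℂ (LinearMap.range P)) = (-1 : ℂ) • 1 by ext; simp,
    LinearMap.det_smul, map_one,
    hrank, mul_one]

end Generation

/-! ### Action of the centralizer on multiplicity spaces. -/

section MultiplicitySpaces

variable {V : Type*} [AddCommGroup V] [Module ℂ V] [FiniteDimensional ℂ V]
  {B : LinearMap.BilinForm ℂ V} {x : Module.End ℂ V}
  {ι : Type} [DecidableEq ι] [Fintype ι] {j : ι → ℕ} {v : ι → V}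

/-- The action of an isometry commuting with `x` on the multiplicity space of the cyclic modules of
length `i + 1`. -/
def multMatrix (B : LinearMap.BilinForm ℂ V) (x : Module.End ℂ V) (j : ι → ℕ) (v : ι → V) (i : ℕ)
    (g : Module.End ℂ V) : Matrix {a // j a = i} {a // j a = i} ℂ :=
  Matrix.of fun a b => B (v a) ((x ^ i) (g (v b)))

/-- On the kernel of `x^(i+1)` the form `B u (x^i w)` only sees the generators of chains of length
exactly `i + 1`. Longer chains pair to zero with `u`, shorter ones are killed by `x^i`, and vectors
further along a chain are killed by the condition on `w`. -/
theorem JordanSystem.complete (hS : SymmPair B x) (h : JordanSystem B x j v)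
    (hfull : ∑ a, (j a + 1) = Module.finrank ℂ V) (i : ℕ) {u w : V}
    (hu : (x ^ (i + 1)) u = 0) (hw : (x ^ (i + 1)) w = 0) :
    B u ((x ^ i) w) =
      ∑ a : {a // j a = i}, B u ((x ^ i) (v a)) * B (v a) ((x ^ i) w) := by
  conv_lhs => rw [h.expand hS hfull u]
  rw [map_sum, LinearMap.sum_apply]
  symm
  refine Fintype.sum_of_injective (fun a : {a // j a = i} => (⟨a, 0⟩ : JordanIndex j)) ?_ _ _ ?_ ?_
  · intro a b hab
    simp only [Sigma.mk.injEq] at hab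
    exact Subtype.ext hab.1
  · rintro ⟨a, l⟩ hp
    rw [map_smul, LinearMap.smul_apply, smul_eq_mul, jordanVec, hS.selfadj_pow, pow_apply_pow]
    by_cases hl : (l : ℕ) = 0
    · simp only [hl, zero_add, Nat.sub_zero]
      rcases lt_trichotomy (j a) i with hlt | heq | hgt
      · have h0 : B (v a) ((x ^ i) w) = 0 := by
          rw [← hS.selfadj_pow, pow_apply_eq_zero (h.kill a) hlt, map_zero, LinearMap.zero_apply]
        rw [h0, mul_zero]
      · exact absurd ⟨⟨a, heq⟩, Sigma.ext rfl (heq_of_eq (Fin.ext hl.symm))⟩ hp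
      · rw [← hS.selfadj_pow (j a), pow_apply_eq_zero hu hgt, map_zero,
          LinearMap.zero_apply, zero_mul]
    · have h0 : (x ^ (l + i)) w = 0 := pow_apply_eq_zero hw (by omega)
      rw [h0, map_zero, mul_zero]
  · rintro ⟨a, ha⟩
    simp [jordanVec, ha]

/-- Writing `v a = g u` moves `g` off the product, and `JordanSystem.complete` inserts a sum over
the multiplicity space between `u` and `g' (v b)`. -/
theorem multMatrix_mul (hS : SymmPair B x) (h : JordanSystem B x j v)
    (hfull : ∑ a, (j a + 1) = Module.finrank ℂ V) (i : ℕ) {g g' : Module.End ℂ V}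
    (hg : IsCentralIsometry B x g) (hg' : IsCentralIsometry B x g') :
    multMatrix B x j v i (g * g') = multMatrix B x j v i g * multMatrix B x j v i g' := by
  ext a b
  have hinj : Function.Injective g := by
    rw [injective_iff_map_eq_zero]
    intro u hu
    refine hS.nondeg u fun w => ?_
    rw [← hg.isometry, hu, map_zero, LinearMap.zero_apply]
  obtain ⟨u, hu⟩ := (LinearMap.injective_iff_surjective.1 hinj) (v a)
  have hka : ∀ a : {a // j a = i}, (x ^ (i + 1)) (v a) = 0 := fun a => by
    have := h.kill a; rwa [a.2] at this
  have hu0 : (x ^ (i + 1)) u = 0 := hinj (by rw [← hg.pow_apply, hu, hka, map_zero])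
  rw [Matrix.mul_apply]
  simp only [multMatrix, Matrix.of_apply, Module.End.mul_apply]
  rw [← hu, hg.pow_apply, hg.isometry, h.complete hS hfull i hu0
    (by rw [hg'.pow_apply, hka, map_zero])]
  refine Finset.sum_congr rfl fun c _ => ?_
  rw [hg.pow_apply, hg.isometry]

omit [FiniteDimensional ℂ V] [Fintype ι] in
theorem multMatrix_one (h : JordanSystem B x j v) (i : ℕ) :
    multMatrix B x j v i 1 = 1 := by
  ext a b
  rw [multMatrix, Matrix.of_apply, Module.End.one_apply, h.gram, Matrix.one_apply]
  simp [Subtype.ext_iff, a.2]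

omit [FiniteDimensional ℂ V] [Fintype ι] in
-- After applying `x^i` to the projection of `v b`, only its term along `x^k u` survives, and on
-- that vector the Gram polynomial acts by the scalar `B u (x^k u)`.
theorem multMatrix_cyclicRefl (hS : SymmPair B x) (h : JordanSystem B x j v) (i : ℕ) {k : ℕ} {u : V}
    (hu : Aniso B x k u) (a b : {a // j a = i}) :
    multMatrix B x j v i (cyclicRefl B x k u) a b = (1 : Matrix _ _ ℂ) a b -
      2 * (B u ((x ^ k) u))⁻¹ * B (v a) ((x ^ k) u) * B u ((x ^ i) (v b)) := by
  have hkb : (x ^ (i + 1)) (v b) = 0 := by have := h.kill b; rwa [b.2] at this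
  have hP : (x ^ i) (cyclicProj B x k u (v b)) =
      ((B u ((x ^ k) u))⁻¹ * B u ((x ^ i) (v b))) • (x ^ k) u := by
    rw [← Module.End.mul_apply, ((commute_cyclicProj hS hu).pow_left i).eq, Module.End.mul_apply,
      cyclicProj_apply, cyclicMap_apply, Finset.sum_range_succ', Finset.sum_eq_zero]
    · have hT : cyclicGram B x k u ((x ^ k) u) = (B u ((x ^ k) u)) • (x ^ k) u := by
        rw [cyclicGram_apply, Finset.sum_range_succ, Finset.sum_eq_zero, zero_add, Nat.sub_self,
          pow_zero, Module.End.one_apply]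
        intro l hl
        have := Finset.mem_range.1 hl
        have h0 : (x ^ (k - l + k)) u = 0 := pow_apply_eq_zero hu.1 (by omega)
        rw [pow_apply_pow, h0, smul_zero]
      have hT' : Ring.inverse (cyclicGram B x k u) ((x ^ k) u) =
          (B u ((x ^ k) u))⁻¹ • (x ^ k) u := by
        rw [eq_inv_smul_iff₀ hu.2, ← map_smul, ← hT, inverse_cyclicGram_apply hS hu]
      rw [zero_add, map_smul, Nat.sub_zero, pow_zero, Module.End.one_apply, hT', smul_smul, mul_comm]
    · intro l _
      have h0 : (x ^ (l + 1 + i)) (v b) = 0 := pow_apply_eq_zero hkb (by omega)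
      rw [pow_apply_pow, h0, map_zero, zero_smul]
  rw [multMatrix, Matrix.of_apply, cyclicRefl_apply, map_sub, map_smul, hP, map_sub, map_smul,
    map_smul, h.gram, Matrix.one_apply]
  simp only [Subtype.ext_iff, a.2, and_true, smul_eq_mul]
  ring

/-- For `i = k` the matrix is an ordinary reflection `1 - (2/c) n nᵀ` with `n · n = c`. For other
`i` the rank-one correction vanishes, so distinct lengths are detected independently. -/
theorem det_multMatrix_cyclicRefl (hS : SymmPair B x) (h : JordanSystem B x j v)
    (hfull : ∑ a, (j a + 1) = Module.finrank ℂ V) (i : ℕ) {k : ℕ} {u : V} (hu : Aniso B x k u) :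
    (multMatrix B x j v i (cyclicRefl B x k u)).det = if i = k then -1 else 1 := by
  have hka : ∀ a : {a // j a = i}, (x ^ (i + 1)) (v a) = 0 := fun a => by
    have := h.kill a; rwa [a.2] at this
  split_ifs with hik
  · subst hik
    let c := B u ((x ^ i) u)
    let n : {a // j a = i} → ℂ := fun a => B u ((x ^ i) (v a))
    have hM : multMatrix B x j v i (cyclicRefl B x i u) =
        1 + replicateCol Unit (fun a => -(2 * c⁻¹) * n a) * replicateRow Unit n := by
      ext a b
      rw [multMatrix_cyclicRefl hS h i hu, Matrix.add_apply, Matrix.mul_apply]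
      have : B (v a) ((x ^ i) u) = n a := by rw [hS.symm, hS.selfadj_pow]
      simp only [this, Finset.univ_unique, Finset.sum_singleton, replicateCol_apply,
        replicateRow_apply]
      ring
    rw [hM, det_one_add_replicateCol_mul_replicateRow]
    have hc : c = ∑ a, n a * n a := by
      rw [show c = B u ((x ^ i) u) from rfl, h.complete hS hfull i hu.1 hu.1]
      refine Finset.sum_congr rfl fun a _ => ?_
      rw [hS.symm (v a), hS.selfadj_pow]
    have hc0 : c ≠ 0 := hu.2
    have : n ⬝ᵥ (fun a => -(2 * c⁻¹) * n a) = -(2 * c⁻¹) * c := by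
      conv_rhs => rw [hc]
      rw [dotProduct, Finset.mul_sum]
      refine Finset.sum_congr rfl fun a _ => by rw [hc]; ring
    rw [this]
    field_simp
    norm_num
  · have hM : multMatrix B x j v i (cyclicRefl B x k u) = 1 := by
      ext a b
      rw [multMatrix_cyclicRefl hS h i hu]
      rcases Nat.lt_or_ge i k with hlt | hge
      · rw [← hS.selfadj_pow k (v a), pow_apply_eq_zero (hka a) hlt]
        simp
      · have hlt : k + 1 ≤ i := by omega
        rw [← hS.selfadj_pow i u, pow_apply_eq_zero hu.1 hlt]
        simp
    rw [hM, det_one]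

end MultiplicitySpaces

/-! ## Equivariant local systems on homogeneous spaces -/

section EtaleSpace

variable {X : Type} [TopologicalSpace X]

open Topology

theorem LocalSystem.exists_frame_vector (L : LocalSystem X) (t : L.Total) :
    ∃ (U : Set X) (r : ℕ) (b : ∀ y : U, (Fin r → ℂ) ≃ₗ[ℂ] L.fiber y) (hx : t.proj ∈ U)
      (c : Fin r → ℂ), IsFlatFrame U b ∧ t = ⟨t.proj, b ⟨t.proj, hx⟩ c⟩ := by
  obtain ⟨U, r, b, hx, hb⟩ := L.exists_frame t.proj
  exact ⟨U, r, b, hx, (b ⟨t.proj, hx⟩).symm t.snd, hb, by simp⟩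

theorem IsFlatFrame.mono {fiber : X → Type} [∀ x, AddCommGroup (fiber x)] [∀ x, Module ℂ (fiber x)]
    [TopologicalSpace (Bundle.TotalSpace Unit fiber)]
    {U V : Set X} {r : ℕ} {b : ∀ y : U, (Fin r → ℂ) ≃ₗ[ℂ] fiber y}
    (h : IsFlatFrame U b) (hV : IsOpen V) (hVU : V ⊆ U) :
    IsFlatFrame V (fun y : V => b ⟨y, hVU y.2⟩) := by
  refine ⟨hV, fun v => (h.2 v).comp (f := Set.inclusion hVU) ?_⟩
  refine ⟨Topology.IsEmbedding.inclusion hVU, ?_⟩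
  rw [Set.range_inclusion]
  exact hV.preimage continuous_subtype_val

/-- Two lifts to the étale space which agree at a point agree near that point. -/
theorem LocalSystem.eventually_eq_of_lift (L : LocalSystem X) {Z : Type*} [TopologicalSpace Z]
    {f g : Z → L.Total} {z : Z} (hf : ContinuousAt f z) (hg : ContinuousAt g z)
    (hp : ∀ z', (f z').proj = (g z').proj) (h : f z = g z) : ∀ᶠ z' in 𝓝 z, f z' = g z' := by
  obtain ⟨U, r, b, hx, c, hb, ht⟩ := L.exists_frame_vector (f z)
  -- The sheet through the common point is open, so both lifts stay in it nearby, and on a sheet a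
  -- point is determined by its projection.
  have hR := (hb.2 c).isOpen_range
  have hm : f z ∈ Set.range fun y : U => (⟨y, b y c⟩ : L.Total) := ⟨⟨_, hx⟩, ht.symm⟩
  filter_upwards [hf (hR.mem_nhds hm), hg (hR.mem_nhds (h ▸ hm))] with z' h₁ h₂
  obtain ⟨⟨y, hy⟩, h₁⟩ := h₁
  obtain ⟨⟨y', hy'⟩, h₂⟩ := h₂
  have hpp := hp z'
  rw [← h₁, ← h₂] at hpp ⊢
  obtain rfl : y = y' := hpp
  rfl

/-- Through every point of the étale space there is a section. -/
theorem LocalSystem.exists_section (L : LocalSystem X) (t : L.Total) {V : Set X} (hV : IsOpen V)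
    (ht : t.proj ∈ V) : ∃ U : Opens X, (U : Set X) ⊆ V ∧ ∃ (hx : t.proj ∈ U)
      (s : L.sections U), t = ⟨t.proj, s.1 ⟨t.proj, hx⟩⟩ ∧
      IsOpenMap fun y : U => (⟨y, s.1 y⟩ : L.Total) := by
  obtain ⟨U, r, b, hx, c, hb, ht'⟩ := L.exists_frame_vector t
  have hb' := hb.mono (hV.inter hb.1) Set.inter_subset_right
  exact ⟨⟨V ∩ U, hV.inter hb.1⟩, Set.inter_subset_left, ⟨ht, hx⟩,
    ⟨fun y => b ⟨y, y.2.2⟩ c, (hb'.2 c).continuous⟩, ht', (hb'.2 c).isOpenMap⟩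

end EtaleSpace

/-! ### Group actions on étale spaces over homogeneous spaces. -/

section Homogeneous

open Topology

variable {K : Type} [Group K] [TopologicalSpace K] {X : Type} [TopologicalSpace X] [MulAction K X]

/-- `X` is the quotient of `K` by the stabilizer of `x₀`. -/
structure IsHomogeneous (K : Type) [Group K] [TopologicalSpace K] {X : Type} [TopologicalSpace X]
    [MulAction K X] (x₀ : X) : Prop where
  continuous : Continuous fun k : K => k • x₀
  isOpenMap : IsOpenMap fun k : K => k • x₀
  surjective : ∀ x : X, ∃ k : K, k • x₀ = x

namespace EquivariantLocalSystem

variable (E : EquivariantLocalSystem K X)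

instance : MulAction K E.Total where
  smul k t := ⟨k • t.proj, E.act k t.proj t.snd⟩
  one_smul t := E.act_one t.proj t.snd
  mul_smul k l t := E.act_mul k l t.proj t.snd

instance : ContinuousSMul K E.Total := ⟨E.continuous_act⟩

/-- The action of `k` on the fibres over `x` and `y = k • x`. -/
def trans (k : K) {x y : X} (h : k • x = y) : E.fiber x →ₗ[ℂ] E.fiber y :=
  h ▸ E.act k x

theorem mk_trans (k : K) {x y : X} (h : k • x = y) (v : E.fiber x) :
    (⟨y, E.trans k h v⟩ : E.Total) = k • (⟨x, v⟩ : E.Total) := by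
  subst h; rfl

theorem trans_eq_iff {k : K} {x y : X} (h : k • x = y) (v : E.fiber x) (w : E.fiber y) :
    E.trans k h v = w ↔ k • (⟨x, v⟩ : E.Total) = ⟨y, w⟩ := by
  rw [← E.mk_trans k h]
  simp

theorem trans_trans {k l : K} {x y z : X} (h : k • x = y) (h' : l • y = z) (v : E.fiber x) :
    E.trans l h' (E.trans k h v) = E.trans (l * k) (by rw [mul_smul, h, h']) v := by
  symm
  rw [trans_eq_iff, mul_smul, ← E.mk_trans k h, ← E.mk_trans l h']

theorem trans_one {x : X} (h : (1 : K) • x = x) (v : E.fiber x) : E.trans 1 h v = v := by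
  rw [trans_eq_iff, one_smul]

theorem trans_congr {k l : K} (e : k = l) {x y : X} (h : k • x = y) (v : E.fiber x) :
    E.trans k h v = E.trans l (e ▸ h) v := by subst e; rfl

/-- The action of `k` as an isomorphism between fibres. -/
def transEquiv (k : K) {x y : X} (h : k • x = y) : E.fiber x ≃ₗ[ℂ] E.fiber y :=
  LinearEquiv.ofLinearMap (E.trans k h) (E.trans k⁻¹ (by rw [← h, inv_smul_smul]))
    (LinearMap.ext fun v => by
      rw [LinearMap.comp_apply, E.trans_trans, E.trans_congr (mul_inv_cancel k), E.trans_one]; rfl)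
    (LinearMap.ext fun v => by
      rw [LinearMap.comp_apply, E.trans_trans, E.trans_congr (inv_mul_cancel k), E.trans_one]; rfl)

theorem transEquiv_apply (k : K) {x y : X} (h : k • x = y) (v : E.fiber x) :
    E.transEquiv k h v = E.trans k h v := rfl

theorem mem_of_mem_isSubsystem {W : ∀ x, Submodule ℂ (E.fiber x)} (hW : E.IsSubsystem W)
    {k : K} {x y : X} (h : k • x = y) {v : E.fiber x} (hv : v ∈ W x) : E.trans k h v ∈ W y := by
  subst h; exact hW.1 k x v hv

variable {E} {x₀ : X}

/-- Near each `k` this map is the open orbit map on `X` followed by a local section, which is also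
open. Continuity of maps out of the étale space can therefore be tested on `K`. -/
theorem isOpenMap_smul (hX : IsHomogeneous K x₀) (v : E.fiber x₀) :
    IsOpenMap fun k : K => k • (⟨x₀, v⟩ : E.Total) := by
  rw [isOpenMap_iff_nhds_le]
  intro k N hN
  rw [Filter.mem_map] at hN
  have hcont : Continuous fun k : K => k • (⟨x₀, v⟩ : E.Total) := by fun_prop
  obtain ⟨U, -, hx, s, hs, hopen⟩ := E.exists_section (k • (⟨x₀, v⟩ : E.Total)) isOpen_univ trivial
  have hx' : k • x₀ ∈ U := hx
  let Z : Set K := (fun k : K => k • x₀) ⁻¹' U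
  have hZ : IsOpen Z := U.isOpen.preimage hX.continuous
  have hev : ∀ᶠ z : Z in 𝓝 ⟨k, hx'⟩, z.1 • (⟨x₀, v⟩ : E.Total) = ⟨z.1 • x₀, s.1 ⟨z.1 • x₀, z.2⟩⟩ := by
    refine E.eventually_eq_of_lift (hcont.comp continuous_subtype_val).continuousAt ?_
      (fun _ => rfl) hs
    exact (s.2.comp (Continuous.subtype_mk (hX.continuous.comp continuous_subtype_val)
      _)).continuousAt
  have hev' : ∀ᶠ z in 𝓝 k, ∀ hz : z ∈ Z, z ∈ (fun k : K => k • (⟨x₀, v⟩ : E.Total)) ⁻¹' N ∧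
      z • (⟨x₀, v⟩ : E.Total) = ⟨z • x₀, s.1 ⟨z • x₀, hz⟩⟩ := by
    rw [← map_nhds_subtype_coe_eq_nhds (x := k) hx' (hZ.mem_nhds hx'), Filter.eventually_map]
    filter_upwards [hev, continuous_subtype_val.continuousAt hN] with z h₁ h₂ h₃
    exact ⟨h₂, h₁⟩
  obtain ⟨W, hWs, hWo, hkW⟩ := mem_nhds_iff.1 (Filter.inter_mem hev' (hZ.mem_nhds hx'))
  have hWx : IsOpen ((fun k : K => k • x₀) '' W) := hX.isOpenMap _ hWo
  have himg := hopen _ (hWx.preimage (continuous_subtype_val (p := fun y => y ∈ U)))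
  refine Filter.mem_of_superset (himg.mem_nhds ⟨⟨k • x₀, hx'⟩, ⟨k, hkW, rfl⟩, hs.symm⟩) ?_
  rintro _ ⟨⟨_, hy⟩, ⟨w, hw, rfl⟩, rfl⟩
  have := (hWs hw).1 (hWs hw).2
  dsimp only
  rw [← this.2]
  exact this.1

end EquivariantLocalSystem

end Homogeneous

/-! ### Irreducible systems as characters of the component group. -/

section Characters

open Topology

variable {K : Type} [Group K] [TopologicalSpace K] {X : Type} [TopologicalSpace X] [MulAction K X]

/-- A presentation of the component group of the stabilizer of `x₀` as an abelian group `A`. -/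
structure ComponentMap (K : Type) [Group K] [TopologicalSpace K] {X : Type} [TopologicalSpace X]
    [MulAction K X] (x₀ : X) (A : Type) [CommGroup A] where
  toHom : MulAction.stabilizer K x₀ →* A
  surjective : Function.Surjective toHom
  isOpen_ker : IsOpen {s | toHom s = 1}
  connected : ∀ s, toHom s = 1 → ∃ T : Set K, IsPreconnected T ∧
    T ⊆ MulAction.stabilizer K x₀ ∧ 1 ∈ T ∧ (s : K) ∈ T

namespace EquivariantLocalSystem

variable {E : EquivariantLocalSystem K X} {x₀ : X}

/-- The fibre is discrete in the étale space, so the continuous orbit of a vector under `T` is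
locally constant. -/
theorem trans_eq_self_of_isPreconnected {T : Set K} (hT : IsPreconnected T)
    (hTs : T ⊆ MulAction.stabilizer K x₀) (h1 : 1 ∈ T) {s : K} (hs : s ∈ T) (h : s • x₀ = x₀)
    (v : E.fiber x₀) : E.trans s h v = v := by
  rw [trans_eq_iff]
  have : PreconnectedSpace T := isPreconnected_iff_preconnectedSpace.1 hT
  have hcont : Continuous fun t : T => t.1 • (⟨x₀, v⟩ : E.Total) := by fun_prop
  have hlc : IsLocallyConstant fun t : T => t.1 • (⟨x₀, v⟩ : E.Total) := by
    rw [IsLocallyConstant.iff_eventually_eq]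
    intro t
    refine E.eventually_eq_of_lift hcont.continuousAt continuousAt_const (fun t' => ?_) rfl
    change t'.1 • x₀ = t.1 • x₀
    rw [MulAction.mem_stabilizer_iff.1 (hTs t.2), MulAction.mem_stabilizer_iff.1 (hTs t'.2)]
  have := hlc.apply_eq_of_preconnectedSpace ⟨s, hs⟩ ⟨1, h1⟩
  simpa using this

/-- The action of the stabilizer on the fibre over the base point. -/
def monodromy (E : EquivariantLocalSystem K X) (s : MulAction.stabilizer K x₀) :
    E.fiber x₀ →ₗ[ℂ] E.fiber x₀ :=
  E.trans s.1 (MulAction.mem_stabilizer_iff.1 s.2)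

theorem monodromy_apply (s : MulAction.stabilizer K x₀) (v : E.fiber x₀) :
    E.monodromy s v = E.trans s.1 (MulAction.mem_stabilizer_iff.1 s.2) v := rfl

variable {A : Type} [CommGroup A] (P : ComponentMap K x₀ A)

theorem trans_eq_of_toHom_eq {s t : MulAction.stabilizer K x₀} (h : P.toHom s = P.toHom t)
    (v : E.fiber x₀) : E.monodromy s v = E.monodromy t v := by
  simp only [monodromy_apply]
  obtain ⟨T, hT, hTs, h1, hs⟩ := P.connected (t⁻¹ * s) (by rw [map_mul, map_inv, h, inv_mul_cancel])
  have := E.trans_eq_self_of_isPreconnected hT hTs h1 hs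
    (MulAction.mem_stabilizer_iff.1 (t⁻¹ * s).2) v
  conv_rhs => rw [← this, trans_trans]
  exact E.trans_congr (by simp) _ _

include P in
theorem monodromy_comm (s t : MulAction.stabilizer K x₀) (v : E.fiber x₀) :
    E.monodromy s (E.monodromy t v) = E.monodromy t (E.monodromy s v) := by
  simp only [monodromy_apply]
  rw [trans_trans, trans_trans]
  exact E.trans_eq_of_toHom_eq P (s := s * t) (t := t * s)
    (by rw [map_mul, map_mul, mul_comm]) v

/-- The family of subspaces generated by a subspace of the fibre over the base point. -/
def spread (hX : IsHomogeneous K x₀) (W₀ : Submodule ℂ (E.fiber x₀)) (x : X) :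
    Submodule ℂ (E.fiber x) :=
  W₀.map (E.trans (hX.surjective x).choose (hX.surjective x).choose_spec)

/-- Two elements carrying `x₀` to `x` differ by an element of the stabilizer, which preserves `W₀`.
-/
theorem spread_eq (hX : IsHomogeneous K x₀) {W₀ : Submodule ℂ (E.fiber x₀)}
    (hW : ∀ s : MulAction.stabilizer K x₀, ∀ v ∈ W₀, E.monodromy s v ∈ W₀) {k : K} {x : X}
    (h : k • x₀ = x) : E.spread hX W₀ x = W₀.map (E.trans k h) := by
  suffices H : ∀ {k l : K} (h : k • x₀ = x) (h' : l • x₀ = x),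
      W₀.map (E.trans k h) ≤ W₀.map (E.trans l h') from le_antisymm (H _ _) (H _ _)
  rintro k l h h' _ ⟨v, hv, rfl⟩
  have hs : (l⁻¹ * k) • x₀ = x₀ := by rw [mul_smul, h, ← h', inv_smul_smul]
  refine ⟨E.trans (l⁻¹ * k) hs v, hW ⟨_, MulAction.mem_stabilizer_iff.2 hs⟩ v hv, ?_⟩
  rw [trans_trans]
  exact E.trans_congr (by simp) _ _

theorem spread_self (hX : IsHomogeneous K x₀) {W₀ : Submodule ℂ (E.fiber x₀)}
    (hW : ∀ s : MulAction.stabilizer K x₀, ∀ v ∈ W₀, E.monodromy s v ∈ W₀) :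
    E.spread hX W₀ x₀ = W₀ := by
  rw [E.spread_eq hX hW (one_smul K x₀)]
  ext v
  simp [trans_one]

theorem isSubsystem_spread (hX : IsHomogeneous K x₀) {W₀ : Submodule ℂ (E.fiber x₀)}
    (hW : ∀ s : MulAction.stabilizer K x₀, ∀ v ∈ W₀, E.monodromy s v ∈ W₀) :
    E.IsSubsystem (E.spread hX W₀) := by
  refine ⟨fun k x v hv => ?_, fun x => ?_⟩
  · obtain ⟨l, hl⟩ := hX.surjective x
    rw [E.spread_eq hX hW hl] at hv
    rw [E.spread_eq hX hW (k := k * l) (by rw [mul_smul, hl])]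
    obtain ⟨w, hw, rfl⟩ := hv
    exact ⟨w, hw, (E.trans_trans hl rfl w).symm⟩
  · obtain ⟨U, r, b, hx, hb⟩ := E.exists_frame x
    obtain ⟨k, rfl⟩ := hX.surjective x
    let Z : Set K := (fun k : K => k • x₀) ⁻¹' U
    have hZ : IsOpen Z := hb.1.preimage hX.continuous
    -- Frame vectors and translates of the frame at `k • x₀` are two lifts agreeing at `z = k`,
    -- hence nearby. Since the rank is finite, one neighbourhood works for the whole frame, and
    -- there the spread subspaces are constant.
    have hev : ∀ i : Fin r, ∀ᶠ z in 𝓝 k, ∀ hz : z ∈ Z,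
        (⟨z • x₀, b ⟨z • x₀, hz⟩ (Pi.single i 1)⟩ : E.Total) =
          z • k⁻¹ • ⟨k • x₀, b ⟨k • x₀, hx⟩ (Pi.single i 1)⟩ := by
      intro i
      rw [← map_nhds_subtype_coe_eq_nhds (x := k) hx (hZ.mem_nhds hx), Filter.eventually_map]
      have h1 : Continuous fun z : Z =>
          (⟨z.1 • x₀, b ⟨z.1 • x₀, z.2⟩ (Pi.single i 1)⟩ : E.Total) :=
        (hb.2 (Pi.single i 1)).continuous.comp
          (Continuous.subtype_mk (hX.continuous.comp continuous_subtype_val) fun z : Z => z.2)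
      have h2 : Continuous fun z : Z =>
          z.1 • k⁻¹ • (⟨k • x₀, b ⟨k • x₀, hx⟩ (Pi.single i 1)⟩ : E.Total) := by fun_prop
      have := E.eventually_eq_of_lift (z := (⟨k, hx⟩ : Z)) h1.continuousAt h2.continuousAt
        (fun z => by
          change z.1 • x₀ = z.1 • k⁻¹ • k • x₀
          rw [inv_smul_smul]) (by rw [smul_inv_smul])
      filter_upwards [this] with z hz _ using hz
    obtain ⟨Y, hYs, hYo, hkY⟩ := mem_nhds_iff.1
      (Filter.inter_mem (Filter.eventually_all.2 hev) (hZ.mem_nhds hx))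
    have hYU : (fun k : K => k • x₀) '' Y ⊆ U := by
      rintro _ ⟨z, hz, rfl⟩; exact (hYs hz).2
    refine ⟨(fun k : K => k • x₀) '' Y, r, fun y => b ⟨y, hYU y.2⟩, (E.spread hX W₀ (k • x₀)).comap (b ⟨k • x₀, hx⟩).toLinearMap, ⟨k, hkY, rfl⟩,
      hb.mono (hX.isOpenMap _ hYo) hYU, ?_⟩
    rintro ⟨_, z, hz, rfl⟩
    have key : ∀ c, b ⟨z • x₀, (hYs hz).2⟩ c =
        E.trans (z * k⁻¹) (by rw [mul_smul, inv_smul_smul]) (b ⟨k • x₀, hx⟩ c) := by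
      intro c
      have : (b ⟨z • x₀, (hYs hz).2⟩).toLinearMap =
          (E.trans (z * k⁻¹) (by rw [mul_smul, inv_smul_smul])).comp
            (b ⟨k • x₀, hx⟩).toLinearMap := by
        refine LinearMap.pi_ext' fun i => LinearMap.ext_ring ?_
        symm
        simp only [LinearMap.comp_apply, LinearMap.single_apply, LinearEquiv.coe_coe]
        rw [trans_eq_iff, mul_smul]
        exact ((hYs hz).1 i (hYs hz).2).symm
      exact LinearMap.congr_fun this c
    dsimp only
    rw [E.spread_eq hX hW rfl, E.spread_eq hX hW rfl]
    ext w
    constructor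
    · rintro ⟨v, hv, rfl⟩
      refine ⟨(b ⟨k • x₀, hx⟩).symm (E.trans k rfl v), ?_, ?_⟩
      · exact ⟨v, hv, by simp⟩
      · refine (key _).trans ?_
        rw [LinearEquiv.apply_symm_apply, trans_trans]
        exact E.trans_congr (by simp) _ _
    · rintro ⟨c, ⟨v, hv, hc⟩, rfl⟩
      refine ⟨v, hv, ?_⟩
      refine Eq.trans ?_ (key _).symm
      change E.trans k rfl v = b ⟨k • x₀, hx⟩ c at hc
      rw [← hc, trans_trans]
      exact E.trans_congr (by simp) _ _

theorem finiteDimensional_fiber (L : LocalSystem X) (x : X) : FiniteDimensional ℂ (L.fiber x) := by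
  obtain ⟨U, r, b, hx, -⟩ := L.exists_frame x
  exact (b ⟨x, hx⟩).finiteDimensional

theorem IsIrreducible.nontrivial (hE : E.IsIrreducible) (hX : IsHomogeneous K x₀) :
    Nontrivial (E.fiber x₀) := by
  obtain ⟨⟨x, hx⟩, -⟩ := hE
  obtain ⟨k, hk⟩ := hX.surjective x
  exact (E.transEquiv k hk).toEquiv.nontrivial

theorem IsIrreducible.eq_top (hE : E.IsIrreducible) (hX : IsHomogeneous K x₀)
    {W₀ : Submodule ℂ (E.fiber x₀)} (h0 : W₀ ≠ ⊥)
    (hW : ∀ s : MulAction.stabilizer K x₀, ∀ v ∈ W₀, E.monodromy s v ∈ W₀) : W₀ = ⊤ := by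
  rcases hE.2 _ (E.isSubsystem_spread hX hW) with h | h
  · exact absurd ((E.spread_self hX hW).symm.trans (h x₀)) h0
  · exact (E.spread_self hX hW).symm.trans (h x₀)

include P in
/-- The stabilizer acts on the fibre of an irreducible system by scalars. -/
theorem IsIrreducible.exists_scalar (hE : E.IsIrreducible) (hX : IsHomogeneous K x₀)
    (s : MulAction.stabilizer K x₀) : ∃ c : ℂ, ∀ v : E.fiber x₀, E.monodromy s v = c • v := by
  have := hE.nontrivial hX
  have := finiteDimensional_fiber E.toLocalSystem x₀
  obtain ⟨c, hc⟩ := Module.End.exists_eigenvalue (E.monodromy s)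
  -- Schur's lemma: the component group is abelian, so the eigenspace is stable under the whole
  -- stabilizer.
  have htop := hE.eq_top hX (W₀ := Module.End.eigenspace (E.monodromy s) c) hc (by
    intro t v hv
    rw [Module.End.mem_eigenspace_iff] at hv ⊢
    rw [E.monodromy_comm P, hv, map_smul])
  exact ⟨c, fun v => Module.End.mem_eigenspace_iff.1 (htop ▸ Submodule.mem_top)⟩

-- All monodromy is scalar, so every line in the fibre generates a subsystem.
include P in
theorem IsIrreducible.finrank_eq_one (hE : E.IsIrreducible) (hX : IsHomogeneous K x₀) :
    Module.finrank ℂ (E.fiber x₀) = 1 := by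
  have := hE.nontrivial hX
  obtain ⟨v, hv⟩ := exists_ne (0 : E.fiber x₀)
  have htop := hE.eq_top hX (W₀ := Submodule.span ℂ {v}) (by simpa using hv) (by
    intro s w hw
    obtain ⟨c, hc⟩ := hE.exists_scalar P hX s
    rw [hc]
    exact Submodule.smul_mem _ _ hw)
  exact (finrank_eq_one_iff_of_nonzero v hv).2 htop

/-- `E` is a system of lines on which the stabilizer acts by the character `χ`. -/
structure HasCharacter (E : EquivariantLocalSystem K X) (P : ComponentMap K x₀ A) (χ : A →* ℂˣ) :
    Prop where
  finrank_eq_one : Module.finrank ℂ (E.fiber x₀) = 1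
  monodromy_eq : ∀ (s : MulAction.stabilizer K x₀) (v : E.fiber x₀),
    E.monodromy s v = (χ (P.toHom s) : ℂ) • v

theorem IsIrreducible.exists_hasCharacter (hE : E.IsIrreducible) (hX : IsHomogeneous K x₀) :
    ∃ χ : A →* ℂˣ, E.HasCharacter P χ := by
  have h1 := hE.finrank_eq_one P hX
  have := hE.nontrivial hX
  obtain ⟨v, hv⟩ := exists_ne (0 : E.fiber x₀)
  choose c hc using hE.exists_scalar P hX
  have hc1 : ∀ s t, P.toHom s = P.toHom t → c s = c t := fun s t h => by
    have := E.trans_eq_of_toHom_eq P h v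
    rw [hc, hc] at this
    exact smul_left_injective ℂ hv this
  have hone : c 1 = 1 := smul_left_injective ℂ hv <| by
    change c 1 • v = (1 : ℂ) • v
    rw [← hc, one_smul]; exact E.trans_one _ v
  have hmul : ∀ s t, c (s * t) = c s * c t := fun s t => smul_left_injective ℂ hv <| by
    change c (s * t) • v = (c s * c t) • v
    rw [mul_smul, ← hc t, ← hc s, ← hc]
    exact (E.trans_trans _ _ v).symm
  -- The scalar depends only on the image in `A`, so any set-theoretic section of the surjection
  -- defines the character.
  choose σ hσ using P.surjective
  have h0 : ∀ a, c (σ a) * c (σ a⁻¹) = 1 := fun a => by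
    rw [← hmul, ← hone]; exact hc1 _ _ (by simp [hσ])
  refine ⟨⟨⟨fun a => ⟨c (σ a), c (σ a⁻¹), h0 a, by rw [mul_comm, h0]⟩, ?_⟩, ?_⟩, h1, ?_⟩
  · refine Units.ext ?_
    change c (σ 1) = 1
    rw [← hone]; exact hc1 _ _ (by simp [hσ])
  · intro a b
    refine Units.ext ?_
    change c (σ (a * b)) = c (σ a) * c (σ b)
    rw [← hmul]; exact hc1 _ _ (by simp [hσ])
  · intro s w
    rw [hc]
    change c s • w = c (σ (P.toHom s)) • w
    rw [hc1 _ _ (hσ (P.toHom s))]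

end EquivariantLocalSystem

end Characters

/-! ### Equal characters give isomorphic sheaves. -/

section SheafIso

open Topology

variable {X : Type} [TopologicalSpace X]

/-- A continuous family of linear maps between the fibres induces maps on sections. -/
def LocalSystem.sectionsMap {L L' : LocalSystem X} (φ : ∀ x, L.fiber x →ₗ[ℂ] L'.fiber x)
    (h : Continuous fun t : L.Total => (⟨t.proj, φ t.proj t.snd⟩ : L'.Total)) (U : Opens X) :
    L.sections U →ₗ[ℂ] L'.sections U where
  toFun s := ⟨fun x => φ x (s.1 x), h.comp s.2⟩
  map_add' _ _ := Subtype.ext (funext fun x => map_add (φ x) _ _)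
  map_smul' _ _ := Subtype.ext (funext fun x => map_smul (φ x) _ _)

/-- A bicontinuous family of isomorphisms between the fibres induces an isomorphism of sheaves. -/
def LocalSystem.sheafIso {L L' : LocalSystem X} (φ : ∀ x, L.fiber x ≃ₗ[ℂ] L'.fiber x)
    (h : Continuous fun t : L.Total => (⟨t.proj, φ t.proj t.snd⟩ : L'.Total))
    (h' : Continuous fun t : L'.Total => (⟨t.proj, (φ t.proj).symm t.snd⟩ : L.Total)) :
    L.sheaf ≅ L'.sheaf :=
  (fullyFaithfulSheafToPresheaf _ _).preimageIso <|
    NatIso.ofComponents (fun U => LinearEquiv.toModuleIso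
      (LinearEquiv.ofLinearMap (LocalSystem.sectionsMap (fun x => (φ x).toLinearMap) h U.unop)
        (LocalSystem.sectionsMap (fun x => (φ x).symm.toLinearMap) h' U.unop)
        (LinearMap.ext fun _ => Subtype.ext (funext fun x => (φ x).apply_symm_apply _))
        (LinearMap.ext fun _ => Subtype.ext (funext fun x => (φ x).symm_apply_apply _))))
      (fun _ => rfl)

variable {K : Type} [Group K] [TopologicalSpace K] [MulAction K X]
  {E E' : EquivariantLocalSystem K X} {x₀ : X} {A : Type} [CommGroup A] {P : ComponentMap K x₀ A}

namespace EquivariantLocalSystem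

/-- A family of maps between the fibres which commutes with the group action is continuous. -/
theorem continuous_of_equivariant (hX : IsHomogeneous K x₀) (φ : ∀ x, E.fiber x →ₗ[ℂ] E'.fiber x)
    (h : ∀ (k : K) (x : X) (hk : k • x₀ = x) (v : E.fiber x₀),
      φ x (E.trans k hk v) = E'.trans k hk (φ x₀ v)) :
    Continuous fun t : E.Total => (⟨t.proj, φ t.proj t.snd⟩ : E'.Total) := by
  refine continuous_iff_continuousAt.2 ?_
  rintro ⟨x, w⟩
  obtain ⟨k, rfl⟩ := hX.surjective x
  obtain ⟨v, rfl⟩ := (E.transEquiv k rfl).surjective w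
  have hopen := E.isOpenMap_smul hX v
  have hcont : Continuous fun k : K => k • (⟨x₀, v⟩ : E.Total) := by fun_prop
  -- Neighbourhoods in the étale space are images of neighbourhoods in `K`. Along the orbit map the
  -- family becomes the orbit map of `φ x₀ v`.
  have hn := hopen.map_nhds_eq (hcont.continuousAt (x := k))
  have hk : k • (⟨x₀, v⟩ : E.Total) = ⟨k • x₀, E.trans k rfl v⟩ := (E.mk_trans k rfl v).symm
  rw [hk] at hn
  rw [E.transEquiv_apply, ContinuousAt, ← hn, Filter.tendsto_map'_iff]
  have : ((fun t : E.Total => (⟨t.proj, φ t.proj t.snd⟩ : E'.Total)) ∘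
      fun k : K => k • (⟨x₀, v⟩ : E.Total)) = fun k => k • (⟨x₀, φ x₀ v⟩ : E'.Total) := by
    funext l
    rw [← E'.mk_trans l rfl, ← h l _ rfl]
    simp only [Function.comp_apply]
    rw [← E.mk_trans l rfl]
  rw [this, h k _ rfl, E'.mk_trans]
  exact (by fun_prop : Continuous fun k : K => k • (⟨x₀, φ x₀ v⟩ : E'.Total)).continuousAt

/-- A linear isomorphism of the base fibres is transported by the group. The result is independent
of choices because the stabilizer acts on both lines by the same scalars. -/
theorem HasCharacter.nonempty_sheaf_iso (hX : IsHomogeneous K x₀) {χ : A →* ℂˣ}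
    (h : E.HasCharacter P χ) (h' : E'.HasCharacter P χ) : Nonempty (E.sheaf ≅ E'.sheaf) := by
  have := finiteDimensional_fiber E.toLocalSystem x₀
  have := finiteDimensional_fiber E'.toLocalSystem x₀
  let φ₀ : E.fiber x₀ ≃ₗ[ℂ] E'.fiber x₀ :=
    LinearEquiv.ofFinrankEq _ _ (h.finrank_eq_one.trans h'.finrank_eq_one.symm)
  choose σ hσ using hX.surjective
  let φ (x : X) : E.fiber x ≃ₗ[ℂ] E'.fiber x :=
    (E.transEquiv (σ x) (hσ x)).symm.trans (φ₀.trans (E'.transEquiv (σ x) (hσ x)))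
  have key : ∀ (k : K) (x : X) (hk : k • x₀ = x) (v : E.fiber x₀),
      φ x (E.trans k hk v) = E'.trans k hk (φ₀ v) := by
    intro k x hk v
    have hs : ((σ x)⁻¹ * k) • x₀ = x₀ := by rw [mul_smul, hk, inv_smul_eq_iff, hσ]
    let s : MulAction.stabilizer K x₀ := ⟨(σ x)⁻¹ * k, MulAction.mem_stabilizer_iff.2 hs⟩
    have h1 : (E.transEquiv (σ x) (hσ x)).symm (E.trans k hk v) = E.monodromy s v := by
      rw [LinearEquiv.symm_apply_eq, transEquiv_apply, monodromy_apply, trans_trans]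
      exact E.trans_congr (by simp [s]) _ _
    have h2 : E'.transEquiv (σ x) (hσ x) (E'.monodromy s (φ₀ v)) = E'.trans k hk (φ₀ v) := by
      rw [transEquiv_apply, monodromy_apply, trans_trans]
      exact E'.trans_congr (by simp [s]) _ _
    change E'.transEquiv (σ x) (hσ x) (φ₀ ((E.transEquiv (σ x) (hσ x)).symm (E.trans k hk v))) = _
    rw [h1, ← h2, h.monodromy_eq, h'.monodromy_eq, map_smul]
  have h0 : ∀ v, φ x₀ v = φ₀ v := fun v => by
    have := key 1 x₀ (one_smul _ _) v
    rwa [E.trans_one, E'.trans_one] at this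
  refine ⟨LocalSystem.sheafIso φ (continuous_of_equivariant hX (fun x => (φ x).toLinearMap) ?_)
    (continuous_of_equivariant hX (fun x => (φ x).symm.toLinearMap) ?_)⟩
  · intro k x hk v
    exact (key k x hk v).trans (by rw [← h0]; rfl)
  · intro k x hk v
    change (φ x).symm (E'.trans k hk v) = E.trans k hk ((φ x₀).symm v)
    rw [LinearEquiv.symm_apply_eq, key, ← h0, LinearEquiv.apply_symm_apply]

end EquivariantLocalSystem

end SheafIso

/-! ### Direct images of local systems along an inducing map. -/

section Pushforward

open Topology

variable {X Y : TopCat.{0}} {i : X ⟶ Y}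

/-- The map between sections over open subsets of `Y` induced by a map of direct images. -/
def LocalSystem.pushforwardMap {Z : TopCat.{0}} {j : Z ⟶ Y} {L : LocalSystem X} {L' : LocalSystem Z}
    (f : (TopCat.Sheaf.pushforward (ModuleCat.{0} ℂ) i).obj L.sheaf ⟶
      (TopCat.Sheaf.pushforward (ModuleCat.{0} ℂ) j).obj L'.sheaf) (V : Opens Y) :
    L.sections ((Opens.map i).obj V) →ₗ[ℂ] L'.sections ((Opens.map j).obj V) :=
  (f.hom.app (Opposite.op V)).hom

variable {Z : TopCat.{0}} {j : Z ⟶ Y} {L : LocalSystem X} {L' : LocalSystem Z}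

theorem LocalSystem.pushforwardMap_restrict
    (f : (TopCat.Sheaf.pushforward (ModuleCat.{0} ℂ) i).obj L.sheaf ⟶
      (TopCat.Sheaf.pushforward (ModuleCat.{0} ℂ) j).obj L'.sheaf) {V W : Opens Y} (h : V ≤ W)
    (s : L.sections ((Opens.map i).obj V)) (t : L.sections ((Opens.map i).obj W))
    (hst : ∀ x (hx : i x ∈ V), s.1 ⟨x, hx⟩ = t.1 ⟨x, h hx⟩) (z : Z) (hz : j z ∈ V) :
    (pushforwardMap f V s).1 ⟨z, hz⟩ = (pushforwardMap f W t).1 ⟨z, h hz⟩ := by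
  have hnat := f.hom.naturality (homOfLE h).op
  have := congrArg (fun g => g.hom t) hnat
  have hs : s = ((((TopCat.Sheaf.pushforward (ModuleCat.{0} ℂ) i).obj L.sheaf).obj.map
      (homOfLE h).op).hom t : L.sections ((Opens.map i).obj V)) :=
    Subtype.ext (funext fun x => hst x.1 x.2)
  rw [hs]
  exact congrFun (congrArg Subtype.val this) ⟨z, hz⟩

theorem LocalSystem.pushforwardMap_injective
    (f : (TopCat.Sheaf.pushforward (ModuleCat.{0} ℂ) i).obj L.sheaf ≅
      (TopCat.Sheaf.pushforward (ModuleCat.{0} ℂ) j).obj L'.sheaf) (V : Opens Y) :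
    Function.Injective (pushforwardMap f.hom V) := by
  refine Function.LeftInverse.injective (g := pushforwardMap f.inv V) fun s => ?_
  have := congrArg (fun g => (g.hom.app (Opposite.op V)).hom s) f.hom_inv_id
  exact this

/-- Open subsets of `X` are traces of open subsets of `Y`, so local sections of the system occur as
sections of the direct image. -/
theorem LocalSystem.exists_section_preimage (hi : IsInducing i) (t : L.Total) {W : Opens Y}
    (hW : i t.proj ∈ W) : ∃ V : Opens Y, V ≤ W ∧ ∃ (hx : i t.proj ∈ V)
      (s : L.sections ((Opens.map i).obj V)), t = ⟨t.proj, s.1 ⟨t.proj, hx⟩⟩ := by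
  obtain ⟨U, hUW, hx, s, hs, -⟩ := L.exists_section t (W.isOpen.preimage i.hom.continuous) hW
  obtain ⟨V₀, hV₀, hV⟩ := hi.isOpen_iff.1 U.isOpen
  obtain rfl : U = (Opens.map i).obj (⟨V₀, hV₀⟩ ⊓ W) := by
    ext x
    constructor
    · intro h
      exact ⟨(Set.ext_iff.1 hV x).2 h, hUW h⟩
    · rintro ⟨h, -⟩
      exact (Set.ext_iff.1 hV x).1 h
  exact ⟨_, inf_le_right, hx, s, hs⟩

/-- The direct images of two local systems are different if some open set meets only the first of
the two spaces. -/
theorem LocalSystem.isEmpty_pushforward_iso (hi : IsInducing i) {x : X} [Nontrivial (L.fiber x)]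
    (W : Opens Y) (hx : i x ∈ W) (hW : ∀ z, j z ∉ W) :
    IsEmpty ((TopCat.Sheaf.pushforward (ModuleCat.{0} ℂ) i).obj L.sheaf ≅
      (TopCat.Sheaf.pushforward (ModuleCat.{0} ℂ) j).obj L'.sheaf) := by
  refine ⟨fun f => ?_⟩
  obtain ⟨v, hv⟩ := exists_ne (0 : L.fiber x)
  obtain ⟨V, hVW, hxV, s, hs⟩ := L.exists_section_preimage hi ⟨x, v⟩ hx
  -- The second direct image has only the zero section over an open set missed by `j`.
  have h0 : s = 0 := pushforwardMap_injective f V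
    (Subtype.ext (funext fun z => absurd (hVW z.2) (hW z.1)))
  rw [h0] at hs
  simp only [Bundle.TotalSpace.mk.injEq, heq_eq_eq, true_and] at hs
  exact hv hs

theorem LocalSystem.not_isZero_pushforward (hi : IsInducing i) {x : X} [Nontrivial (L.fiber x)] :
    ¬ Limits.IsZero ((TopCat.Sheaf.pushforward (ModuleCat.{0} ℂ) i).obj L.sheaf) := by
  intro h
  obtain ⟨v, hv⟩ := exists_ne (0 : L.fiber x)
  obtain ⟨V, -, hxV, s, hs⟩ := L.exists_section_preimage hi ⟨x, v⟩ (W := ⊤) trivial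
  have h0 := congrArg (fun g => (g.hom.app (Opposite.op V)).hom s)
    (h.eq_of_src (𝟙 _) (0 : _ ⟶ (TopCat.Sheaf.pushforward (ModuleCat.{0} ℂ) i).obj L.sheaf))
  have h1 : s = 0 := h0
  rw [h1] at hs
  simp only [Bundle.TotalSpace.mk.injEq, heq_eq_eq, true_and] at hs
  exact hv hs

end Pushforward

/-! ### Recovering the character from the direct image. -/

section Uniqueness

open Topology

variable {K : Type} [Group K] [TopologicalSpace K] [IsTopologicalGroup K] [PreconnectedSpace K]
  {X : Type} [TopologicalSpace X] [MulAction K X] {Y : TopCat.{0}} {i : TopCat.of X ⟶ Y}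
  {E E' : EquivariantLocalSystem K X} {x₀ : X} {A : Type} [CommGroup A] {P : ComponentMap K x₀ A}

theorem LocalSystem.exists_section_eq (L : LocalSystem X) (hi : IsInducing i) (x : X)
    (v : L.fiber x) : ∃ (V : Opens Y) (hx : i x ∈ V) (s : L.sections ((Opens.map i).obj V)),
      v = s.1 ⟨x, hx⟩ := by
  obtain ⟨V, -, hx, s, hs⟩ := L.exists_section_preimage hi ⟨x, v⟩ (W := ⊤) trivial
  simp only [Bundle.TotalSpace.mk.injEq, heq_eq_eq, true_and] at hs
  exact ⟨V, hx, s, hs⟩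

/-- The map between étale spaces induced by an isomorphism of direct images. -/
theorem LocalSystem.exists_totalMap {L L' : LocalSystem X} (hi : IsInducing i)
    (f : (TopCat.Sheaf.pushforward (ModuleCat.{0} ℂ) i).obj L.sheaf ≅
      (TopCat.Sheaf.pushforward (ModuleCat.{0} ℂ) i).obj L'.sheaf) :
    ∃ φ : ∀ x, L.fiber x → L'.fiber x, ∀ (V : Opens Y) (s : L.sections ((Opens.map i).obj V))
      (x : X) (hx : i x ∈ V), φ x (s.1 ⟨x, hx⟩) = (pushforwardMap f.hom V s).1 ⟨x, hx⟩ := by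
  choose V hV s hs using L.exists_section_eq hi
  refine ⟨fun x v => (pushforwardMap f.hom (V x v) (s x v)).1 ⟨x, hV x v⟩, fun W t x hx => ?_⟩
  set v := t.1 ⟨x, hx⟩
  let Z : Opens X := (Opens.map i).obj (V x v ⊓ W)
  have hc1 : Continuous fun z : Z => (⟨z, (s x v).1 ⟨z, z.2.1⟩⟩ : L.Total) :=
    (s x v).2.comp (Continuous.subtype_mk continuous_subtype_val fun z : Z => z.2.1)
  have hc2 : Continuous fun z : Z => (⟨z, t.1 ⟨z, z.2.2⟩⟩ : L.Total) :=
    t.2.comp (Continuous.subtype_mk continuous_subtype_val fun z : Z => z.2.2)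
  have hev := L.eventually_eq_of_lift (z := (⟨x, hV x v, hx⟩ : Z)) hc1.continuousAt
    hc2.continuousAt (fun _ => rfl) (by rw [← hs])
  obtain ⟨Q, hQ, hQo, hxQ⟩ := mem_nhds_iff.1 hev
  have hQ' := Z.isOpen.isOpenMap_subtype_val Q hQo
  obtain ⟨R, hR, hRQ⟩ := hi.isOpen_iff.1 hQ'
  -- A neighbourhood on which the chosen section through `v` agrees with `t`, so that their images
  -- agree at `x`.
  let T : Opens Y := ⟨R, hR⟩ ⊓ (V x v ⊓ W)
  have hxT : i x ∈ T := ⟨(Set.ext_iff.1 hRQ x).2 ⟨_, hxQ, rfl⟩, hV x v, hx⟩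
  have hTV : T ≤ V x v := inf_le_right.trans inf_le_left
  have hTW : T ≤ W := inf_le_right.trans inf_le_right
  let u : L.sections ((Opens.map i).obj T) := ⟨fun z => t.1 ⟨z, hTW z.2⟩,
    t.2.comp (Continuous.subtype_mk continuous_subtype_val _)⟩
  refine (pushforwardMap_restrict f.hom hTV u (s x v) (fun z hz => ?_) x hxT).symm.trans
    (pushforwardMap_restrict f.hom hTW u t (fun z hz => rfl) x hxT)
  obtain ⟨z', hz', hzz⟩ := (Set.ext_iff.1 hRQ z).1 hz.1
  have := hQ hz'
  obtain ⟨z', hz''⟩ := z'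
  obtain rfl : z' = z := hzz
  simp only [Set.mem_ofPred_eq, Bundle.TotalSpace.mk.injEq, heq_eq_eq, true_and] at this
  exact this.symm

namespace EquivariantLocalSystem

/-- The induced map Φ of étale spaces is not assumed equivariant. However, `k⁻¹ • Φ (k • t₀)` stays
in the discrete fibre over `x₀` and varies continuously with `k`, so it is constant on the connected
group. Comparing a stabilizer element with 1 equates the two scalars. -/
theorem HasCharacter.eq_of_pushforward_iso (hX : IsHomogeneous K x₀) (hi : IsInducing i)
    {χ χ' : A →* ℂˣ} (h : E.HasCharacter P χ) (h' : E'.HasCharacter P χ')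
    (f : (TopCat.Sheaf.pushforward (ModuleCat.{0} ℂ) i).obj E.sheaf ≅
      (TopCat.Sheaf.pushforward (ModuleCat.{0} ℂ) i).obj E'.sheaf) : χ = χ' := by
  obtain ⟨φ, hφ⟩ := LocalSystem.exists_totalMap hi f
  have hsec := E.exists_section_eq hi
  have hsmul : ∀ (x : X) (c : ℂ) (v : E.fiber x), φ x (c • v) = c • φ x v := by
    intro x c v
    obtain ⟨V, hx, s, rfl⟩ := hsec x v
    rw [hφ]
    refine (hφ V (c • s) x hx).trans ?_
    rw [map_smul]; rfl
  have hΦ : ∀ (V : Opens Y) (s : E.sections ((Opens.map i).obj V)),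
      Continuous fun z : (Opens.map i).obj V => (⟨z, φ z (s.1 z)⟩ : E'.Total) := by
    intro V s
    have : Continuous fun z : (Opens.map i).obj V =>
        (⟨z, (LocalSystem.pushforwardMap f.hom V s).1 z⟩ : E'.Total) :=
      (LocalSystem.pushforwardMap f.hom V s).2
    convert this using 1
    funext z
    exact congrArg (Bundle.TotalSpace.mk z.1) (hφ V s z.1 z.2)
  have hne : ∀ (x : X) (v : E.fiber x), φ x v = 0 → v = 0 := by
    obtain ⟨ψ, hψ⟩ := LocalSystem.exists_totalMap hi f.symm
    intro x v hv
    obtain ⟨V, hx, s, rfl⟩ := hsec x v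
    have h1 := hψ V (LocalSystem.pushforwardMap f.hom V s) x hx
    have h2 : LocalSystem.pushforwardMap f.inv V (LocalSystem.pushforwardMap f.hom V s) = s :=
      congrArg (fun g => (g.hom.app (Opposite.op V)).hom s) f.hom_inv_id
    have h3 := hψ V 0 x hx
    rw [map_zero] at h3
    rw [← hφ, hv] at h1
    refine Eq.trans ?_ (h1.symm.trans h3)
    exact (congrFun (congrArg Subtype.val h2) ⟨x, hx⟩).symm
  have : Nontrivial (E.fiber x₀) :=
    Module.nontrivial_of_finrank_pos (R := ℂ) (by rw [h.finrank_eq_one]; exact one_pos)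
  obtain ⟨v, hv⟩ := exists_ne (0 : E.fiber x₀)
  let Φ (t : E.Total) : E'.Total := ⟨t.proj, φ t.proj t.snd⟩
  let t₀ : E.Total := ⟨x₀, v⟩
  have hlc : IsLocallyConstant fun k : K => k⁻¹ • Φ (k • t₀) := by
    rw [IsLocallyConstant.iff_eventually_eq]
    intro k
    have hproj : ∀ k : K, (k⁻¹ • Φ (k • t₀)).proj = x₀ := fun k => inv_smul_smul k x₀
    refine E'.eventually_eq_of_lift ?_ continuousAt_const
      (fun l => (hproj l).trans (hproj k).symm) rfl
    obtain ⟨V, hx, s, hs⟩ := hsec (k • x₀) (E.trans k rfl v)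
    let Z : Set K := (fun k : K => k • x₀) ⁻¹' ((Opens.map i).obj V)
    have hZ : IsOpen Z := ((Opens.map i).obj V).isOpen.preimage hX.continuous
    have hres : Continuous fun z : Z => (⟨z.1 • x₀, z.2⟩ : (Opens.map i).obj V) :=
      Continuous.subtype_mk (hX.continuous.comp continuous_subtype_val) _
    have h1 : Continuous fun z : Z => z.1 • t₀ := by fun_prop
    have hev := E.eventually_eq_of_lift (z := (⟨k, hx⟩ : Z)) h1.continuousAt
      (s.2.comp hres).continuousAt (fun _ => rfl)
      ((E.mk_trans k rfl v).symm.trans (congrArg (Bundle.TotalSpace.mk (k • x₀)) hs))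
    have hc : ContinuousAt (fun z : Z => z.1⁻¹ • Φ (z.1 • t₀)) ⟨k, hx⟩ := by
      have hcont : Continuous fun z : Z =>
          z.1⁻¹ • (⟨z.1 • x₀, φ _ (s.1 ⟨z.1 • x₀, z.2⟩)⟩ : E'.Total) := by
        have := (hΦ V s).comp hres
        fun_prop
      refine hcont.continuousAt.congr ?_
      filter_upwards [hev] with z hz
      rw [hz]; rfl
    exact (hZ.isOpenEmbedding_subtypeVal.continuousAt_iff
      (g := fun k : K => k⁻¹ • Φ (k • t₀)) (x := ⟨k, hx⟩)).1 hc
  ext a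
  obtain ⟨s, rfl⟩ := P.surjective a
  have hs0 : s.1 • x₀ = x₀ := MulAction.mem_stabilizer_iff.1 s.2
  have hconst := hlc.apply_eq_of_preconnectedSpace s.1 1
  rw [inv_one, one_smul, one_smul, inv_smul_eq_iff] at hconst
  have e1 : s.1 • t₀ = ⟨x₀, (χ (P.toHom s) : ℂ) • v⟩ := by
    rw [← h.monodromy_eq, monodromy_apply, E.mk_trans]
  have e2 : s.1 • Φ t₀ = ⟨x₀, (χ' (P.toHom s) : ℂ) • φ x₀ v⟩ := by
    rw [← h'.monodromy_eq, monodromy_apply, E'.mk_trans]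
  rw [e1, e2] at hconst
  simp only [Φ, Bundle.TotalSpace.mk.injEq, heq_eq_eq, true_and, hsmul] at hconst
  exact smul_left_injective ℂ (fun h0 => hv (hne _ _ h0)) hconst

end EquivariantLocalSystem

end Uniqueness

/-! ### The local system attached to a character. -/

section Existence

open Topology

variable {K : Type} [Group K] [TopologicalSpace K] {X : Type} [TopologicalSpace X] [MulAction K X]
  {x₀ : X} {A : Type} [CommGroup A]

/-- A subspace of the line over `x₀` is zero or everything, and the transitive group action spreads
this to all fibres. -/
theorem EquivariantLocalSystem.HasCharacter.isIrreducible {E : EquivariantLocalSystem K X}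
    {P : ComponentMap K x₀ A} {χ : A →* ℂˣ} (h : E.HasCharacter P χ) (hX : IsHomogeneous K x₀) :
    E.IsIrreducible := by
  have hnt : Nontrivial (E.fiber x₀) :=
    Module.nontrivial_of_finrank_pos (R := ℂ) (by rw [h.finrank_eq_one]; exact one_pos)
  refine ⟨⟨x₀, hnt⟩, fun W hW => ?_⟩
  have := is_simple_module_of_finrank_eq_one (A := ℂ) h.finrank_eq_one
  rcases eq_bot_or_eq_top (W x₀) with h0 | h0
  · refine Or.inl fun x => (Submodule.eq_bot_iff _).2 fun v hv => ?_
    obtain ⟨k, rfl⟩ := hX.surjective x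
    have := E.mem_of_mem_isSubsystem hW (inv_smul_smul k x₀) hv
    rw [h0, Submodule.mem_bot] at this
    exact (E.transEquiv k⁻¹ (inv_smul_smul k x₀)).map_eq_zero_iff.1 this
  · refine Or.inr fun x => (Submodule.eq_top_iff').2 fun v => ?_
    obtain ⟨k, rfl⟩ := hX.surjective x
    obtain ⟨w, rfl⟩ := (E.transEquiv k rfl).surjective v
    exact E.mem_of_mem_isSubsystem hW rfl (h0 ▸ Submodule.mem_top)

open Classical in
/-- A character of the component group, as a function on the whole group. -/
def ComponentMap.eval (P : ComponentMap K x₀ A) (χ : A →* ℂˣ) (k : K) : ℂˣ :=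
  if h : k • x₀ = x₀ then χ (P.toHom ⟨k, MulAction.mem_stabilizer_iff.2 h⟩) else 1

theorem ComponentMap.eval_coe (P : ComponentMap K x₀ A) (χ : A →* ℂˣ)
    (s : MulAction.stabilizer K x₀) : P.eval χ s = χ (P.toHom s) := by
  rw [ComponentMap.eval, dif_pos (MulAction.mem_stabilizer_iff.1 s.2)]

theorem ComponentMap.eval_mul (P : ComponentMap K x₀ A) (χ : A →* ℂˣ) {k l : K} (hk : k • x₀ = x₀)
    (hl : l • x₀ = x₀) : P.eval χ (k * l) = P.eval χ k * P.eval χ l := by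
  let s : MulAction.stabilizer K x₀ := ⟨k, hk⟩
  let t : MulAction.stabilizer K x₀ := ⟨l, hl⟩
  have := P.eval_coe χ (s * t)
  rw [map_mul, map_mul, ← P.eval_coe, ← P.eval_coe] at this
  exact this

variable (hX : IsHomogeneous K x₀) (P : ComponentMap K x₀ A) (χ : A →* ℂˣ)

/-- The kernel of the component map is open, and `a⁻¹ * b` is close to 1 for `a`, `b` close to `k₀`.
Over such a set the twist by χ is invisible, which makes the sheets well defined. -/
theorem ComponentMap.exists_open [IsTopologicalGroup K] (k₀ : K) :
    ∃ W : Set K, IsOpen W ∧ k₀ ∈ W ∧ ∀ a ∈ W, ∀ b ∈ W, a • x₀ = b • x₀ → P.eval χ (a⁻¹ * b) = 1 := by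
  obtain ⟨O, hO, hOk⟩ := isOpen_induced_iff.1 P.isOpen_ker
  have hc : Continuous fun p : K × K => p.1⁻¹ * p.2 := by fun_prop
  have h1 : (1 : K) ∈ O := by
    have : (1 : MulAction.stabilizer K x₀) ∈ Subtype.val ⁻¹' O := by
      rw [hOk]; exact map_one P.toHom
    exact this
  have hn : (fun p : K × K => p.1⁻¹ * p.2) ⁻¹' O ∈ 𝓝 (k₀, k₀) :=
    hc.continuousAt (hO.mem_nhds (by simpa using h1))
  obtain ⟨W, hW, hk, hWO⟩ := exists_nhds_square hn
  refine ⟨W, hW, hk, fun a ha b hb hab => ?_⟩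
  let s : MulAction.stabilizer K x₀ := ⟨a⁻¹ * b, MulAction.mem_stabilizer_iff.2
    (by rw [mul_smul, ← hab, inv_smul_smul])⟩
  have hs : s ∈ Subtype.val ⁻¹' O := hWO (Set.mk_mem_prod ha hb)
  rw [hOk] at hs
  have hs' : P.toHom s = 1 := hs
  exact (P.eval_coe χ s).trans (by rw [hs', map_one])

/-- The fibres of the equivariant local system attached to a character. -/
def charFiber (_ : IsHomogeneous K x₀) (_ : ComponentMap K x₀ A) (_ : A →* ℂˣ) : X → Type :=
  fun _ => ℂ

instance (x : X) : AddCommGroup (charFiber hX P χ x) := inferInstanceAs (AddCommGroup ℂ)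

instance (x : X) : Module ℂ (charFiber hX P χ x) := inferInstanceAs (Module ℂ ℂ)

/-- The number `c` in the fibre over `x` stands for the class of (`hX.lift x`, `c`) in the quotient
of `K × ℂ` by the stabilizer. Since the lift is arbitrary, this identification need not be
continuous in `x`. -/
def charVec (x : X) : ℂ ≃ₗ[ℂ] charFiber hX P χ x := LinearEquiv.refl ℂ ℂ

/-- A section of the orbit map. -/
def IsHomogeneous.lift (x : X) : K := (hX.surjective x).choose

theorem IsHomogeneous.lift_smul (x : X) : hX.lift x • x₀ = x := (hX.surjective x).choose_spec

/-- The point of the étale space given by the pair `(k, c)`. -/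
def charPoint (c : ℂ) (k : K) : Bundle.TotalSpace Unit (charFiber hX P χ) :=
  ⟨k • x₀, charVec hX P χ _ ((P.eval χ ((hX.lift (k • x₀))⁻¹ * k) : ℂ) * c)⟩

/-- This is the relation (k s, c) ~ (k, χ(s) c) defining the associated bundle. The auxiliary lift
drops out. -/
theorem charPoint_eq_iff {c c' : ℂ} {k k' : K} : charPoint hX P χ c k = charPoint hX P χ c' k' ↔
    k • x₀ = k' • x₀ ∧ (P.eval χ (k'⁻¹ * k) : ℂ) * c = c' := by
  have key : ∀ h : k • x₀ = k' • x₀, (P.eval χ ((hX.lift (k • x₀))⁻¹ * k) : ℂ) =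
      P.eval χ ((hX.lift (k' • x₀))⁻¹ * k') * P.eval χ (k'⁻¹ * k) := by
    intro h
    rw [← Units.val_mul, ← P.eval_mul, h]
    · simp [mul_assoc]
    · rw [mul_smul, inv_smul_eq_iff, hX.lift_smul]
    · rw [mul_smul, h, inv_smul_smul]
  constructor
  · intro h
    have h1 : k • x₀ = k' • x₀ := congrArg Bundle.TotalSpace.proj h
    refine ⟨h1, ?_⟩
    have h2 : (P.eval χ ((hX.lift (k • x₀))⁻¹ * k) : ℂ) * c =
        (P.eval χ ((hX.lift (k' • x₀))⁻¹ * k') : ℂ) * c' :=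
      congrArg (fun t : Bundle.TotalSpace Unit (charFiber hX P χ) =>
        (charVec hX P χ t.proj).symm t.snd) h
    rw [key h1, mul_assoc] at h2
    exact mul_left_cancel₀ (Units.ne_zero _) h2
  · rintro ⟨h, rfl⟩
    rw [charPoint, charPoint, key h, mul_assoc]
    rw [h]

theorem exists_charPoint (t : Bundle.TotalSpace Unit (charFiber hX P χ)) {k : K}
    (h : k • x₀ = t.proj) : ∃ c, charPoint hX P χ c k = t := by
  obtain ⟨x, v⟩ := t
  obtain rfl : k • x₀ = x := h
  refine ⟨(P.eval χ ((hX.lift (k • x₀))⁻¹ * k))⁻¹ * (charVec hX P χ _).symm v, ?_⟩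
  rw [charPoint, ← mul_assoc, Units.mul_inv, one_mul, LinearEquiv.apply_symm_apply]

/-- The quotient topology from `K × ℂ` with ℂ discrete, so that the fibres become discrete and the
bundle flat. -/
instance : TopologicalSpace (Bundle.TotalSpace Unit (charFiber hX P χ)) :=
  ⨆ c, TopologicalSpace.coinduced (charPoint hX P χ c) inferInstance

theorem isOpen_charTotal {O : Set (Bundle.TotalSpace Unit (charFiber hX P χ))} :
    IsOpen O ↔ ∀ c, IsOpen (charPoint hX P χ c ⁻¹' O) := by
  rw [isOpen_iSup_iff]
  rfl

theorem continuous_charPoint (c : ℂ) : Continuous (charPoint hX P χ c) :=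
  continuous_def.2 fun _ hO => (isOpen_charTotal hX P χ).1 hO c

variable [IsTopologicalGroup K]

/-- Pulling the image of `W` back along another `charPoint` gives a union of right translates of `W`
by stabilizer elements. -/
theorem isOpenMap_charPoint (c : ℂ) : IsOpenMap (charPoint hX P χ c) := by
  intro W hW
  rw [isOpen_charTotal]
  intro c'
  have : charPoint hX P χ c' ⁻¹' (charPoint hX P χ c '' W) =
      ⋃ s : {s : K // s • x₀ = x₀ ∧ (P.eval χ s : ℂ) * c = c'}, (fun k => k * s.1) ⁻¹' W := by
    ext k'
    simp only [Set.mem_preimage, Set.mem_image, Set.mem_iUnion, charPoint_eq_iff]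
    constructor
    · rintro ⟨k, hk, h, h'⟩
      exact ⟨⟨k'⁻¹ * k, by rw [mul_smul, h, inv_smul_smul], h'⟩, by simpa using hk⟩
    · rintro ⟨⟨s, hs, h⟩, hk⟩
      exact ⟨_, hk, by rw [mul_smul, hs], by simpa using h⟩
  rw [this]
  exact isOpen_iUnion fun s => hW.preimage (continuous_mul_const s.1)

/-- Over the image of a set `W` from `ComponentMap.exists_open`, any representative in `W` gives the
same vector. The arbitrary choice `w` therefore does not spoil continuity. -/
theorem charFiber_exists_frame (x : X) : ∃ (U : Set X) (r : ℕ)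
    (b : ∀ y : U, (Fin r → ℂ) ≃ₗ[ℂ] charFiber hX P χ y), x ∈ U ∧ IsFlatFrame U b := by
  obtain ⟨W, hW, hk₀, hWχ⟩ := P.exists_open χ (hX.lift x)
  choose w hwW hw using fun y : (fun k : K => k • x₀) '' W => y.2
  dsimp only at hw
  let b (y : (fun k : K => k • x₀) '' W) : (Fin 1 → ℂ) ≃ₗ[ℂ] charFiber hX P χ y :=
    (LinearEquiv.funUnique (Fin 1) ℂ ℂ).trans ((LinearEquiv.smulOfUnit
      (P.eval χ ((hX.lift y)⁻¹ * w y))).trans (charVec hX P χ y))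
  have hb : ∀ (y : (fun k : K => k • x₀) '' W) (v : Fin 1 → ℂ) (k : K), k ∈ W → k • x₀ = y →
      (⟨y, b y v⟩ : Bundle.TotalSpace Unit (charFiber hX P χ)) = charPoint hX P χ (v 0) k := by
    intro y v k hk hky
    trans charPoint hX P χ (v 0) (w y)
    · have h1 : (⟨y, b y v⟩ : Bundle.TotalSpace Unit (charFiber hX P χ)) =
          ⟨y, charVec hX P χ _ ((P.eval χ ((hX.lift y)⁻¹ * w y) : ℂ) * v 0)⟩ := rfl
      have h2 : ∀ (z : X), w y • x₀ = z → (⟨z, charVec hX P χ _ ((P.eval χ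
          ((hX.lift z)⁻¹ * w y) : ℂ) * v 0)⟩ : Bundle.TotalSpace Unit (charFiber hX P χ)) =
            charPoint hX P χ (v 0) (w y) := by
        rintro _ rfl; rfl
      exact h1.trans (h2 y (hw y))
    · rw [charPoint_eq_iff, hw, hky, hWχ k hk _ (hwW y) (by rw [hw, hky])]
      simp
  refine ⟨_, 1, b, ⟨hX.lift x, hk₀, hX.lift_smul x⟩, hX.isOpenMap W hW, fun v => ?_⟩
  refine Topology.IsOpenEmbedding.of_continuous_injective_isOpenMap ?_ ?_ ?_
  · rw [continuous_def]
    intro O hO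
    have hO' := hX.isOpenMap _ (hW.inter (hO.preimage (continuous_charPoint hX P χ (v 0))))
    convert hO'.preimage continuous_subtype_val using 1
    ext y
    constructor
    · intro hy
      refine ⟨w y, ⟨hwW y, ?_⟩, hw y⟩
      rw [Set.mem_preimage, ← hb y v _ (hwW y) (hw y)]
      exact hy
    · rintro ⟨k, ⟨hk, hkO⟩, hky⟩
      rw [Set.mem_preimage, ← hb y v k hk hky] at hkO
      exact hkO
  · intro y y' h
    exact Subtype.ext (congrArg Bundle.TotalSpace.proj h)
  · intro Q hQ
    obtain ⟨Q', hQ', rfl⟩ := isOpen_induced_iff.1 hQ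
    convert isOpenMap_charPoint hX P χ (v 0) _ (hW.inter (hQ'.preimage hX.continuous)) using 1
    ext t
    constructor
    · rintro ⟨y, hy, rfl⟩
      refine ⟨w y, ⟨hwW y, ?_⟩, (hb y v _ (hwW y) (hw y)).symm⟩
      rw [Set.mem_preimage, hw]
      exact hy
    · rintro ⟨k, ⟨hk, hkQ⟩, rfl⟩
      exact ⟨⟨k • x₀, k, hk, rfl⟩, hkQ, hb ⟨k • x₀, k, hk, rfl⟩ v k hk rfl⟩

/-- The action of the group on the fibres. -/
def charAct (k : K) (x : X) : charFiber hX P χ x →ₗ[ℂ] charFiber hX P χ (k • x) :=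
  (P.eval χ ((hX.lift (k • x))⁻¹ * k * hX.lift x) : ℂ) •
    ((charVec hX P χ (k • x)).toLinearMap ∘ₗ (charVec hX P χ x).symm.toLinearMap)

-- The formula for `charAct` is arranged so that in terms of representatives it is left
-- multiplication. The axioms of an action and continuity follow from this.
omit [IsTopologicalGroup K] in
theorem charAct_charPoint (l : K) (c : ℂ) (k : K) :
    (⟨l • (charPoint hX P χ c k).proj, charAct hX P χ l _ (charPoint hX P χ c k).snd⟩ :
      Bundle.TotalSpace Unit (charFiber hX P χ)) = charPoint hX P χ c (l * k) := by
  have h1 : (⟨l • (charPoint hX P χ c k).proj, charAct hX P χ l _ (charPoint hX P χ c k).snd⟩ :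
      Bundle.TotalSpace Unit (charFiber hX P χ)) =
      ⟨l • k • x₀, charVec hX P χ _ ((P.eval χ ((hX.lift (l • k • x₀))⁻¹ * l *
        hX.lift (k • x₀)) : ℂ) * (P.eval χ ((hX.lift (k • x₀))⁻¹ * k) * c))⟩ := rfl
  rw [h1, ← mul_assoc, ← Units.val_mul, ← P.eval_mul, charPoint, mul_smul]
  · simp [mul_assoc]
  · rw [mul_smul, mul_smul, hX.lift_smul, inv_smul_eq_iff, hX.lift_smul]
  · rw [mul_smul, inv_smul_eq_iff, hX.lift_smul]

/-- The equivariant local system attached to a character of the component group. -/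
def charSystem : EquivariantLocalSystem K X where
  fiber := charFiber hX P χ
  exists_frame := charFiber_exists_frame hX P χ
  act := charAct hX P χ
  act_one x v := by
    obtain ⟨c, hc⟩ := exists_charPoint hX P χ ⟨x, v⟩ (hX.lift_smul x)
    have := charAct_charPoint hX P χ 1 c (hX.lift x)
    rwa [one_mul, hc] at this
  act_mul k l x v := by
    obtain ⟨c, hc⟩ := exists_charPoint hX P χ ⟨x, v⟩ (hX.lift_smul x)
    have h1 := charAct_charPoint hX P χ (k * l) c (hX.lift x)
    have h2 := charAct_charPoint hX P χ l c (hX.lift x)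
    have h3 := charAct_charPoint hX P χ k c (l * hX.lift x)
    rw [← h2, ← mul_assoc, ← h1, hc] at h3
    exact h3.symm
  continuous_act := by
    refine continuous_iff_continuousAt.2 ?_
    rintro ⟨l, t⟩
    obtain ⟨c, hc⟩ := exists_charPoint hX P χ t (hX.lift_smul t.proj)
    generalize hX.lift t.proj = k at hc
    subst hc
    have hm : IsOpenMap fun p : K × K => (p.1, charPoint hX P χ c p.2) :=
      IsOpenMap.id.prodMap (isOpenMap_charPoint hX P χ c)
    have hc : Continuous fun p : K × K => (p.1, charPoint hX P χ c p.2) :=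
      continuous_id.prodMap (continuous_charPoint hX P χ c)
    rw [ContinuousAt, ← hm.map_nhds_eq (x := (l, k)) hc.continuousAt,
      Filter.tendsto_map'_iff]
    have : Continuous fun p : K × K => charPoint hX P χ c (p.1 * p.2) :=
      (continuous_charPoint hX P χ c).comp continuous_mul
    have h := this.continuousAt (x := (l, k))
    rw [ContinuousAt, ← charAct_charPoint] at h
    exact h.congr fun p => (charAct_charPoint hX P χ p.1 c p.2).symm

theorem charSystem_hasCharacter : (charSystem hX P χ).HasCharacter P χ := by
  refine ⟨?_, fun s v => ?_⟩
  · exact ((charVec hX P χ x₀).finrank_eq).symm.trans (Module.finrank_self ℂ)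
  · rw [EquivariantLocalSystem.monodromy_apply, EquivariantLocalSystem.trans_eq_iff]
    obtain ⟨c, hc⟩ := exists_charPoint hX P χ ⟨x₀, v⟩ (one_smul K x₀)
    have h1 := charAct_charPoint hX P χ s.1 c 1
    have hs : charPoint hX P χ c (s.1 * 1) = charPoint hX P χ ((P.eval χ s.1 : ℂ) * c) 1 := by
      rw [charPoint_eq_iff]
      simp [MulAction.mem_stabilizer_iff.1 s.2]
    rw [hc, hs] at h1
    refine h1.trans ?_
    have h2 : charPoint hX P χ ((P.eval χ s.1 : ℂ) * c) 1 =
        ⟨(charPoint hX P χ c 1).proj, (P.eval χ s.1 : ℂ) • (charPoint hX P χ c 1).snd⟩ := by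
      rw [charPoint, mul_left_comm]
      rfl
    rw [h2, hc, P.eval_coe]
    rfl

end Existence

/-! ## The orthogonal group and its action on the nilpotent cone -/

section OrthogonalGroup

variable {N : ℕ}

/-- The standard symmetric form on `ℂ^N`. -/
def dotForm (N : ℕ) : LinearMap.BilinForm ℂ (Fin N → ℂ) := dotProductBilin ℂ ℂ

theorem dotForm_apply (u v : Fin N → ℂ) : dotForm N u v = u ⬝ᵥ v := rfl

theorem dotForm_mulVec (a : Matrix (Fin N) (Fin N) ℂ) (u v : Fin N → ℂ) :
    dotForm N (a *ᵥ u) v = dotForm N u (aᵀ *ᵥ v) := by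
  rw [dotForm_apply, dotForm_apply, mulVec_transpose, dotProduct_comm, dotProduct_mulVec,
    dotProduct_comm]

theorem dotForm_ext {u v : Fin N → ℂ} (h : ∀ w, dotForm N w u = dotForm N w v) : u = v := by
  funext i
  have := h (Pi.single i 1)
  rwa [dotForm_apply, dotForm_apply, single_one_dotProduct, single_one_dotProduct] at this

/-- The endomorphism of `ℂ^N` given by a matrix. -/
abbrev endo (a : Matrix (Fin N) (Fin N) ℂ) : Module.End ℂ (Fin N → ℂ) := Matrix.toLinAlgEquiv' a

theorem endo_apply (a : Matrix (Fin N) (Fin N) ℂ) (u : Fin N → ℂ) : endo a u = a *ᵥ u :=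
  Matrix.toLinAlgEquiv'_apply a u

theorem NilCone.transpose_eq (x : NilCone N) : x.1ᵀ = x.1 := x.2.1.2

theorem NilCone.symmPair (x : NilCone N) : SymmPair (dotForm N) (endo x.1) where
  symm u v := by rw [dotForm_apply, dotForm_apply, dotProduct_comm]
  nondeg u h := dotForm_ext fun w => by
    rw [dotForm_apply, dotProduct_comm, ← dotForm_apply, h, map_zero]
  selfadj u v := by rw [endo_apply, endo_apply, dotForm_mulVec, x.transpose_eq]
  nilp := x.2.2.map Matrix.toLinAlgEquiv'

/-- The orthogonal group. -/
def OG (N : ℕ) : Type := {g : Matrix (Fin N) (Fin N) ℂ // gᵀ * g = 1}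

instance : TopologicalSpace (OG N) :=
  inferInstanceAs (TopologicalSpace {g : Matrix (Fin N) (Fin N) ℂ // gᵀ * g = 1})

theorem OG.ext {g h : OG N} (e : g.1 = h.1) : g = h := Subtype.ext e

theorem OG.mul_transpose (g : OG N) : g.1 * g.1ᵀ = 1 := mul_eq_one_comm.1 g.2

instance : Group (OG N) where
  mul g h := ⟨g.1 * h.1, by
    rw [transpose_mul, Matrix.mul_assoc, ← Matrix.mul_assoc g.1ᵀ, g.2, Matrix.one_mul, h.2]⟩
  one := ⟨1, by simp⟩
  inv g := ⟨g.1ᵀ, by rw [transpose_transpose, g.mul_transpose]⟩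
  mul_assoc g h k := OG.ext (Matrix.mul_assoc g.1 h.1 k.1)
  one_mul g := OG.ext (Matrix.one_mul g.1)
  mul_one g := OG.ext (Matrix.mul_one g.1)
  inv_mul_cancel g := OG.ext g.2

theorem OG.mul_val (g h : OG N) : (g * h).1 = g.1 * h.1 := rfl

theorem OG.inv_val (g : OG N) : (g⁻¹).1 = g.1ᵀ := rfl

theorem OG.continuous_val : Continuous fun g : OG N => g.1 := continuous_subtype_val

instance : IsTopologicalGroup (OG N) where
  continuous_mul := Continuous.subtype_mk
    ((OG.continuous_val.comp continuous_fst).matrix_mul (OG.continuous_val.comp continuous_snd)) _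
  continuous_inv := Continuous.subtype_mk OG.continuous_val.matrix_transpose _

theorem isClosed_OG : IsClosed {g : Matrix (Fin N) (Fin N) ℂ | gᵀ * g = 1} :=
  isClosed_eq (by fun_prop) continuous_const

instance : SigmaCompactSpace (Matrix (Fin N) (Fin N) ℂ) :=
  inferInstanceAs (SigmaCompactSpace (Fin N → Fin N → ℂ))

instance : LocallyCompactSpace (Matrix (Fin N) (Fin N) ℂ) :=
  inferInstanceAs (LocallyCompactSpace (Fin N → Fin N → ℂ))

instance : SigmaCompactSpace (OG N) := isClosed_OG.sigmaCompactSpace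

instance : T2Space (NilCone N) :=
  inferInstanceAs (T2Space {x : Matrix (Fin N) (Fin N) ℂ // x ∈ g1 N ∧ IsNilpotent x})

/-- Cayley–Hamilton, as a nilpotent matrix has characteristic polynomial `X ^ N`. The uniform
exponent makes the cone closed, hence locally compact. -/
theorem isNilpotent_matrix_iff {a : Matrix (Fin N) (Fin N) ℂ} : IsNilpotent a ↔ a ^ N = 0 := by
  refine ⟨fun h => ?_, fun h => ⟨N, h⟩⟩
  have h1 := (Matrix.isNilpotent_charpoly_sub_pow_of_isNilpotent h).eq_zero
  rw [sub_eq_zero, Fintype.card_fin] at h1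
  have h2 := Matrix.aeval_self_charpoly a
  rwa [h1, map_pow, Polynomial.aeval_X] at h2

instance : LocallyCompactSpace (NilCone N) := by
  refine IsClosed.locallyCompactSpace (X := Matrix (Fin N) (Fin N) ℂ)
    (s := {x | x ∈ g1 N ∧ IsNilpotent x}) ?_
  simp only [g1, isNilpotent_matrix_iff]
  refine IsClosed.inter (IsClosed.inter (isClosed_eq ?_ ?_) (isClosed_eq ?_ ?_))
    (isClosed_eq ?_ ?_) <;> fun_prop

theorem OG.conj_pow (g : OG N) (x : Matrix (Fin N) (Fin N) ℂ) (k : ℕ) :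
    (g.1 * x * g.1ᵀ) ^ k = g.1 * x ^ k * g.1ᵀ := by
  induction k with
  | zero => rw [pow_zero, pow_zero, Matrix.mul_one, g.mul_transpose]
  | succ k ih =>
    rw [pow_succ, ih, pow_succ]
    calc g.1 * x ^ k * g.1ᵀ * (g.1 * x * g.1ᵀ) = g.1 * x ^ k * (g.1ᵀ * g.1) * x * g.1ᵀ := by
          noncomm_ring
      _ = g.1 * (x ^ k * x) * g.1ᵀ := by rw [g.2]; noncomm_ring

instance : MulAction (OG N) (NilCone N) where
  smul g x := ⟨g.1 * x.1 * g.1ᵀ, ⟨by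
    rw [Matrix.trace_mul_comm, ← Matrix.mul_assoc, g.2, Matrix.one_mul, x.2.1.1], by
    rw [transpose_mul, transpose_mul, transpose_transpose, x.transpose_eq, Matrix.mul_assoc]⟩, by
    obtain ⟨m, hm⟩ := x.2.2
    exact ⟨m, by rw [g.conj_pow, hm, Matrix.mul_zero, Matrix.zero_mul]⟩⟩
  one_smul x := Subtype.ext <| by
    change (1 : Matrix (Fin N) (Fin N) ℂ) * x.1 * 1ᵀ = x.1
    simp
  mul_smul g h x := Subtype.ext <| by
    change g.1 * h.1 * x.1 * (g.1 * h.1)ᵀ = g.1 * (h.1 * x.1 * h.1ᵀ) * g.1ᵀ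
    simp [Matrix.mul_assoc]

theorem OG.smul_val (g : OG N) (x : NilCone N) : (g • x).1 = g.1 * x.1 * g.1ᵀ := rfl

instance : ContinuousSMul (OG N) (NilCone N) where
  continuous_smul := by
    refine Continuous.subtype_mk (f := fun p : OG N × NilCone N => p.1.1 * p.2.1 * p.1.1ᵀ) ?_ _
    have h1 : Continuous fun p : OG N × NilCone N => p.1.1 := OG.continuous_val.comp continuous_fst
    have h2 : Continuous fun p : OG N × NilCone N => p.2.1 :=
      continuous_subtype_val.comp continuous_snd
    exact (h1.matrix_mul h2).matrix_mul h1.matrix_transpose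

theorem OG.smul_eq_iff {g : OG N} {x y : NilCone N} : g • x = y ↔ g.1 * x.1 = y.1 * g.1 := by
  constructor
  · rintro rfl
    rw [OG.smul_val, Matrix.mul_assoc (g.1 * x.1), g.2, Matrix.mul_one]
  · intro h
    refine Subtype.ext ?_
    rw [OG.smul_val, h, Matrix.mul_assoc, g.mul_transpose, Matrix.mul_one]

theorem isCentralIsometry_iff {x : NilCone N} {g : Matrix (Fin N) (Fin N) ℂ} :
    IsCentralIsometry (dotForm N) (endo x.1) (endo g) ↔ gᵀ * g = 1 ∧ g * x.1 = x.1 * g := by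
  have h2 : Commute (endo g) (endo x.1) ↔ g * x.1 = x.1 * g := by
    rw [Commute, SemiconjBy, ← map_mul, ← map_mul, EmbeddingLike.apply_eq_iff_eq]
  constructor
  · intro h
    refine ⟨?_, h2.1 h.comm⟩
    rw [Matrix.ext_iff_mulVec]
    intro v
    refine dotForm_ext fun w => ?_
    have := h.isometry w v
    rwa [endo_apply, endo_apply, dotForm_mulVec, mulVec_mulVec, ← one_mulVec v,
      mulVec_mulVec, Matrix.mul_one] at this
  · rintro ⟨h1, h3⟩
    refine ⟨fun u w => ?_, h2.2 h3⟩
    rw [endo_apply, endo_apply, dotForm_mulVec, mulVec_mulVec, h1, one_mulVec]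

theorem OG.isCentralIsometry {g : OG N} {x : NilCone N} (h : g • x = x) :
    IsCentralIsometry (dotForm N) (endo x.1) (endo g.1) :=
  isCentralIsometry_iff.2 ⟨g.2, OG.smul_eq_iff.1 h⟩

/-- The inclusion of the special orthogonal group. -/
def SO.toOG : SO N →* OG N where
  toFun k := ⟨SO.mat k, k.2⟩
  map_one' := rfl
  map_mul' _ _ := rfl

theorem SO.toOG_smul (k : SO N) (x : NilCone N) : SO.toOG k • x = k • x := by
  refine Subtype.ext ?_
  rw [OG.smul_val, NilpotentOrbitalComplexes.smul_val, SO.mat_inv]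
  rfl

theorem SO.isInducing_toOG : Topology.IsInducing (SO.toOG (N := N)) := by
  have h1 : Topology.IsInducing fun k : SO N => SO.mat k :=
    Topology.IsInducing.subtypeVal.comp Topology.IsInducing.subtypeVal
  have h2 : Topology.IsInducing fun g : OG N => g.1 := Topology.IsInducing.subtypeVal
  exact Topology.IsInducing.of_comp (Continuous.subtype_mk h1.continuous _) h2.continuous h1

theorem SO.exists_toOG_eq {g : OG N} (h : g.1.det = 1) : ∃ k : SO N, SO.toOG k = g :=
  ⟨⟨⟨g.1, h⟩, g.2⟩, rfl⟩

theorem SO.det_toOG (k : SO N) : (SO.toOG k).1.det = 1 := k.1.2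

theorem OG.det_eq (g : OG N) : g.1.det = 1 ∨ g.1.det = -1 := by
  have := congrArg Matrix.det g.2
  rw [det_mul, det_transpose, det_one] at this
  exact mul_self_eq_one_iff.1 this

theorem OG.isOpen_det : IsOpen {g : OG N | g.1.det = 1} := by
  have : {g : OG N | g.1.det = 1} = {g : OG N | g.1.det ≠ -1} := by
    ext g
    rcases g.det_eq with h | h <;> simp only [Set.mem_ofPred_eq, h] <;> norm_num
  rw [this]
  exact isOpen_ne_fun OG.continuous_val.matrix_det continuous_const

theorem SO.isOpenMap_toOG : IsOpenMap (SO.toOG (N := N)) := by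
  refine (SO.isInducing_toOG.isOpenMap ?_)
  convert OG.isOpen_det (N := N) using 1
  ext g
  exact ⟨by rintro ⟨k, rfl⟩; exact SO.det_toOG k, fun h => SO.exists_toOG_eq h⟩

end OrthogonalGroup

/-! ### Jordan types classify the orbits of the orthogonal group. -/

section JordanTypes

variable {N : ℕ}

/-- A full Jordan system of an element of the nilpotent cone. -/
structure FullJordan (x : NilCone N) where
  ι : Type
  [fintype : Fintype ι]
  [decidableEq : DecidableEq ι]
  j : ι → ℕ
  v : ι → Fin N → ℂ
  system : JordanSystem (dotForm N) (endo x.1) j v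
  full : ∑ a, (j a + 1) = Module.finrank ℂ (Fin N → ℂ)

attribute [instance] FullJordan.fintype FullJordan.decidableEq

theorem jordanSystem_empty {V : Type*} [AddCommGroup V] [Module ℂ V] (B : LinearMap.BilinForm ℂ V)
    (x : Module.End ℂ V) : JordanSystem B x (fun a : Empty => a.elim) (fun a : Empty => a.elim) :=
  ⟨fun a => a.elim, fun a => a.elim⟩

theorem SymmPair.exists_fullJordan {V : Type*} [AddCommGroup V] [Module ℂ V]
    [FiniteDimensional ℂ V] {B : LinearMap.BilinForm ℂ V} {x : Module.End ℂ V}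
    (hS : SymmPair B x) : ∃ (κ : Type) (_ : Fintype κ) (_ : DecidableEq κ) (j : κ → ℕ) (v : κ → V),
      JordanSystem B x j v ∧ ∑ a, (j a + 1) = Module.finrank ℂ V := by
  obtain ⟨κ, h₁, h₂, j, v, h, hfull, -⟩ := (jordanSystem_empty B x).exists_full hS
  exact ⟨κ, h₁, h₂, j, v, h, hfull⟩

/-- A choice of a full Jordan system. -/
def NilCone.jordan (x : NilCone N) : FullJordan x := Classical.choice <| by
  obtain ⟨κ, _, _, j, v, h, hfull⟩ := x.symmPair.exists_fullJordan
  exact ⟨⟨κ, j, v, h, hfull⟩⟩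

/-- The partition attached to a full Jordan system. -/
def FullJordan.partition {x : NilCone N} (J : FullJordan x) : N.Partition where
  parts := Finset.univ.val.map fun a => J.j a + 1
  parts_pos := by
    intro i hi
    obtain ⟨a, -, rfl⟩ := Multiset.mem_map.1 hi
    omega
  parts_sum := J.full.trans (by simp)

/-- The Jordan type. -/
def NilCone.type (x : NilCone N) : N.Partition := x.jordan.partition

/-- The ranks of the powers. -/
def NilCone.rk (x : NilCone N) (k : ℕ) : ℕ := Module.finrank ℂ (LinearMap.range (endo x.1 ^ k))

theorem FullJordan.rk_eq {x : NilCone N} (J : FullJordan x) (k : ℕ) :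
    x.rk k = ∑ a, (J.j a + 1 - k) :=
  J.system.finrank_range_pow x.symmPair J.full k

theorem OG.rk_smul (g : OG N) (x : NilCone N) (k : ℕ) : (g • x).rk k = x.rk k := by
  suffices H : ∀ (g : OG N) (x : NilCone N), (g • x).rk k ≤ x.rk k by
    refine le_antisymm (H g x) ?_
    conv_lhs => rw [← inv_smul_smul g x]
    exact H _ _
  intro g x
  rw [NilCone.rk, NilCone.rk, ← map_pow, ← map_pow, OG.smul_val, OG.conj_pow, map_mul, map_mul,
    Module.End.mul_eq_comp, Module.End.mul_eq_comp]
  exact (Submodule.finrank_mono (LinearMap.range_comp_le_range _ _)).trans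
    (by rw [LinearMap.range_comp]; exact Submodule.finrank_map_le _ _)

/-- Isometries which intertwine nilpotent symmetric matrices come from the orthogonal group. -/
theorem exists_smul_eq_of_isometry {x y : NilCone N} (g : (Fin N → ℂ) ≃ₗ[ℂ] (Fin N → ℂ))
    (hg : ∀ u w, dotForm N (g u) (g w) = dotForm N u w)
    (hx : ∀ u, g (endo x.1 u) = endo y.1 (g u)) : ∃ g : OG N, g • x = y := by
  obtain ⟨a, ha⟩ := (Matrix.toLinAlgEquiv' (R := ℂ) (n := Fin N)).surjective g.toLinearMap
  have ha' : ∀ u, a *ᵥ u = g u := fun u => by rw [← endo_apply]; exact LinearMap.congr_fun ha u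
  have h1 : aᵀ * a = 1 := by
    rw [Matrix.ext_iff_mulVec]
    intro u
    refine dotForm_ext fun w => ?_
    rw [← mulVec_mulVec, ← dotForm_mulVec, ha', ha', hg, one_mulVec]
  let g' : OG N := ⟨a, h1⟩
  refine ⟨g', OG.smul_eq_iff.2 ?_⟩
  change a * x.1 = y.1 * a
  rw [Matrix.ext_iff_mulVec]
  intro u
  have := hx u
  rw [endo_apply, endo_apply, ← ha', ← ha'] at this
  rw [← mulVec_mulVec, ← mulVec_mulVec, this]

theorem NilCone.exists_smul_eq_of_rk {x y : NilCone N} (h : ∀ k, x.rk k = y.rk k) :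
    ∃ g : OG N, g • x = y := by
  obtain ⟨e, he⟩ := exists_equiv_of_sum_eq (j := x.jordan.j) (j' := y.jordan.j)
    fun k => by rw [← x.jordan.rk_eq, ← y.jordan.rk_eq, h]
  obtain ⟨g, hg, hx⟩ := x.jordan.system.exists_isometry x.symmPair x.jordan.full y.symmPair
    y.jordan.system y.jordan.full e he
  exact exists_smul_eq_of_isometry g hg hx

theorem FullJordan.partition_eq {x y : NilCone N} (J : FullJordan x) (J' : FullJordan y) 
    (h : ∀ k, x.rk k = y.rk k) : J.partition = J'.partition := by
  obtain ⟨e, he⟩ := exists_equiv_of_sum_eq (j := J.j) (j' := J'.j)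
    fun k => by rw [← J.rk_eq, ← J'.rk_eq, h]
  refine Nat.Partition.ext ?_
  change Multiset.map _ _ = Multiset.map _ _
  rw [← Multiset.map_univ_val_equiv e, Multiset.map_map]
  exact Multiset.map_congr rfl fun a _ => by simp [he]

theorem FullJordan.type_eq {x : NilCone N} (J : FullJordan x) : x.type = J.partition :=
  x.jordan.partition_eq J fun _ => rfl

theorem NilCone.rk_eq (x : NilCone N) (k : ℕ) : x.rk k = (x.type.parts.map (· - k)).sum := by
  rw [x.jordan.rk_eq, NilCone.type, FullJordan.partition, Multiset.map_map]
  rfl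

theorem NilCone.type_eq_iff_rk {x y : NilCone N} : x.type = y.type ↔ ∀ k, x.rk k = y.rk k :=
  ⟨fun h k => by rw [x.rk_eq, y.rk_eq, h], fun h => x.jordan.partition_eq y.jordan h⟩

/-- Two elements are conjugate under the orthogonal group if and only if they have the same Jordan
type. -/
theorem NilCone.type_eq_iff {x y : NilCone N} : x.type = y.type ↔ ∃ g : OG N, g • x = y := by
  rw [NilCone.type_eq_iff_rk]
  refine ⟨NilCone.exists_smul_eq_of_rk, ?_⟩
  rintro ⟨g, rfl⟩ k
  exact (OG.rk_smul g x k).symm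

/-- Quadratic spaces of the same dimension are isometric. -/
theorem exists_isometry_of_finrank_eq {V V' : Type*} [AddCommGroup V] [Module ℂ V]
    [FiniteDimensional ℂ V] [AddCommGroup V'] [Module ℂ V'] [FiniteDimensional ℂ V']
    {B : LinearMap.BilinForm ℂ V} {B' : LinearMap.BilinForm ℂ V'} (hS : SymmPair B 0)
    (hS' : SymmPair B' 0) (h : Module.finrank ℂ V = Module.finrank ℂ V') :
    ∃ g : V ≃ₗ[ℂ] V', ∀ u w, B' (g u) (g w) = B u w := by
  -- For the zero endomorphism a full Jordan system is an orthonormal basis, so this is a case of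
  -- the general classification.
  obtain ⟨κ, _, _, j, v, hJ, hfull⟩ := hS.exists_fullJordan
  obtain ⟨κ', _, _, j', v', hJ', hfull'⟩ := hS'.exists_fullJordan
  obtain ⟨e, he⟩ := exists_equiv_of_sum_eq (j := j) (j' := j') fun k => by
    rcases k with _ | k
    · simpa [hfull, hfull'] using h
    · rw [← hJ.finrank_range_pow hS hfull, ← hJ'.finrank_range_pow hS' hfull', zero_pow k.succ_ne_zero,
        zero_pow k.succ_ne_zero, LinearMap.range_zero, LinearMap.range_zero, finrank_bot, finrank_bot]
  obtain ⟨g, hg, -⟩ := hJ.exists_isometry hS hfull hS' hJ' hfull' e he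
  exact ⟨g, hg⟩

/-- Every partition is the Jordan type of a nilpotent symmetric matrix. -/
theorem NilCone.exists_type_eq (l : N.Partition) : ∃ x : NilCone N, x.type = l := by
  classical
  let j : l.parts.ToType → ℕ := fun a => a.1 - 1
  have hj : ∀ a : l.parts.ToType, j a + 1 = a.1 := fun a => by
    have := l.parts_pos (Multiset.coe_mem (x := a))
    simp only [j]; omega
  have hsum : ∑ a, (j a + 1) = N := by
    simp only [hj]
    conv_rhs => rw [← l.parts_sum, ← Multiset.map_univ_coe l.parts]
    rfl
  obtain ⟨B, x, v, hS, hJ⟩ := exists_model j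
  have hfin : Module.finrank ℂ (JordanIndex j → ℂ) = N := by
    rw [Module.finrank_fintype_fun_eq_card, card_jordanIndex, hsum]
  have hzero : SymmPair (dotForm N) 0 := ⟨fun u v => by
    rw [dotForm_apply, dotForm_apply, dotProduct_comm], fun u h => dotForm_ext fun w => by
      rw [dotForm_apply, dotProduct_comm, ← dotForm_apply, h, map_zero], by simp, ⟨1, by simp⟩⟩
  -- The model lives on an abstract quadratic space. An isometry moves it to the standard form,
  -- where self-adjoint means symmetric.
  obtain ⟨g, hg⟩ := exists_isometry_of_finrank_eq (B := B)
    ⟨hS.symm, hS.nondeg, by simp, ⟨1, by simp⟩⟩ hzero (by rw [hfin]; simp)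
  have hg' : ∀ u w, B (g.symm u) (g.symm w) = dotForm N u w := fun u w => by
    rw [← hg, g.apply_symm_apply, g.apply_symm_apply]
  let a : Matrix (Fin N) (Fin N) ℂ := Matrix.toLinAlgEquiv'.symm (g.conjAlgEquiv ℂ x)
  have ha : endo a = g.conjAlgEquiv ℂ x := Matrix.toLinAlgEquiv'.apply_symm_apply _
  have ha' : ∀ u, endo a u = g (x (g.symm u)) := fun u => by rw [ha]; rfl
  have hnil : IsNilpotent a := (hS.nilp.map (g.conjAlgEquiv ℂ)).map Matrix.toLinAlgEquiv'.symm
  have hsymm : aᵀ = a := by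
    rw [Matrix.ext_iff_mulVec]
    intro u
    refine dotForm_ext fun w => ?_
    rw [← dotForm_mulVec, ← endo_apply, ← endo_apply, ha', ha', ← hg', ← hg', g.symm_apply_apply,
      g.symm_apply_apply, hS.selfadj]
  let y : NilCone N := ⟨a, ⟨(Matrix.isNilpotent_trace_of_isNilpotent hnil).eq_zero, hsymm⟩, hnil⟩
  let J : FullJordan y := ⟨_, j, _, hJ.map g hg fun u => by
    change _ = endo a (g u)
    rw [ha', g.symm_apply_apply], by rw [hsum]; simp⟩
  refine ⟨y, J.type_eq.trans (Nat.Partition.ext ?_)⟩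
  change Multiset.map (fun a => j a + 1) Finset.univ.val = l.parts
  conv_rhs => rw [← Multiset.map_univ_coe l.parts]
  exact Multiset.map_congr rfl fun a _ => hj a

end JordanTypes

/-! ### Rank conditions and the topology of the orbits. -/

section Strata

variable {N : ℕ}

-- A lower bound on the rank says that some `r` vectors have independent images, which is an open
-- condition.
attribute [local instance] Matrix.normedAddCommGroup Matrix.normedSpace in
theorem NilCone.isOpen_le_rk (r k : ℕ) : IsOpen {y : NilCone N | r ≤ y.rk k} := by
  have h : {y : NilCone N | r ≤ y.rk k} = ⋃ f : Fin r → Fin N → ℂ,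
      {y : NilCone N | LinearIndependent ℂ fun i => (y.1 ^ k) *ᵥ f i} := by
    ext y
    simp only [Set.mem_ofPred_eq, Set.mem_iUnion]
    constructor
    · intro h
      obtain ⟨g, hg⟩ := exists_linearIndependent_of_le_finrank (R := ℂ)
        (M := LinearMap.range (endo y.1 ^ k)) h
      choose f hf using fun i => (g i).2
      refine ⟨f, ?_⟩
      have := hg.map' (Submodule.subtype _) (Submodule.ker_subtype _)
      have hfg : (fun i => (y.1 ^ k) *ᵥ f i) = (LinearMap.range (endo y.1 ^ k)).subtype ∘ g :=
        funext fun i => (endo_apply _ _).symm.trans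
          ((LinearMap.congr_fun (map_pow Matrix.toLinAlgEquiv' y.1 k) _).trans (hf i))
      rw [hfg]
      exact this
    · rintro ⟨f, hf⟩
      have h : LinearIndependent ℂ fun i =>
          (⟨(y.1 ^ k) *ᵥ f i, f i, by rw [← map_pow]; exact endo_apply _ _⟩ :
            LinearMap.range (endo y.1 ^ k)) :=
        LinearIndependent.of_comp (Submodule.subtype _) hf
      simpa [NilCone.rk] using h.fintype_card_le_finrank
  rw [h]
  refine isOpen_iUnion fun f => (isOpen_setOfPred_linearIndependent (𝕜 := ℂ)).preimage
    (f := fun (y : NilCone N) i => (y.1 ^ k) *ᵥ f i) ?_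
  have hy : Continuous fun y : NilCone N => y.1 := continuous_subtype_val
  exact continuous_pi fun i => (hy.pow k).matrix_mulVec continuous_const

theorem NilCone.rk_eq_zero (x : NilCone N) {k : ℕ} (hk : N ≤ k) : x.rk k = 0 := by
  rw [NilCone.rk, ← map_pow, pow_eq_zero_of_le hk (isNilpotent_matrix_iff.1 x.2.2), map_zero,
    LinearMap.range_zero, finrank_bot]

/-- The orbit is cut out by prescribing ranks of powers. Lower bounds are open, upper bounds closed,
and only powers below `N` need an open condition. -/
theorem NilCone.isLocallyClosed_orbit (x : NilCone N) :
    IsLocallyClosed (MulAction.orbit (OG N) x) := by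
  refine ⟨⋂ k ∈ Finset.range N, {y | x.rk k ≤ y.rk k}, ⋂ k, {y | x.rk k + 1 ≤ y.rk k}ᶜ,
    isOpen_biInter_finset fun k _ => isOpen_le_rk _ k,
    isClosed_iInter fun k => (isOpen_le_rk _ k).isClosed_compl, ?_⟩
  ext y
  simp only [Set.mem_inter_iff, Set.mem_iInter, Finset.mem_range, Set.mem_compl_iff,
    Set.mem_ofPred_eq, not_le, Nat.lt_succ_iff]
  constructor
  · rintro ⟨g, rfl⟩
    exact ⟨fun k _ => (OG.rk_smul g x k).ge, fun k => (OG.rk_smul g x k).le⟩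
  · rintro ⟨h1, h2⟩
    obtain ⟨g, hg⟩ := NilCone.exists_smul_eq_of_rk (x := x) (y := y) fun k => by
      rcases lt_or_ge k N with hk | hk
      · exact le_antisymm (h1 k hk) (h2 k)
      · rw [x.rk_eq_zero hk, y.rk_eq_zero hk]
    exact ⟨g, hg⟩

instance (x : NilCone N) : ContinuousSMul (OG N) (MulAction.orbit (OG N) x) where
  continuous_smul := Continuous.subtype_mk
    (continuous_fst.smul (continuous_subtype_val.comp continuous_snd)) _

/-- The Baire category form of the open mapping theorem: a σ-compact group acts transitively on a
locally compact orbit. -/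
theorem OG.isOpenMap_orbit (x : NilCone N) (W : Set (OG N)) (hW : IsOpen W) :
    ∃ Q : Set (NilCone N), IsOpen Q ∧ ∀ y, y ∈ (fun g : OG N => g • x) '' W ↔
      y ∈ MulAction.orbit (OG N) x ∧ y ∈ Q := by
  have : LocallyCompactSpace (MulAction.orbit (OG N) x) :=
    (NilCone.isLocallyClosed_orbit x).locallyCompactSpace
  have h := isOpenMap_smul_of_sigmaCompact (G := OG N)
    (⟨x, MulAction.mem_orbit_self x⟩ : MulAction.orbit (OG N) x) W hW
  obtain ⟨Q, hQ, hQW⟩ := isOpen_induced_iff.1 h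
  refine ⟨Q, hQ, fun y => ⟨?_, ?_⟩⟩
  · rintro ⟨g, hg, rfl⟩
    refine ⟨MulAction.mem_orbit x g, ?_⟩
    have : g • (⟨x, MulAction.mem_orbit_self x⟩ : MulAction.orbit (OG N) x) ∈ Subtype.val ⁻¹' Q := by
      rw [hQW]; exact ⟨g, hg, rfl⟩
    exact this
  · rintro ⟨hy, hyQ⟩
    have : (⟨y, hy⟩ : MulAction.orbit (OG N) x) ∈ Subtype.val ⁻¹' Q := hyQ
    rw [hQW] at this
    obtain ⟨g, hg, hgy⟩ := this
    exact ⟨g, hg, congrArg Subtype.val hgy⟩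

theorem SO.smul_mem_orbit (k : SO N) (x : NilCone N) : k • x ∈ MulAction.orbit (OG N) x :=
  ⟨SO.toOG k, SO.toOG_smul k x⟩

theorem SO.isOpenMap_orbit (x : NilCone N) (W : Set (SO N)) (hW : IsOpen W) :
    ∃ Q : Set (NilCone N), IsOpen Q ∧ ∀ y, y ∈ (fun k : SO N => k • x) '' W ↔
      y ∈ MulAction.orbit (OG N) x ∧ y ∈ Q := by
  obtain ⟨Q, hQ, h⟩ := OG.isOpenMap_orbit x _ (SO.isOpenMap_toOG W hW)
  refine ⟨Q, hQ, fun y => ?_⟩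
  rw [← h, Set.image_image]
  simp only [SO.toOG_smul]

theorem NilpotentOrbit.mem_orbit_iff {O : NilpotentOrbit N} {x y : NilCone N} (hx : x ∈ O.orbit) :
    y ∈ O.orbit ↔ ∃ k : SO N, k • x = y := by
  rw [MulAction.orbitRel.Quotient.mem_orbit] at hx
  subst hx
  rfl

theorem NilpotentOrbit.isHomogeneous {O : NilpotentOrbit N} (x : O.orbit) :
    IsHomogeneous (SO N) x where
  continuous := by
    refine Continuous.subtype_mk (f := fun k : SO N => k • x.1) ?_ _
    have : Continuous fun k : SO N => SO.toOG k • x.1 :=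
      (SO.isInducing_toOG.continuous).smul continuous_const
    simpa only [SO.toOG_smul] using this
  isOpenMap W hW := by
    obtain ⟨Q, hQ, h⟩ := SO.isOpenMap_orbit x.1 W hW
    convert hQ.preimage (continuous_subtype_val (p := fun y => y ∈ O.orbit)) using 1
    ext y
    constructor
    · rintro ⟨k, hk, rfl⟩
      exact ((h (k • x.1)).1 ⟨k, hk, rfl⟩).2
    · intro hy
      obtain ⟨l, hl⟩ := (NilpotentOrbit.mem_orbit_iff x.2).1 y.2
      obtain ⟨k, hk, hky⟩ := (h y.1).2 ⟨hl ▸ SO.smul_mem_orbit l x.1, hy⟩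
      exact ⟨k, hk, Subtype.ext hky⟩
  surjective y := by
    obtain ⟨k, hk⟩ := (NilpotentOrbit.mem_orbit_iff x.2).1 y.2
    exact ⟨k, Subtype.ext hk⟩

/-- Different orbits are separated by an open set. -/
theorem NilpotentOrbit.exists_open {O O' : NilpotentOrbit N} (h : O ≠ O') {x x' : NilCone N}
    (hx : x ∈ O.orbit) (hx' : x' ∈ O'.orbit) : ∃ Q : Opens (NilCone N),
      (x ∈ Q ∧ ∀ z ∈ O'.orbit, z ∉ Q) ∨ (x' ∈ Q ∧ ∀ z ∈ O.orbit, z ∉ Q) := by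
  have hrk : ∀ {O : NilpotentOrbit N} {x y : NilCone N}, x ∈ O.orbit → y ∈ O.orbit → ∀ k,
      y.rk k = x.rk k := by
    intro O x y hx hy k
    obtain ⟨l, rfl⟩ := (NilpotentOrbit.mem_orbit_iff hx).1 hy
    rw [← SO.toOG_smul, OG.rk_smul]
  -- With equal ranks both orbits lie in one O(N)-orbit, where SO(N)-orbits are open. Otherwise a
  -- lower bound on a rank separates them.
  by_cases hk : ∀ k, x.rk k = x'.rk k
  · obtain ⟨Q, hQ, hxQ⟩ := SO.isOpenMap_orbit x Set.univ isOpen_univ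
    refine ⟨⟨Q, hQ⟩, Or.inl ⟨((hxQ x).1 ⟨1, trivial, one_smul _ x⟩).2, fun z hz hzQ => h ?_⟩⟩
    obtain ⟨g, hg⟩ := NilCone.exists_smul_eq_of_rk (x := x) (y := z) fun k => by
      rw [hk k, hrk hx' hz]
    obtain ⟨k, -, hk⟩ := (hxQ z).2 ⟨⟨g, hg⟩, hzQ⟩
    have hz' := (NilpotentOrbit.mem_orbit_iff hx).2 ⟨k, hk⟩
    rw [MulAction.orbitRel.Quotient.mem_orbit] at hz hz'
    rw [← hz, ← hz']
  · push Not at hk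
    obtain ⟨k, hk⟩ := hk
    rcases lt_or_gt_of_ne hk with hk | hk
    · exact ⟨⟨_, NilCone.isOpen_le_rk (x'.rk k) k⟩, Or.inr ⟨le_refl (x'.rk k), fun z hz hzQ =>
        absurd (le_trans hzQ (hrk hx hz k).le) hk.not_ge⟩⟩
    · exact ⟨⟨_, NilCone.isOpen_le_rk (x.rk k) k⟩, Or.inl ⟨le_refl (x.rk k), fun z hz hzQ =>
        absurd (le_trans hzQ (hrk hx' hz k).le) hk.not_ge⟩⟩

end Strata

/-! ### Connecting reflections of equal length. -/

section ReflectionPaths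

variable {N : ℕ}

open Topology

/-- A nonzero polynomial has finitely many zeros, and removing them does not disconnect the real
plane. -/
theorem isPreconnected_compl_zeros {a b c : ℂ} (ha : a ≠ 0) :
    _root_.IsPreconnected {z : ℂ | a + b * z + c * z ^ 2 ≠ 0} := by
  let P : Polynomial ℂ := Polynomial.C a + Polynomial.C b * Polynomial.X +
    Polynomial.C c * Polynomial.X ^ 2
  have hP : ∀ z, P.eval z = a + b * z + c * z ^ 2 := fun z => by simp [P]
  have hP0 : P ≠ 0 := fun h => ha (by have := hP 0; rw [h] at this; simpa using this.symm)
  have hfin := Polynomial.finite_setOfPred_isRoot hP0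
  have hset : {z : ℂ | a + b * z + c * z ^ 2 ≠ 0} = {z | P.IsRoot z}ᶜ := by
    ext z
    simp only [Set.mem_ofPred_eq, Set.mem_compl_iff, Polynomial.IsRoot.def, hP, ne_eq]
  rw [hset]
  exact (hfin.countable.isPathConnected_compl_of_one_lt_rank
    (by rw [Complex.rank_real_complex]; norm_num)).isConnected.isPreconnected

/-- The matrix of an endomorphism. -/
abbrev mtx (f : Module.End ℂ (Fin N → ℂ)) : Matrix (Fin N) (Fin N) ℂ := Matrix.toLinAlgEquiv'.symm f

theorem mtx_apply (f : Module.End ℂ (Fin N → ℂ)) (i j : Fin N) :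
    mtx f i j = f (Pi.single j 1) i := LinearMap.toMatrixAlgEquiv'_apply f i j

theorem endo_mtx (f : Module.End ℂ (Fin N → ℂ)) : endo (mtx f) = f :=
  Matrix.toLinAlgEquiv'.apply_symm_apply f

theorem mtx_ringInverse {f : Module.End ℂ (Fin N → ℂ)} (hf : IsUnit f) :
    mtx (Ring.inverse f) = (mtx f)⁻¹ := by
  refine (Matrix.inv_eq_right_inv ?_).symm
  rw [mtx, mtx, ← map_mul, Ring.mul_inverse_cancel f hf, map_one]

theorem mtx_cyclicRefl {B : LinearMap.BilinForm ℂ (Fin N → ℂ)} {X : Module.End ℂ (Fin N → ℂ)}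
    {k : ℕ} {u : Fin N → ℂ} (h : IsUnit (cyclicGram B X k u)) : mtx (cyclicRefl B X k u) =
      1 - (2 : ℂ) • ((mtx (cyclicGram B X k u))⁻¹ * mtx (cyclicMap B X k u)) := by
  rw [cyclicRefl, cyclicProj, ← mtx_ringInverse h, ← map_mul, ← map_smul]
  refine (map_sub Matrix.toLinAlgEquiv'.symm _ _).trans ?_
  rw [map_one]

theorem continuous_mtx_cyclicRefl {Z : Type*} [TopologicalSpace Z] {x : NilCone N} {k : ℕ}
    {p : Z → Fin N → ℂ} (hp : Continuous p) (h : ∀ z, Aniso (dotForm N) (endo x.1) k (p z)) :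
    Continuous fun z => mtx (cyclicRefl (dotForm N) (endo x.1) k (p z)) := by
  have hpow : ∀ l, Continuous fun z => (endo x.1 ^ l) (p z) := fun l =>
    (LinearMap.continuous_of_finiteDimensional (endo x.1 ^ l)).comp hp
  have hdot : ∀ {f g : Z → Fin N → ℂ}, Continuous f → Continuous g →
      Continuous fun z => dotForm N (f z) (g z) := fun hf hg => hf.dotProduct hg
  have h1 : Continuous fun z => mtx (cyclicGram (dotForm N) (endo x.1) k (p z)) := by
    simp only [mtx, cyclicGram, map_sum, map_smul]
    exact continuous_finsetSum _ fun l _ => (hdot hp (hpow l)).smul continuous_const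
  have h2 : Continuous fun z => mtx (cyclicMap (dotForm N) (endo x.1) k (p z)) := by
    refine continuous_matrix fun i j => ?_
    simp only [mtx_apply, cyclicMap_apply, Finset.sum_apply, Pi.smul_apply]
    exact continuous_finsetSum _ fun l _ => (hdot hp continuous_const).smul
      ((continuous_apply i).comp (hpow _))
  have h3 : Continuous fun z => (mtx (cyclicGram (dotForm N) (endo x.1) k (p z)))⁻¹ := by
    simp only [Matrix.inv_def, Ring.inverse_eq_inv']
    refine (h1.matrix_det.inv₀ fun z => ?_).smul h1.matrix_adjugate
    have := (isUnit_cyclicGram x.symmPair (h z)).map Matrix.toLinAlgEquiv'.symm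
    exact ((Matrix.isUnit_iff_isUnit_det _).1 this).ne_zero
  have h4 := fun z => mtx_cyclicRefl (isUnit_cyclicGram x.symmPair (h z))
  simp only [h4]
  exact continuous_const.sub ((h3.matrix_mul h2).fun_const_smul (2 : ℂ))

/-- The stabilizer in the orthogonal group. -/
abbrev Stab (x : NilCone N) : Subgroup (OG N) := MulAction.stabilizer (OG N) x

theorem Stab.isCentralIsometry {x : NilCone N} (g : Stab x) :
    IsCentralIsometry (dotForm N) (endo x.1) (endo g.1.1) :=
  OG.isCentralIsometry (MulAction.mem_stabilizer_iff.1 g.2)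

/-- An isometry commuting with `x`, as an element of the stabilizer of `x`. -/
def Stab.ofEnd {x : NilCone N} (f : Module.End ℂ (Fin N → ℂ))
    (hf : IsCentralIsometry (dotForm N) (endo x.1) f) : Stab x :=
  have h := isCentralIsometry_iff.1 ((endo_mtx f).symm ▸ hf)
  ⟨⟨mtx f, h.1⟩, MulAction.mem_stabilizer_iff.2 (OG.smul_eq_iff.2 h.2)⟩

theorem Stab.ext {x : NilCone N} {g h : Stab x} (e : endo g.1.1 = endo h.1.1) : g = h :=
  Subtype.ext (OG.ext (Matrix.toLinAlgEquiv'.injective e))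

/-- The reflections in the stabilizer. -/
def Stab.refl {x : NilCone N} {k : ℕ} {u : Fin N → ℂ} (hu : Aniso (dotForm N) (endo x.1) k u) :
    Stab x :=
  Stab.ofEnd _ (cyclicRefl_isCentralIsometry x.symmPair hu)

theorem Stab.endo_refl {x : NilCone N} {k : ℕ} {u : Fin N → ℂ}
    (hu : Aniso (dotForm N) (endo x.1) k u) :
    endo (Stab.refl hu).1.1 = cyclicRefl (dotForm N) (endo x.1) k u := endo_mtx _

theorem Stab.endo_mul {x : NilCone N} (g h : Stab x) :
    endo (g * h).1.1 = endo g.1.1 * endo h.1.1 := map_mul _ _ _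

theorem Stab.endo_one {x : NilCone N} : endo (1 : Stab x).1.1 = 1 := map_one _

/-- The stabilizer is generated by reflections. -/
theorem Stab.closure_refl (x : NilCone N) : Submonoid.closure {g : Stab x | ∃ (k : ℕ)
    (u : Fin N → ℂ) (hu : Aniso (dotForm N) (endo x.1) k u), g = Stab.refl hu} = ⊤ := by
  refine (Submonoid.eq_top_iff' _).2 fun g => ?_
  suffices H : ∀ f ∈ Submonoid.closure (reflections (dotForm N) (endo x.1)),
      ∃ h ∈ Submonoid.closure {g : Stab x | ∃ (k : ℕ)
        (u : Fin N → ℂ) (hu : Aniso (dotForm N) (endo x.1) k u), g = Stab.refl hu},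
          endo h.1.1 = f by
    obtain ⟨h, hh, e⟩ := H _ ((Stab.isCentralIsometry g).mem_closure x.symmPair)
    rwa [← Stab.ext e]
  intro f hf
  induction hf using Submonoid.closure_induction with
  | mem f hf =>
    obtain ⟨k, u, hu, rfl⟩ := hf
    exact ⟨Stab.refl hu, Submonoid.subset_closure ⟨k, u, hu, rfl⟩, Stab.endo_refl hu⟩
  | one => exact ⟨1, one_mem _, Stab.endo_one⟩
  | mul f f' _ _ h h' =>
    obtain ⟨g, hg, rfl⟩ := h
    obtain ⟨g', hg', rfl⟩ := h'
    exact ⟨g * g', mul_mem hg hg', Stab.endo_mul g g'⟩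

theorem Stab.refl_mul_self {x : NilCone N} {k : ℕ} {u : Fin N → ℂ}
    (hu : Aniso (dotForm N) (endo x.1) k u) : Stab.refl hu * Stab.refl hu = 1 :=
  Stab.ext <| by rw [Stab.endo_mul, Stab.endo_refl, cyclicRefl_mul_self x.symmPair hu, Stab.endo_one]

theorem Stab.mul_refl {x : NilCone N} {k : ℕ} {u : Fin N → ℂ}
    (hu : Aniso (dotForm N) (endo x.1) k u) (g : Stab x) :
    g * Stab.refl hu = Stab.refl ((Stab.isCentralIsometry g).aniso hu) * g :=
  Stab.ext <| by
    rw [Stab.endo_mul, Stab.endo_mul, Stab.endo_refl, Stab.endo_refl,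
      (Stab.isCentralIsometry g).mul_cyclicRefl]

/-- Reflections of the same length lie in the same component. -/
theorem Stab.refl_mul_refl_mem {x : NilCone N} {k : ℕ} {u w : Fin N → ℂ}
    (hu : Aniso (dotForm N) (endo x.1) k u) (hw : Aniso (dotForm N) (endo x.1) k w) :
    (Stab.refl hu)⁻¹ * Stab.refl hw ∈ Subgroup.connectedComponentOfOne (Stab x) := by
  -- The complex line through `u` and `w`. The anisotropy condition along it is the nonvanishing of
  -- a quadratic polynomial, so the admissible parameters form a connected set containing 0 and 1.
  let p (z : ℂ) : Fin N → ℂ := u + z • (w - u)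
  let β (u w : Fin N → ℂ) : ℂ := dotForm N u ((endo x.1 ^ k) w)
  let Z : Set ℂ := {z | β u u + (β u (w - u) + β (w - u) u) * z + β (w - u) (w - u) * z ^ 2 ≠ 0}
  have hZ : ∀ z, β u u + (β u (w - u) + β (w - u) u) * z + β (w - u) (w - u) * z ^ 2 =
      β (p z) (p z) := by
    intro z
    simp only [β, p, map_add, map_smul, LinearMap.add_apply, LinearMap.smul_apply, smul_eq_mul]
    ring
  have han : ∀ z : Z, Aniso (dotForm N) (endo x.1) k (p z.1) := fun z => by
    refine ⟨?_, ?_⟩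
    · simp only [p, map_add, map_smul, map_sub, hu.1, hw.1]
      simp
    · have := z.2
      simp only [Z, Set.mem_ofPred_eq, hZ] at this
      exact this
  have hp : Continuous fun z : Z => p z.1 := by fun_prop
  have hf : Continuous fun z : Z => Stab.refl (han z) :=
    Continuous.subtype_mk (Continuous.subtype_mk (continuous_mtx_cyclicRefl hp han) _) _
  have hZc : PreconnectedSpace Z :=
    isPreconnected_iff_preconnectedSpace.1 (isPreconnected_compl_zeros hu.2)
  have hc : _root_.IsPreconnected (Set.range fun z : Z => (Stab.refl hu)⁻¹ * Stab.refl (han z)) :=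
    isPreconnected_range (continuous_const.mul hf)
  have h0 : (0 : ℂ) ∈ Z := by
    simp only [Z, Set.mem_ofPred_eq, hZ]; simpa [p] using hu.2
  have h1 : (1 : ℂ) ∈ Z := by
    simp only [Z, Set.mem_ofPred_eq, hZ]; simpa [p] using hw.2
  have e0 : p 0 = u := by simp [p]
  have e1 : p 1 = w := by simp [p]
  have key : ∀ {u' : Fin N → ℂ} (hu' : Aniso (dotForm N) (endo x.1) k u') (e : u' = u),
      Stab.refl hu' = Stab.refl hu := by rintro _ _ rfl; rfl
  have key' : ∀ {u' : Fin N → ℂ} (hu' : Aniso (dotForm N) (endo x.1) k u') (e : u' = w),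
      Stab.refl hu' = Stab.refl hw := by rintro _ _ rfl; rfl
  refine hc.subset_connectedComponent ⟨⟨0, h0⟩, ?_⟩ ⟨⟨1, h1⟩, ?_⟩
  · dsimp only
    rw [key (han ⟨0, h0⟩) e0, inv_mul_cancel]
  · dsimp only
    rw [key' (han ⟨1, h1⟩) e1]

end ReflectionPaths

/-! ### Component groups of stabilizers. -/

section ComponentGroups

variable {N : ℕ} {x : NilCone N} (J : FullJordan x)

/-- The determinant of an element of the stabilizer on a multiplicity space. -/
def FullJordan.multDet (i : ℕ) (g : Stab x) : ℂ :=
  (multMatrix (dotForm N) (endo x.1) J.j J.v i (endo g.1.1)).det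

theorem FullJordan.multDet_mul (i : ℕ) (g h : Stab x) :
    J.multDet i (g * h) = J.multDet i g * J.multDet i h := by
  rw [multDet, Stab.endo_mul, multMatrix_mul x.symmPair J.system J.full i
    (Stab.isCentralIsometry g) (Stab.isCentralIsometry h), det_mul]
  rfl

theorem FullJordan.multDet_one (i : ℕ) : J.multDet i 1 = 1 := by
  rw [multDet, Stab.endo_one, multMatrix_one J.system, det_one]

theorem FullJordan.multDet_refl (i : ℕ) {k : ℕ} {u : Fin N → ℂ}
    (hu : Aniso (dotForm N) (endo x.1) k u) :
    J.multDet i (Stab.refl hu) = if i = k then -1 else 1 := by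
  rw [multDet, Stab.endo_refl, det_multMatrix_cyclicRefl x.symmPair J.system J.full i hu]

theorem FullJordan.multDet_eq (i : ℕ) (g : Stab x) : J.multDet i g = 1 ∨ J.multDet i g = -1 := by
  have hg : g ∈ (⊤ : Submonoid (Stab x)) := trivial
  rw [← Stab.closure_refl] at hg
  induction hg using Submonoid.closure_induction with
  | mem g hg =>
    obtain ⟨k, u, hu, rfl⟩ := hg
    rw [J.multDet_refl]
    split_ifs <;> simp
  | one => exact Or.inl (J.multDet_one i)
  | mul g h _ _ h₁ h₂ =>
    rw [J.multDet_mul]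
    rcases h₁ with h₁ | h₁ <;> rcases h₂ with h₂ | h₂ <;> simp [h₁, h₂]

theorem FullJordan.continuous_multDet (i : ℕ) : Continuous (J.multDet i) := by
  refine Continuous.matrix_det (continuous_matrix fun a b => ?_)
  have h1 : Continuous fun g : Stab x => g.1.1 *ᵥ J.v b :=
    (OG.continuous_val.comp continuous_subtype_val).matrix_mulVec continuous_const
  exact (LinearMap.continuous_of_finiteDimensional
    ((dotForm N (J.v a)).comp (endo x.1 ^ i))).comp h1

/-- The set of the lengths minus one of the cyclic modules. -/
abbrev FullJordan.Index : Type := ↥(Finset.univ.image J.j)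

open Classical in
/-- The signs of the determinants on the multiplicity spaces. -/
def FullJordan.signs : Stab x →* (J.Index → ℤˣ) where
  toFun g i := if J.multDet i g = 1 then 1 else -1
  map_one' := funext fun i => by rw [J.multDet_one, if_pos rfl]; rfl
  map_mul' g h := funext fun i => by
    rw [Pi.mul_apply, J.multDet_mul]
    rcases J.multDet_eq i g with h₁ | h₁ <;> rcases J.multDet_eq i h with h₂ | h₂ <;>
      norm_num [h₁, h₂]

theorem FullJordan.signs_eq_one_iff {g : Stab x} : J.signs g = 1 ↔ ∀ i : J.Index,
    J.multDet i g ≠ -1 := by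
  rw [funext_iff]
  refine forall_congr' fun i => ?_
  change (if J.multDet i g = 1 then (1 : ℤˣ) else -1) = 1 ↔ _
  rcases J.multDet_eq i g with h | h <;> norm_num [h]

/-- Otherwise the multiplicity matrix is empty with determinant 1, whereas the reflection must have
determinant -1 on it. -/
theorem FullJordan.mem_index {k : ℕ} {u : Fin N → ℂ} (hu : Aniso (dotForm N) (endo x.1) k u) :
    k ∈ Finset.univ.image J.j := by
  by_contra hk
  have h := J.multDet_refl k hu
  have : IsEmpty {a // J.j a = k} :=
    ⟨fun a => hk (Finset.mem_image.2 ⟨a.1, Finset.mem_univ _, a.2⟩)⟩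
  rw [if_pos rfl, multDet, Matrix.det_isEmpty] at h
  norm_num at h

theorem FullJordan.signs_refl {k : ℕ} {u : Fin N → ℂ} (hu : Aniso (dotForm N) (endo x.1) k u) :
    J.signs (Stab.refl hu) = Pi.mulSingle ⟨k, J.mem_index hu⟩ (-1) := by
  funext i
  change (if J.multDet i (Stab.refl hu) = 1 then (1 : ℤˣ) else -1) = _
  rw [J.multDet_refl, Pi.mulSingle_apply]
  by_cases hik : (i : ℕ) = k
  · rw [if_pos hik, if_pos (Subtype.ext hik), if_neg (by norm_num)]
  · rw [if_neg hik, if_neg (fun h => hik (congrArg Subtype.val h)), if_pos rfl]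

theorem FullJordan.aniso (a : J.ι) : Aniso (dotForm N) (endo x.1) (J.j a) (J.v a) :=
  ⟨J.system.kill a, by rw [J.system.gram]; simp⟩

theorem FullJordan.signs_surjective : Function.Surjective J.signs := by
  intro ε
  refine MonoidHom.mem_range.1 (Subgroup.pi_mem_of_mulSingle_mem ε fun i => ?_)
  obtain ⟨i, hi⟩ := i
  rcases Int.units_eq_one_or (ε ⟨i, hi⟩) with h | h
  · rw [h, Pi.mulSingle_one]; exact one_mem _
  · rw [h]
    obtain ⟨a, -, rfl⟩ := Finset.mem_image.1 hi
    exact ⟨Stab.refl (J.aniso a), J.signs_refl _⟩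

/-- The determinant in terms of the signs. -/
def FullJordan.signDet : (J.Index → ℤˣ) →* ℤˣ :=
  ∏ i : J.Index, (powMonoidHom (i.1 + 1)).comp (Pi.evalMonoidHom (fun _ : J.Index => ℤˣ) i)

theorem FullJordan.signDet_apply (ε : J.Index → ℤˣ) : J.signDet ε = ∏ i, ε i ^ (i.1 + 1) := by
  simp [signDet]

theorem FullJordan.signDet_mulSingle (i : J.Index) (ε : ℤˣ) :
    J.signDet (Pi.mulSingle i ε) = ε ^ (i.1 + 1) := by
  rw [signDet_apply, Finset.prod_eq_single i (fun j _ hj => by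
    rw [Pi.mulSingle_eq_of_ne hj, one_pow]) (by simp), Pi.mulSingle_eq_same]

/-- Both sides are multiplicative, and they agree on the generating reflections. -/
theorem FullJordan.det_eq (g : Stab x) : g.1.1.det = ((J.signDet (J.signs g) : ℤ) : ℂ) := by
  have hg : g ∈ (⊤ : Submonoid (Stab x)) := trivial
  rw [← Stab.closure_refl] at hg
  induction hg using Submonoid.closure_induction with
  | mem g hg =>
    obtain ⟨k, u, hu, rfl⟩ := hg
    rw [J.signs_refl, J.signDet_mulSingle]
    have h := det_cyclicRefl x.symmPair hu
    rw [← Stab.endo_refl hu] at h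
    refine (LinearMap.det_toLin' _).symm.trans (h.trans ?_)
    simp
  | one =>
    rw [map_one, map_one]
    change (1 : Matrix (Fin N) (Fin N) ℂ).det = _
    simp
  | mul g h _ _ h₁ h₂ =>
    rw [map_mul, map_mul, Units.val_mul, Int.cast_mul, ← h₁, ← h₂]
    exact det_mul _ _

theorem connectedComponentOfOne_normal (G : Type*) [TopologicalSpace G] [Group G]
    [IsTopologicalGroup G] : (Subgroup.connectedComponentOfOne G).Normal := by
  refine ⟨fun h hh g => ?_⟩
  have hc : Continuous fun a : G => g * a * g⁻¹ := by fun_prop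
  refine (isPreconnected_connectedComponent.image _ hc.continuousOn).subset_connectedComponent
    ⟨1, mem_connectedComponent, by simp⟩ ⟨h, hh, rfl⟩

/-- The homomorphism from the group of signs attached to an involution. -/
def signHom {M : Type*} [Monoid M] (c : M) (hc : c * c = 1) : ℤˣ →* M where
  toFun ε := if ε = 1 then 1 else c
  map_one' := if_pos rfl
  map_mul' ε δ := by
    rcases Int.units_eq_one_or ε with rfl | rfl <;> rcases Int.units_eq_one_or δ with rfl | rfl <;>
      simp [hc]

/-- The kernel of the signs is contained in the identity component. -/
theorem FullJordan.mem_connectedComponentOfOne {g : Stab x} (hg : J.signs g = 1) :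
    g ∈ Subgroup.connectedComponentOfOne (Stab x) := by
  have := connectedComponentOfOne_normal (Stab x)
  let Q := Stab x ⧸ Subgroup.connectedComponentOfOne (Stab x)
  let π : Stab x →* Q := QuotientGroup.mk' _
  have hrefl : ∀ {k : ℕ} {u w : Fin N → ℂ} (hu : Aniso (dotForm N) (endo x.1) k u)
      (hw : Aniso (dotForm N) (endo x.1) k w), π (Stab.refl hu) = π (Stab.refl hw) :=
    fun hu hw => QuotientGroup.eq.2 (Stab.refl_mul_refl_mem hu hw)
  -- Conjugation turns a reflection into one of the same length, which has the same class. The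
  -- classes of reflections are thus central.
  have hcen : ∀ {k : ℕ} {u : Fin N → ℂ} (hu : Aniso (dotForm N) (endo x.1) k u),
      π (Stab.refl hu) ∈ Submonoid.center Q := by
    intro k u hu
    rw [Submonoid.mem_center_iff]
    intro y
    obtain ⟨h, rfl⟩ := QuotientGroup.mk'_surjective _ y
    change π h * _ = _ * π h
    rw [← map_mul, Stab.mul_refl, map_mul, hrefl _ hu]
  have hidx : ∀ i : J.Index, ∃ u, Aniso (dotForm N) (endo x.1) i.1 u := by
    rintro ⟨i, hi⟩
    obtain ⟨a, -, rfl⟩ := Finset.mem_image.1 hi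
    exact ⟨_, J.aniso a⟩
  choose u hu using hidx
  let c (i : J.Index) : Submonoid.center Q := ⟨π (Stab.refl (hu i)), hcen (hu i)⟩
  have hc : ∀ i, c i * c i = 1 := fun i => Subtype.ext <| by
    change π (Stab.refl (hu i)) * π (Stab.refl (hu i)) = 1
    rw [← map_mul, Stab.refl_mul_self, map_one]
  -- Central involutions indexed by lengths define a map from the sign group. The quotient map
  -- factors through the signs by comparison on reflections.
  let ψ : (J.Index → ℤˣ) →* Submonoid.center Q :=
    ∏ i, (signHom (c i) (hc i)).comp (Pi.evalMonoidHom (fun _ : J.Index => ℤˣ) i)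
  have hψ : ∀ i, ψ (Pi.mulSingle i (-1)) = c i := by
    intro i
    have h1 : ∀ ε, ψ ε = ∏ i, signHom (c i) (hc i) (ε i) := fun ε => by simp [ψ]
    rw [h1, Finset.prod_eq_single i (fun j _ hj => by
      rw [Pi.mulSingle_eq_of_ne hj, map_one]) (by simp), Pi.mulSingle_eq_same]
    simp [signHom]
  have heq : π = ((Submonoid.center Q).subtype.comp ψ).comp J.signs := by
    refine MonoidHom.eq_of_eqOn_denseM (Stab.closure_refl x) ?_
    rintro _ ⟨k, w, hw, rfl⟩
    rw [MonoidHom.comp_apply, MonoidHom.comp_apply, J.signs_refl, hψ]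
    exact hrefl hw (hu ⟨k, J.mem_index hw⟩)
  have h1 : π g = 1 := by rw [heq, MonoidHom.comp_apply, hg, map_one]
  exact (QuotientGroup.eq_one_iff g).1 h1

theorem Stab.det_eq_one_of_mem {g : Stab x} (hg : g ∈ Subgroup.connectedComponentOfOne (Stab x)) :
    g.1.1.det = 1 := by
  have hclopen : IsClopen {g : Stab x | g.1.1.det = 1} :=
    ⟨isClosed_eq (OG.continuous_val.comp continuous_subtype_val).matrix_det continuous_const,
      OG.isOpen_det.preimage continuous_subtype_val⟩
  exact isPreconnected_connectedComponent.subset_isClopen hclopen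
    ⟨1, mem_connectedComponent, det_one⟩ hg

/-- The stabilizer in the special orthogonal group, inside the one in the orthogonal group. -/
def stabInclusion {O : NilpotentOrbit N} (x : O.orbit) :
    MulAction.stabilizer (SO N) x →* Stab x.1 where
  toFun s := ⟨SO.toOG s.1, MulAction.mem_stabilizer_iff.2 <| by
    rw [SO.toOG_smul]
    exact congrArg Subtype.val (MulAction.mem_stabilizer_iff.1 s.2)⟩
  map_one' := rfl
  map_mul' _ _ := rfl

/-- The component group of the stabilizer. -/
def componentMap {O : NilpotentOrbit N} (x : O.orbit) (J : FullJordan x.1) :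
    ComponentMap (SO N) x J.signDet.ker where
  toHom := (J.signs.comp (stabInclusion x)).codRestrict _ fun s => by
    rw [MonoidHom.mem_ker]
    have h := J.det_eq (stabInclusion x s)
    rw [show (stabInclusion x s).1.1.det = 1 from SO.det_toOG s.1] at h
    refine Units.ext (Int.cast_injective (α := ℂ) ?_)
    rw [Units.val_one, Int.cast_one]
    exact h.symm
  surjective := by
    rintro ⟨ε, hε⟩
    obtain ⟨g, rfl⟩ := J.signs_surjective ε
    obtain ⟨k, hk⟩ := SO.exists_toOG_eq (g := g.1) (by
      rw [J.det_eq g, MonoidHom.mem_ker.1 hε]; simp)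
    refine ⟨⟨k, MulAction.mem_stabilizer_iff.2 (Subtype.ext ?_)⟩, Subtype.ext ?_⟩
    · have := MulAction.mem_stabilizer_iff.1 g.2
      rw [← hk, SO.toOG_smul] at this
      exact this
    · exact congrArg J.signs (Subtype.ext hk)
  isOpen_ker := by
    have hcont : Continuous (stabInclusion x) :=
      Continuous.subtype_mk (SO.isInducing_toOG.continuous.comp continuous_subtype_val) _
    have : {s : MulAction.stabilizer (SO N) x | J.signs (stabInclusion x s) = 1} =
        ⋂ i : J.Index, {s | J.multDet i (stabInclusion x s) ≠ -1} := by
      ext s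
      simp [J.signs_eq_one_iff]
    have h2 := isOpen_iInter_of_finite fun i : J.Index =>
      isOpen_ne_fun ((J.continuous_multDet i).comp hcont) (continuous_const (y := (-1 : ℂ)))
    convert h2 using 1
    refine Eq.trans ?_ this
    ext s
    exact Subtype.ext_iff
  connected s hs := by
    have hs' : J.signs (stabInclusion x s) = 1 := congrArg Subtype.val hs
    -- The identity component of the O(N)-stabilizer has determinant 1 throughout, so it lies in
    -- SO(N) and provides the connecting set.
    let H : Set (Stab x.1) := connectedComponent 1
    have hH : ∀ g ∈ H, g.1.1.det = 1 := fun g hg => Stab.det_eq_one_of_mem hg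
    refine ⟨SO.toOG ⁻¹' (Subtype.val '' H), ?_, ?_, ⟨1, mem_connectedComponent, rfl⟩,
      ⟨stabInclusion x s, J.mem_connectedComponentOfOne hs', rfl⟩⟩
    · rw [← SO.isInducing_toOG.isPreconnected_image, Set.image_preimage_eq_of_subset]
      · exact isPreconnected_connectedComponent.image _ continuous_subtype_val.continuousOn
      · rintro _ ⟨g, hg, rfl⟩
        exact SO.exists_toOG_eq (hH g hg)
    · rintro k ⟨g, -, hg⟩
      refine MulAction.mem_stabilizer_iff.2 (Subtype.ext ?_)
      have := MulAction.mem_stabilizer_iff.1 g.2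
      rw [hg, SO.toOG_smul] at this
      exact this

end ComponentGroups

/-! ### Connectedness of SO(N). -/

section Connected

variable {N : ℕ}

theorem FullJordan.j_eq_zero {x : NilCone N} (J : FullJordan x) (hx : x.1 = 0) (a : J.ι) :
    J.j a = 0 := by
  by_contra h
  have := J.system.gram a a (J.j a)
  have h0 : endo x.1 = 0 := (congrArg _ hx).trans (map_zero _)
  rw [h0, zero_pow h] at this
  simp at this

/-- The component analysis at `x = 0`: every element stabilizes it, all chains have length one, and
the only possible sign is the determinant, which is 1. -/
instance : PreconnectedSpace (SO N) := by
  let x : NilCone N := ⟨0, ⟨by simp, by simp⟩, ⟨1, by simp⟩⟩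
  let O : NilpotentOrbit N := Quotient.mk'' x
  have hx : x ∈ O.orbit := MulAction.orbitRel.Quotient.mem_orbit.2 rfl
  have hstab : ∀ k : SO N, k ∈ MulAction.stabilizer (SO N) (⟨x, hx⟩ : O.orbit) := by
    intro k
    refine MulAction.mem_stabilizer_iff.2 (Subtype.ext (Subtype.ext ?_))
    change SO.mat k * 0 * SO.mat k⁻¹ = 0
    simp
  let P := componentMap (⟨x, hx⟩ : O.orbit) x.jordan
  have hidx : ∀ i : x.jordan.Index, i.1 = 0 := by
    rintro ⟨i, hi⟩
    obtain ⟨a, -, rfl⟩ := Finset.mem_image.1 hi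
    exact x.jordan.j_eq_zero rfl a
  have htriv : ∀ k : SO N, P.toHom ⟨k, hstab k⟩ = 1 := by
    intro k
    obtain ⟨ε, hε⟩ := P.toHom ⟨k, hstab k⟩
    refine Subtype.ext (funext fun i => ?_)
    have h1 := MonoidHom.mem_ker.1 hε
    rw [FullJordan.signDet_apply, Finset.prod_eq_single i
      (fun j _ hj => absurd (Subtype.ext ((hidx j).trans (hidx i).symm)) hj) (by simp),
      hidx, zero_add, pow_one] at h1
    exact h1
  refine ⟨isPreconnected_of_forall 1 fun k _ => ?_⟩
  obtain ⟨T, hT, -, h1, hk⟩ := P.connected _ (htriv k)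
  exact ⟨T, Set.subset_univ T, h1, hk, hT⟩

end Connected

/-! ### Complexes correspond to orbits with a character. -/

section Classification

variable {N : ℕ}

/-- A base point of an orbit. -/
def NilpotentOrbit.base (O : NilpotentOrbit N) : O.orbit :=
  ⟨O.out, MulAction.orbitRel.Quotient.mem_orbit.2 (Quotient.out_eq' O)⟩

/-- The component group of the stabilizer of the base point of an orbit. -/
abbrev NilpotentOrbit.componentGroup (O : NilpotentOrbit N) : Type :=
  (NilCone.jordan O.base.1).signDet.ker

/-- The presentation of the component group. -/
abbrev NilpotentOrbit.component (O : NilpotentOrbit N) :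
    ComponentMap (SO N) O.base O.componentGroup :=
  componentMap O.base (NilCone.jordan O.base.1)

theorem NilpotentOrbit.isInducing_inclusion (O : NilpotentOrbit N) :
    Topology.IsInducing O.inclusion :=
  Topology.IsInducing.subtypeVal

/-- The class of the complex attached to an orbit and a character of its component group. -/
def orbitalClass (c : Σ O : NilpotentOrbit N, O.componentGroup →* ℂˣ) :
    Quotient (isIsomorphicSetoid
      (DerivedCategory.Plus (ComplexSheaf (TopCat.of (NilCone N))))) :=
  ⟦IC c.1 (charSystem (NilpotentOrbit.isHomogeneous c.1.base) c.1.component c.2)⟧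

theorem range_orbitalClass : Set.range (orbitalClass (N := N)) = nilpotentOrbitalComplexes N := by
  ext c
  constructor
  · rintro ⟨⟨O, χ⟩, rfl⟩
    exact ⟨O, _, (charSystem_hasCharacter _ _ χ).isIrreducible
      (NilpotentOrbit.isHomogeneous O.base), rfl⟩
  · rintro ⟨O, E, hE, rfl⟩
    obtain ⟨χ, hχ⟩ := hE.exists_hasCharacter O.component (NilpotentOrbit.isHomogeneous O.base)
    exact ⟨⟨O, χ⟩, Quotient.sound (nonempty_IC_iso
      ((charSystem_hasCharacter _ _ χ).nonempty_sheaf_iso (NilpotentOrbit.isHomogeneous O.base) hχ))⟩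

/-- The lowest cohomology sheaf returns the direct image, a separating open set then returns the
orbit, and connectedness of SO(N) returns the character. -/
theorem orbitalClass_injective : Function.Injective (orbitalClass (N := N)) := by
  have hnt : ∀ {O : NilpotentOrbit N} {E : EquivariantLocalSystem (SO N) O.orbit}
      {χ : O.componentGroup →* ℂˣ}, E.HasCharacter O.component χ → Nontrivial (E.fiber O.base) :=
    fun h => Module.nontrivial_of_finrank_pos (R := ℂ) (by rw [h.finrank_eq_one]; exact one_pos)
  rintro ⟨O, χ⟩ ⟨O', χ'⟩ h
  obtain ⟨f⟩ := Quotient.exact h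
  have hE := charSystem_hasCharacter (NilpotentOrbit.isHomogeneous O.base) O.component χ
  have hE' := charSystem_hasCharacter (NilpotentOrbit.isHomogeneous O'.base) O'.component χ'
  have := hnt hE
  have := hnt hE'
  obtain ⟨g⟩ := nonempty_pushforwardSheaf_iso f
    (LocalSystem.not_isZero_pushforward O.isInducing_inclusion (x := O.base))
    (LocalSystem.not_isZero_pushforward O'.isInducing_inclusion (x := O'.base))
  by_cases hO : O = O'
  · subst hO
    rw [hE.eq_of_pushforward_iso (NilpotentOrbit.isHomogeneous O.base) O.isInducing_inclusion hE' g]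
  · exfalso
    obtain ⟨Q, ⟨hx, hQ⟩ | ⟨hx, hQ⟩⟩ := NilpotentOrbit.exists_open hO O.base.2 O'.base.2
    · exact (LocalSystem.isEmpty_pushforward_iso O.isInducing_inclusion (j := O'.inclusion)
        (x := O.base) Q hx fun z => hQ z.1 z.2).false g
    · exact (LocalSystem.isEmpty_pushforward_iso O'.isInducing_inclusion (j := O.inclusion)
        (x := O'.base) Q hx fun z => hQ z.1 z.2).false g.symm

theorem ncard_nilpotentOrbitalComplexes : (nilpotentOrbitalComplexes N).ncard =
    Nat.card (Σ O : NilpotentOrbit N, O.componentGroup →* ℂˣ) := by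
  rw [← range_orbitalClass, ← Nat.card_coe_set_eq, Nat.card_range_of_injective orbitalClass_injective]

end Classification

/-! ### Counting orbits and characters by Jordan type. -/

section Counting

variable {N : ℕ}

/-- The number of distinct parts of a partition. -/
def distinctParts {n : ℕ} (l : n.Partition) : ℕ := l.parts.toFinset.card

theorem FullJordan.card_index {x : NilCone N} (J : FullJordan x) :
    Fintype.card J.Index = distinctParts x.type := by
  have h : (J.partition).parts.toFinset = (Finset.univ.image J.j).map (addRightEmbedding 1) := by
    ext i
    simp [FullJordan.partition]
  rw [J.type_eq, distinctParts, h, Finset.card_map, Fintype.card_coe]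

theorem FullJordan.mem_index_iff {x : NilCone N} (J : FullJordan x) {i : ℕ} :
    i ∈ Finset.univ.image J.j ↔ i + 1 ∈ x.type.parts := by
  rw [J.type_eq]
  simp [FullJordan.partition]

theorem FullJordan.signDet_eq_one {x : NilCone N} (J : FullJordan x)
    (h : ∀ i ∈ x.type.parts, Even i) (ε : J.Index → ℤˣ) : J.signDet ε = 1 := by
  rw [signDet_apply]
  refine Finset.prod_eq_one fun i _ => ?_
  obtain ⟨c, hc⟩ := h _ (J.mem_index_iff.1 i.2)
  rw [hc, ← two_mul, pow_mul]
  rcases Int.units_eq_one_or (ε i) with h | h <;> simp [h]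

theorem FullJordan.signDet_surjective {x : NilCone N} (J : FullJordan x)
    (h : ¬ ∀ i ∈ x.type.parts, Even i) : Function.Surjective J.signDet := by
  push Not at h
  obtain ⟨i, hi, hodd⟩ := h
  have hpos := x.type.parts_pos hi
  obtain ⟨i, rfl⟩ := Nat.exists_eq_add_of_le' hpos
  intro δ
  refine ⟨Pi.mulSingle ⟨i, J.mem_index_iff.2 hi⟩ δ, ?_⟩
  rw [J.signDet_mulSingle]
  rcases Int.units_eq_one_or δ with rfl | rfl
  · simp
  · exact (Nat.not_even_iff_odd.1 hodd).neg_one_pow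

theorem FullJordan.card_ker_of_even {x : NilCone N} (J : FullJordan x)
    (h : ∀ i ∈ x.type.parts, Even i) : Nat.card J.signDet.ker = 2 ^ distinctParts x.type := by
  have : J.signDet.ker = ⊤ := (Subgroup.eq_top_iff' _).2 fun ε => J.signDet_eq_one h ε
  rw [this, Subgroup.card_top, Nat.card_eq_fintype_card, Fintype.card_fun, J.card_index]
  rfl

/-- An odd part makes the determinant surjective onto the two signs, so its kernel has index two. -/
theorem FullJordan.card_ker_of_not_even {x : NilCone N} (J : FullJordan x)
    (h : ¬ ∀ i ∈ x.type.parts, Even i) :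
    Nat.card J.signDet.ker * 2 = 2 ^ distinctParts x.type := by
  have h1 := J.signDet.ker.card_mul_index
  rw [Subgroup.index_ker, MonoidHom.range_eq_top.2 (J.signDet_surjective h), Subgroup.card_top,
    Nat.card_eq_fintype_card (α := ℤˣ), Nat.card_eq_fintype_card (α := J.Index → ℤˣ),
    Fintype.card_fun, J.card_index] at h1
  exact h1

theorem card_characters (O : NilpotentOrbit N) :
    Nat.card (O.componentGroup →* ℂˣ) = Nat.card O.componentGroup :=
  CommGroup.card_monoidHom_of_hasEnoughRootsOfUnity _ _

theorem SO.type_smul (k : SO N) (x : NilCone N) : (k • x).type = x.type :=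
  (NilCone.type_eq_iff.2 ⟨SO.toOG k, SO.toOG_smul k x⟩).symm

/-- The Jordan type of an orbit. -/
def NilpotentOrbit.type (O : NilpotentOrbit N) : N.Partition := O.base.1.type

theorem NilpotentOrbit.type_mk (x : NilCone N) :
    NilpotentOrbit.type (Quotient.mk'' x : NilpotentOrbit N) = x.type := by
  obtain ⟨k, hk⟩ := (NilpotentOrbit.mem_orbit_iff (O := Quotient.mk'' x) (x := x)
    (MulAction.orbitRel.Quotient.mem_orbit.2 rfl)).1 (NilpotentOrbit.base _).2
  rw [NilpotentOrbit.type, ← hk, SO.type_smul]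

theorem NilpotentOrbit.mk_eq_mk {x y : NilCone N} :
    (Quotient.mk'' x : NilpotentOrbit N) = Quotient.mk'' y ↔ ∃ k : SO N, k • y = x :=
  Quotient.eq''

theorem OG.exists_det (hN : 0 < N) : ∃ r : OG N, r.1.det = -1 := by
  refine ⟨⟨Matrix.diagonal (Function.update 1 ⟨0, hN⟩ (-1)), ?_⟩, ?_⟩
  · rw [diagonal_transpose, diagonal_mul_diagonal, ← diagonal_one]
    congr 1
    funext i
    by_cases hi : i = ⟨0, hN⟩
    · subst hi; simp
    · simp [hi]
  · change (Matrix.diagonal _).det = -1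
    rw [det_diagonal, Finset.prod_update_of_mem (Finset.mem_univ _)]
    simp

/-- There is one orbit with a given Jordan type if some part is odd. -/
theorem NilpotentOrbit.card_type_of_not_even (l : N.Partition) (h : ¬ ∀ i ∈ l.parts, Even i) :
    Nat.card {O : NilpotentOrbit N // O.type = l} = 1 := by
  rw [Nat.card_eq_one_iff_unique]
  refine ⟨⟨?_⟩, ?_⟩
  · rintro ⟨O, hO⟩ ⟨O', hO'⟩
    refine Subtype.ext ?_
    induction O using Quotient.inductionOn' with | _ x
    induction O' using Quotient.inductionOn' with | _ y
    change NilpotentOrbit.type (Quotient.mk'' x) = l at hO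
    change NilpotentOrbit.type (Quotient.mk'' y) = l at hO'
    rw [NilpotentOrbit.type_mk] at hO hO'
    obtain ⟨g, hg⟩ := NilCone.type_eq_iff.1 (hO'.trans hO.symm)
    refine NilpotentOrbit.mk_eq_mk.2 ?_
    rcases g.det_eq with hd | hd
    · obtain ⟨k, rfl⟩ := SO.exists_toOG_eq hd
      exact ⟨k, by rw [← SO.toOG_smul, hg]⟩
    -- An odd part yields a stabilizer element of determinant -1, which corrects the determinant of
    -- `g`.
    · obtain ⟨ε, hε⟩ := y.jordan.signDet_surjective (hO' ▸ h) (-1)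
      obtain ⟨r, rfl⟩ := y.jordan.signs_surjective ε
      have hr : r.1.1.det = -1 := by rw [y.jordan.det_eq, hε]; simp
      obtain ⟨k, hk⟩ := SO.exists_toOG_eq (g := g * r.1) (by
        rw [OG.mul_val, det_mul, hd, hr]; norm_num)
      refine ⟨k, ?_⟩
      rw [← SO.toOG_smul, hk, mul_smul, MulAction.mem_stabilizer_iff.1 r.2, hg]
  · obtain ⟨x, hx⟩ := NilCone.exists_type_eq l
    exact ⟨⟨Quotient.mk'' x, (NilpotentOrbit.type_mk x).trans hx⟩⟩

/-- There are two orbits with a given Jordan type if all parts are even. -/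
theorem NilpotentOrbit.card_type_of_even (hN : 0 < N) (l : N.Partition)
    (h : ∀ i ∈ l.parts, Even i) : Nat.card {O : NilpotentOrbit N // O.type = l} = 2 := by
  obtain ⟨x, hx⟩ := NilCone.exists_type_eq l
  obtain ⟨r, hr⟩ := OG.exists_det hN
  rw [Nat.card_eq_two_iff]
  refine ⟨⟨Quotient.mk'' x, (NilpotentOrbit.type_mk x).trans hx⟩,
    ⟨Quotient.mk'' (r • x), (NilpotentOrbit.type_mk _).trans
      ((NilCone.type_eq_iff.2 ⟨r, rfl⟩).symm.trans hx)⟩, ?_, ?_⟩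
  · intro e
    obtain ⟨k, hk⟩ := NilpotentOrbit.mk_eq_mk.1 (congrArg Subtype.val e)
    -- If the orbits of `x` and `r • x` coincided, this stabilizer element would have determinant
    -- -1, which even parts forbid.
    let s : Stab x := ⟨SO.toOG k * r, MulAction.mem_stabilizer_iff.2 (by
      rw [mul_smul, SO.toOG_smul, hk])⟩
    have h1 := x.jordan.det_eq s
    rw [x.jordan.signDet_eq_one (hx ▸ h)] at h1
    have h2 : s.1.1.det = -1 := by
      change ((SO.toOG k).1 * r.1).det = -1
      rw [det_mul, SO.det_toOG, hr, one_mul]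
    rw [h2] at h1
    norm_num at h1
  · refine Set.eq_univ_of_forall ?_
    rintro ⟨O, hO⟩
    induction O using Quotient.inductionOn' with | _ y
    change NilpotentOrbit.type (Quotient.mk'' y) = l at hO
    rw [NilpotentOrbit.type_mk] at hO
    obtain ⟨g, hg⟩ := NilCone.type_eq_iff.1 (hx.trans hO.symm)
    rcases g.det_eq with hd | hd
    · obtain ⟨k, rfl⟩ := SO.exists_toOG_eq hd
      exact Or.inl (Subtype.ext (NilpotentOrbit.mk_eq_mk.2 ⟨k, by rw [← SO.toOG_smul, hg]⟩))
    · have hr' : (r⁻¹).1.det = -1 := by rw [OG.inv_val, det_transpose, hr]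
      obtain ⟨k, hk⟩ := SO.exists_toOG_eq (g := g * r⁻¹) (by
        rw [OG.mul_val, det_mul, hd, hr']; norm_num)
      refine Or.inr (Subtype.ext (NilpotentOrbit.mk_eq_mk.2 ⟨k, ?_⟩))
      rw [← SO.toOG_smul, hk, mul_smul, inv_smul_smul, hg]

theorem NilpotentOrbit.finite_type (hN : 0 < N) (l : N.Partition) :
    Finite {O : NilpotentOrbit N // O.type = l} := by
  refine Nat.finite_of_card_ne_zero ?_
  by_cases h : ∀ i ∈ l.parts, Even i
  · rw [card_type_of_even hN l h]; norm_num
  · rw [card_type_of_not_even l h]; norm_num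

open Classical in
/-- The number of nilpotent orbital complexes, as a sum over partitions. -/
theorem two_mul_ncard_nilpotentOrbitalComplexes (hN : 0 < N) :
    2 * (nilpotentOrbitalComplexes N).ncard = ∑ l : N.Partition, 2 ^ distinctParts l +
      3 * ∑ l : N.Partition with ∀ i ∈ l.parts, Even i, 2 ^ distinctParts l := by
  have := NilpotentOrbit.finite_type hN
  have hfin : Finite (Σ l : N.Partition, {O : NilpotentOrbit N // O.type = l}) := inferInstance
  have : Finite (NilpotentOrbit N) :=
    Finite.of_equiv _ (Equiv.sigmaFiberEquiv (NilpotentOrbit.type (N := N)))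
  let _ := Fintype.ofFinite (NilpotentOrbit N)
  rw [ncard_nilpotentOrbitalComplexes, Nat.card_sigma]
  simp only [card_characters]
  rw [← Finset.sum_fiberwise (s := Finset.univ) (g := NilpotentOrbit.type (N := N)), Finset.mul_sum,
    Finset.sum_filter, Finset.mul_sum, ← Finset.sum_add_distrib]
  refine Finset.sum_congr rfl fun l _ => ?_
  have hcard : (Finset.univ.filter fun O : NilpotentOrbit N => O.type = l).card =
      Nat.card {O : NilpotentOrbit N // O.type = l} := by
    rw [Nat.card_eq_fintype_card, Fintype.card_subtype]
  -- Even parts give two orbits with 2^a characters each, so four times 2^a after doubling.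
  -- Otherwise one orbit with half as many characters gives 2^a.
  split_ifs with h
  · rw [Finset.sum_congr rfl (g := fun _ => 2 ^ distinctParts l) fun O hO => ?_,
      Finset.sum_const, hcard, NilpotentOrbit.card_type_of_even hN l h]
    · simp only [smul_eq_mul]; ring
    · obtain rfl := (Finset.mem_filter.1 hO).2
      exact FullJordan.card_ker_of_even _ h
  · rw [mul_comm 2, Finset.sum_mul, Finset.sum_congr rfl (g := fun _ => 2 ^ distinctParts l)
      fun O hO => ?_, Finset.sum_const, hcard, NilpotentOrbit.card_type_of_not_even l h]
    · simp
    · obtain rfl := (Finset.mem_filter.1 hO).2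
      exact FullJordan.card_ker_of_not_even _ h

end Counting

/-! ## Partition identities -/

section GeneratingFunctions

open PowerSeries PowerSeries.WithPiTopology Finset

local instance : TopologicalSpace ℤ := ⊥

/-- The geometric series. -/
def geomSeries (y : ℤ⟦X⟧) : ℤ⟦X⟧ := ∑' j : ℕ, y ^ j

theorem geomSeries_mul {y : ℤ⟦X⟧} (h : constantCoeff y = 0) : geomSeries y * (1 - y) = 1 :=
  tsum_pow_mul_one_sub_of_constantCoeff_eq_zero h

theorem eq_geomSeries {y z : ℤ⟦X⟧} (h : constantCoeff y = 0) (hz : z * (1 - y) = 1) :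
    z = geomSeries y := by
  calc z = z * (geomSeries y * (1 - y)) := by rw [geomSeries_mul h, mul_one]
    _ = geomSeries y := by rw [mul_comm (geomSeries y), ← mul_assoc, hz, one_mul]

theorem one_add_tsum {y : ℤ⟦X⟧} (h : constantCoeff y = 0) :
    1 + ∑' j : ℕ, y ^ (j + 1) = geomSeries y := by
  have h2 : Summable fun j : ℕ => y ^ j := summable_pow_of_constantCoeff_eq_zero h
  have hs : Summable fun j : ℕ => y ^ (j + 1) := by
    simp_rw [pow_add]
    exact h2.mul_right _
  rw [geomSeries, tsum_eq_zero_add' hs, pow_zero]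

theorem constantCoeff_X_pow_succ (i : ℕ) : constantCoeff ((X : ℤ⟦X⟧) ^ (i + 1)) = 0 := by simp

/-- The generating function of the numbers of partitions. -/
theorem hasProd_p : HasProd (fun i : ℕ => geomSeries ((X : ℤ⟦X⟧) ^ (i + 1)))
    (PowerSeries.mk fun n => (p n : ℤ)) := by
  convert! Nat.Partition.hasProd_genFun (fun _ _ => (1 : ℤ)) using 1
  · funext i
    rw [← one_add_tsum (constantCoeff_X_pow_succ i)]
    refine congrArg (1 + ·) (tsum_congr fun j => ?_)
    rw [PowerSeries.smul_eq_C_mul, map_one, one_mul, pow_mul]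
  · ext n
    simp [p, Finsupp.prod]

/-- The generating function of the numbers of partitions all of whose multiplicities are even. -/
theorem hasProd_even : HasProd (fun i : ℕ => geomSeries ((X : ℤ⟦X⟧) ^ (2 * (i + 1))))
    (Nat.Partition.genFun fun _ c => if Even c then (1 : ℤ) else 0) := by
  convert! Nat.Partition.hasProd_genFun (fun _ c => if Even c then (1 : ℤ) else 0) using 1
  funext i
  have hy : constantCoeff ((X : ℤ⟦X⟧) ^ (2 * (i + 1))) = 0 := by simp
  rw [← one_add_tsum hy]
  refine congrArg (1 + ·) (Eq.symm ?_)
  -- The exponents are shifted by one, so index `2j + 1` corresponds to multiplicity `2(j + 1)`.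
  refine tsum_eq_tsum_of_ne_zero_bij (fun j => 2 * j.1 + 1) ?_ ?_ ?_
  · intro j k h
    exact Subtype.ext (by simpa using h)
  · intro j hj
    have hev : Even (j + 1) := by
      by_contra h
      rw [Function.mem_support, if_neg h, PowerSeries.smul_eq_C_mul, map_zero, zero_mul] at hj
      exact hj rfl
    obtain ⟨c, hc⟩ := hev
    refine ⟨⟨c - 1, ?_⟩, by dsimp only; omega⟩
    rw [Function.mem_support, ← pow_mul]
    exact pow_ne_zero _ X_ne_zero
  · intro j
    have : Even (2 * j.1 + 1 + 1) := ⟨j.1 + 1, by ring⟩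
    rw [if_pos this, PowerSeries.smul_eq_C_mul, map_one, one_mul, ← pow_mul]
    congr 1
    ring

/-- The generating function of the numbers of 2-regular partitions. -/
theorem hasProd_q : HasProd (fun i : ℕ => 1 + (X : ℤ⟦X⟧) ^ (i + 1))
    (PowerSeries.mk fun n => (q n : ℤ)) := by
  convert! Nat.Partition.hasProd_powerSeriesMk_card_countRestricted ℤ two_pos using 1
  funext i
  have h : ∑ j ∈ range (1 + 1), (X : ℤ⟦X⟧) ^ ((i + 1) * j) = 1 + X ^ (i + 1) := by
    rw [sum_range_succ]
    simp
  exact h.symm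

/-- The generating function weighting partitions by powers of two. -/
theorem hasProd_two_pow : HasProd (fun i : ℕ => (1 + (X : ℤ⟦X⟧) ^ (i + 1)) *
    geomSeries ((X : ℤ⟦X⟧) ^ (i + 1)))
    (PowerSeries.mk fun n => ∑ l : n.Partition, (2 : ℤ) ^ distinctParts l) := by
  convert! Nat.Partition.hasProd_genFun (fun _ _ => (2 : ℤ)) using 1
  · funext i
    have hy := constantCoeff_X_pow_succ i
    have h := one_add_tsum hy
    have h1 := geomSeries_mul hy
    have hs : Summable fun j : ℕ => ((X : ℤ⟦X⟧) ^ (i + 1)) ^ (j + 1) := by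
      simp_rw [pow_succ ((X : ℤ⟦X⟧) ^ (i + 1))]
      exact (summable_pow_of_constantCoeff_eq_zero hy).mul_right _
    refine Eq.trans ?_ (congrArg (1 + ·)
      (tsum_congr fun j => (?_ : 2 * ((X : ℤ⟦X⟧) ^ (i + 1)) ^ (j + 1) = _)))
    -- With y the power of X, this is 1 + 2(y + y² + ⋯) = (1 + y)/(1 - y).
    · rw [hs.tsum_mul_left]
      linear_combination -2 * h - h1
    · rw [PowerSeries.smul_eq_C_mul, pow_mul]
      simp
  · ext n
    simp [distinctParts, Finsupp.prod]

/-- Factor by factor, 1/(1 - y) = (1 + y)/(1 - y²): each multiplicity is split into its parity and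
an even rest. -/
theorem mk_p_eq : (PowerSeries.mk fun n => (p n : ℤ)) = (PowerSeries.mk fun n => (q n : ℤ)) *
    Nat.Partition.genFun fun _ c => if Even c then (1 : ℤ) else 0 := by
  refine hasProd_p.unique ?_
  convert hasProd_q.mul hasProd_even using 1
  funext i
  have hy := constantCoeff_X_pow_succ i
  refine (eq_geomSeries hy ?_).symm
  have := geomSeries_mul (y := (X : ℤ⟦X⟧) ^ (2 * (i + 1))) (by simp)
  rw [mul_comm 2, pow_mul] at this ⊢
  linear_combination this

theorem mk_two_pow_eq : (PowerSeries.mk fun n => ∑ l : n.Partition, (2 : ℤ) ^ distinctParts l) =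
    (PowerSeries.mk fun n => (q n : ℤ)) * PowerSeries.mk fun n => (p n : ℤ) :=
  hasProd_two_pow.unique (hasProd_q.mul hasProd_p)

end GeneratingFunctions

/-! ### Coefficient identities for weighted partition sums. -/

section Identities

open Finset

/-- The partitions of `2n` with even multiplicities are the doubled partitions of `n`. -/
theorem card_even_multiplicities (n : ℕ) : ∑ l : (2 * n).Partition,
    l.parts.toFinsupp.prod (fun _ c => if Even c then (1 : ℤ) else 0) = p n := by
  classical
  have h1 : ∀ l : (2 * n).Partition,
      l.parts.toFinsupp.prod (fun _ c => if Even c then (1 : ℤ) else 0) =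
        if ∀ i, Even (l.parts.count i) then 1 else 0 := by
    intro l
    rw [Finsupp.prod, prod_boole]
    refine if_congr ?_ rfl rfl
    constructor
    · intro h i
      by_cases hi : i ∈ l.parts
      · exact h i (by simpa using hi)
      · rw [Multiset.count_eq_zero_of_notMem hi]; exact Even.zero
    · intro h i _
      exact h i
  simp only [h1]
  rw [← sum_filter, sum_const, nsmul_eq_mul, mul_one, p, ← card_univ]
  congr 1
  symm
  refine card_bij (fun l _ => ⟨2 • l.parts, ?_, ?_⟩) ?_ ?_ ?_
  · intro i hi
    exact l.parts_pos (Multiset.mem_of_mem_nsmul hi)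
  · rw [Multiset.sum_nsmul, l.parts_sum, smul_eq_mul]
  · intro l _
    simp
  · intro l _ l' _ h
    refine Nat.Partition.ext (Multiset.ext.2 fun i => ?_)
    have := congrArg (fun l : (2 * n).Partition => l.parts.count i) h
    simpa using this
  · intro l hl
    have hl' := (mem_filter.1 hl).2
    let s : Multiset ℕ := Finsupp.toMultiset (l.parts.toFinsupp.mapRange (· / 2) rfl)
    have hs : 2 • s = l.parts := by
      refine Multiset.ext.2 fun i => ?_
      obtain ⟨c, hc⟩ := hl' i
      simp [s, hc]
      omega
    refine ⟨⟨s, fun {i} hi => ?_, ?_⟩, mem_univ _, Nat.Partition.ext hs⟩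
    · refine l.parts_pos (hs ▸ ?_)
      rw [Multiset.mem_nsmul]
      exact ⟨two_ne_zero, hi⟩
    · have := l.parts_sum
      rw [← hs, Multiset.sum_nsmul, smul_eq_mul] at this
      omega

theorem card_even_multiplicities_of_odd {n : ℕ} (hn : ¬ Even n) : ∑ l : n.Partition,
    l.parts.toFinsupp.prod (fun _ c => if Even c then (1 : ℤ) else 0) = 0 := by
  classical
  refine sum_eq_zero fun l _ => ?_
  rw [Finsupp.prod, prod_boole, if_neg]
  intro h
  apply hn
  rw [← l.parts_sum, sum_multiset_count]
  refine even_sum _ fun i hi => ?_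
  exact (h i (by simpa using hi)).mul_right i

theorem sum_two_pow_eq_sum_p_mul_q (n : ℕ) : ∑ l : n.Partition, 2 ^ distinctParts l =
    ∑ a ∈ antidiagonal n, p a.1 * q a.2 := by
  have h := congrArg (PowerSeries.coeff n) mk_two_pow_eq
  rw [mul_comm, PowerSeries.coeff_mul] at h
  simp only [PowerSeries.coeff_mk] at h
  exact_mod_cast h

/-- Extracts the coefficient of Q(t)²P(t²). The last factor has only even exponents, which are
indexed by `m`. -/
theorem sum_two_pow_eq (N : ℕ) : ∑ l : N.Partition, 2 ^ distinctParts l =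
    ∑ m ∈ range (N / 2 + 1), p m * ∑ a ∈ antidiagonal (N - 2 * m), q a.1 * q a.2 := by
  have h := congrArg (PowerSeries.coeff N) mk_two_pow_eq
  rw [mk_p_eq, ← mul_assoc, mul_comm, PowerSeries.coeff_mul] at h
  simp only [PowerSeries.coeff_mul, PowerSeries.coeff_mk, Nat.Partition.coeff_genFun] at h
  have h2 : (∑ l : N.Partition, (2 : ℤ) ^ distinctParts l) = ∑ m ∈ range (N / 2 + 1),
      (p m : ℤ) * ∑ a ∈ antidiagonal (N - 2 * m), (q a.1 : ℤ) * q a.2 := by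
    rw [h]
    symm
    refine sum_of_injOn (fun m => (2 * m, N - 2 * m)) ?_ ?_ ?_ ?_
    · intro m _ m' _ h
      simp only [Prod.mk.injEq] at h
      omega
    · intro m hm
      simp only [coe_range, Set.mem_Iio] at hm
      rw [mem_coe, HasAntidiagonal.mem_antidiagonal]
      dsimp only
      omega
    · rintro ⟨u, v⟩ huv hne
      rw [HasAntidiagonal.mem_antidiagonal] at huv
      dsimp only at huv ⊢
      rw [card_even_multiplicities_of_odd, zero_mul]
      rintro ⟨c, hc⟩
      refine hne ⟨c, ?_, ?_⟩
      · simp only [coe_range, Set.mem_Iio]; omega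
      · simp only [Prod.mk.injEq]; omega
    · intro m _
      dsimp only
      rw [card_even_multiplicities]
  exact_mod_cast h2

-- Halving all parts preserves the number of distinct parts.
open Classical in
theorem sum_even_two_pow (n : ℕ) : ∑ l : (2 * n).Partition with ∀ i ∈ l.parts, Even i,
    2 ^ distinctParts l = ∑ a ∈ antidiagonal n, p a.1 * q a.2 := by
  rw [← sum_two_pow_eq_sum_p_mul_q]
  symm
  refine sum_bij (fun l _ => ⟨l.parts.map (2 * ·), ?_, ?_⟩) ?_ ?_ ?_ ?_
  · intro i hi
    obtain ⟨c, hc, rfl⟩ := Multiset.mem_map.1 hi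
    have := l.parts_pos hc
    omega
  · rw [Multiset.sum_map_mul_left, Multiset.map_id', l.parts_sum]
  · intro l _
    simp
  · intro l _ l' _ h
    refine Nat.Partition.ext (Multiset.map_injective (f := fun i : ℕ => 2 * i) ?_ ?_)
    · intro i j hij; simpa using hij
    · exact congrArg Nat.Partition.parts h
  · intro l hl
    have hl' := (mem_filter.1 hl).2
    have hs : (l.parts.map (· / 2)).map (2 * ·) = l.parts := by
      rw [Multiset.map_map]
      conv_rhs => rw [← Multiset.map_id l.parts]
      refine Multiset.map_congr rfl fun i hi => ?_
      obtain ⟨c, rfl⟩ := hl' i hi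
      simp
      omega
    refine ⟨⟨l.parts.map (· / 2), ?_, ?_⟩, mem_univ _, Nat.Partition.ext hs⟩
    · intro i hi
      obtain ⟨c, hc, rfl⟩ := Multiset.mem_map.1 hi
      obtain ⟨b, rfl⟩ := hl' c hc
      have := l.parts_pos hc
      omega
    · have := l.parts_sum
      rw [← hs, Multiset.sum_map_mul_left, Multiset.map_id'] at this
      omega
  · intro l _
    rw [distinctParts, distinctParts, Multiset.toFinset_map, card_image_of_injective]
    intro i j hij
    simpa using hij

open Classical in
theorem sum_even_two_pow_of_odd (n : ℕ) : ∑ l : (2 * n + 1).Partition with ∀ i ∈ l.parts, Even i,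
    2 ^ distinctParts l = 0 := by
  rw [sum_eq_zero_iff]
  intro l hl
  exfalso
  have h := (mem_filter.1 hl).2
  have h1 : Even l.parts.sum := by
    rw [sum_multiset_count]
    exact even_sum _ fun i hi => (h i (Multiset.mem_toFinset.1 hi)).mul_left _
  rw [l.parts_sum] at h1
  obtain ⟨c, hc⟩ := h1
  omega

end Identities

/-! ## Counting the set `Σ_N` -/

section SigmaCount

open Finset.HasAntidiagonal (antidiagonal mem_antidiagonal)

/-- A triple `(ν; μ¹, μ²)` of partitions with `2|ν| + |μ¹| + |μ²| = N` and `μ¹`, `μ²` 2-regular. -/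
@[ext] structure OrderedTriple (N : ℕ) where
  ν : Σ m, Nat.Partition m
  μ₁ : Σ k, Nat.Partition k
  μ₂ : Σ l, Nat.Partition l
  size_eq : 2 * ν.1 + μ₁.1 + μ₂.1 = N
  μ₁_regular : μ₁.2 ∈ Nat.Partition.countRestricted μ₁.1 2
  μ₂_regular : μ₂.2 ∈ Nat.Partition.countRestricted μ₂.1 2

namespace OrderedTriple

variable {N : ℕ}

/-- Exchange of `μ¹` and `μ²`. -/
def swap (s : OrderedTriple N) : OrderedTriple N :=
  ⟨s.ν, s.μ₂, s.μ₁, by have := s.size_eq; omega, s.μ₂_regular, s.μ₁_regular⟩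

/-- Ordered triples, by the sizes of their partitions. -/
def equivSigma (N : ℕ) : OrderedTriple N ≃ Σ m : Fin (N / 2 + 1), Nat.Partition m ×
    Σ a : antidiagonal (N - 2 * m.1),
      Nat.Partition.countRestricted a.1.1 2 × Nat.Partition.countRestricted a.1.2 2 where
  toFun s := ⟨⟨s.ν.1, by have := s.size_eq; omega⟩, s.ν.2,
    ⟨⟨(s.μ₁.1, s.μ₂.1), by
      have := s.size_eq
      rw [mem_antidiagonal]
      dsimp only
      omega⟩, ⟨s.μ₁.2, s.μ₁_regular⟩, ⟨s.μ₂.2, s.μ₂_regular⟩⟩⟩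
  invFun x := ⟨⟨x.1.1, x.2.1⟩, ⟨x.2.2.1.1.1, x.2.2.2.1.1⟩, ⟨x.2.2.1.1.2, x.2.2.2.2.1⟩, by
      have h1 := x.1.2
      have h2 := mem_antidiagonal.1 x.2.2.1.2
      dsimp only
      omega, x.2.2.2.1.2, x.2.2.2.2.2⟩
  left_inv _ := rfl
  right_inv _ := rfl

/-- The triples `(ν; μ, μ)` with `|ν| + |μ| = n`. -/
def diagonalEquivSigma (n : ℕ) : {s : OrderedTriple (2 * n) // s.μ₁ = s.μ₂} ≃
    Σ a : antidiagonal n, Nat.Partition a.1.1 × Nat.Partition.countRestricted a.1.2 2 where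
  toFun s := ⟨⟨(s.1.ν.1, s.1.μ₁.1), by
      have h1 := s.1.size_eq
      have h2 := congrArg Sigma.fst s.2
      rw [mem_antidiagonal]
      dsimp only
      omega⟩, s.1.ν.2, ⟨s.1.μ₁.2, s.1.μ₁_regular⟩⟩
  invFun x := ⟨⟨⟨x.1.1.1, x.2.1⟩, ⟨x.1.1.2, x.2.2.1⟩, ⟨x.1.1.2, x.2.2.1⟩, by
      have h2 := mem_antidiagonal.1 x.1.2
      dsimp only
      omega, x.2.2.2, x.2.2.2⟩, rfl⟩
  left_inv s := Subtype.ext (OrderedTriple.ext rfl rfl s.2)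
  right_inv _ := rfl

instance : Finite (OrderedTriple N) := Finite.of_equiv _ (equivSigma N).symm

theorem card_eq (N : ℕ) : Nat.card (OrderedTriple N) =
    ∑ m ∈ Finset.range (N / 2 + 1), p m *
      ∑ a ∈ antidiagonal (N - 2 * m), q a.1 * q a.2 := by
  rw [Nat.card_congr (equivSigma N), Nat.card_eq_fintype_card, Fintype.card_sigma,
    Finset.sum_range]
  refine Finset.sum_congr rfl fun m _ => ?_
  rw [Fintype.card_prod, Fintype.card_sigma, p]
  congr 1
  rw [← Finset.sum_coe_sort (antidiagonal (N - 2 * m.1))]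
  refine Finset.sum_congr rfl fun a _ => ?_
  rw [Fintype.card_prod, Fintype.card_coe, Fintype.card_coe, q, q]

theorem card_diagonal (n : ℕ) : Nat.card {s : OrderedTriple (2 * n) // s.μ₁ = s.μ₂} =
    ∑ a ∈ antidiagonal n, p a.1 * q a.2 := by
  rw [Nat.card_congr (diagonalEquivSigma n), Nat.card_eq_fintype_card, Fintype.card_sigma,
    ← Finset.sum_coe_sort (antidiagonal n)]
  refine Finset.sum_congr rfl fun a _ => ?_
  rw [Fintype.card_prod, Fintype.card_coe, q, p]

theorem card_diagonal_of_odd (n : ℕ) :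
    Nat.card {s : OrderedTriple (2 * n + 1) // s.μ₁ = s.μ₂} = 0 := by
  have : IsEmpty {s : OrderedTriple (2 * n + 1) // s.μ₁ = s.μ₂} := by
    refine ⟨fun s => ?_⟩
    have h1 := s.1.size_eq
    have h2 := congrArg Sigma.fst s.2
    omega
  exact Nat.card_of_isEmpty

end OrderedTriple

/-- An injective key for partitions which compares their sizes first. -/
def partitionKey (μ : Σ k, Nat.Partition k) : ℕ ×ₗ ℕ :=
  toLex (μ.1, (exists_injective_nat (Σ k, Nat.Partition k)).choose μ)

theorem partitionKey_injective : Function.Injective partitionKey := by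
  intro μ μ' h
  exact (exists_injective_nat (Σ k, Nat.Partition k)).choose_spec
    (congrArg (fun x => (ofLex x).2) h)

theorem fst_le_of_partitionKey_le {μ μ' : Σ k, Nat.Partition k}
    (h : partitionKey μ ≤ partitionKey μ') : μ.1 ≤ μ'.1 := by
  rcases Prod.Lex.toLex_le_toLex.1 h with h | h
  · exact h.le
  · exact h.1.le

/-- The bound on the size of μ¹ by half of what is left after ν. This is why keys comparing sizes
first select representatives. -/
theorem LabelledTriple.fst_le {N : ℕ} (t : LabelledTriple N) : t.μ₁.1 ≤ t.μ₂.1 := by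
  have h1 := t.ν_le
  have h2 := t.μ₁_le
  have h3 := t.μ₂_eq
  omega

/-- The classes in `Σ_N` are represented by the triples with ordered keys. -/
theorem bijective_mk_of_partitionKey_le (N : ℕ) : Function.Bijective
    fun t : {t : LabelledTriple N // partitionKey t.μ₁ ≤ partitionKey t.μ₂} =>
      (Quotient.mk (tripleSetoid N) t.1 : SigmaSet N) := by
  constructor
  · rintro ⟨s, hs⟩ ⟨t, ht⟩ h
    refine Subtype.ext ?_
    rcases Quotient.exact h with h | ⟨-, h1, h2, h3, h4⟩
    · exact h
    · have h5 : t.μ₁ = t.μ₂ := by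
        rw [h2, h3] at hs
        exact partitionKey_injective (ht.antisymm hs)
      have h6 := h2.trans h5.symm
      have h7 := h3.trans h5
      obtain ⟨⟩ := s
      obtain ⟨⟩ := t
      simp only [LabelledTriple.mk.injEq]
      exact ⟨h1, h6, h7, h4⟩
  · intro x
    induction x using Quotient.inductionOn with
    | h t =>
      rcases le_total (partitionKey t.μ₁) (partitionKey t.μ₂) with h | h
      · exact ⟨⟨t, h⟩, rfl⟩
      -- With keys in the wrong order both size inequalities hold, so the sizes agree and the
      -- exchange is an allowed identification.
      · have hle := t.fst_le
        have hge := fst_le_of_partitionKey_le h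
        have h1 := t.ν_le
        have h2 := t.μ₁_le
        have h3 := t.μ₂_eq
        refine ⟨⟨⟨t.ν, t.μ₂, t.μ₁, t.ν_le, by omega, by omega, t.μ₂_regular, t.μ₁_regular,
          t.label, t.label_isSome.trans eq_comm⟩, h⟩, Quotient.sound (.inr ?_)⟩
        exact ⟨by dsimp only; omega, rfl, rfl, rfl, rfl⟩

/-- The labelled triples with ordered keys, by whether they carry a label. -/
def labelledEquivSum (N : ℕ) :
    {t : LabelledTriple N // partitionKey t.μ₁ ≤ partitionKey t.μ₂} ≃
      {s : OrderedTriple N // partitionKey s.μ₁ < partitionKey s.μ₂} ⊕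
        {s : OrderedTriple N // s.μ₁ = s.μ₂} × Label where
  toFun t :=
    let s : OrderedTriple N := ⟨t.1.ν, t.1.μ₁, t.1.μ₂, by
      have h1 := t.1.ν_le
      have h2 := t.1.μ₁_le
      have h3 := t.1.μ₂_eq
      omega, t.1.μ₁_regular, t.1.μ₂_regular⟩
    match h : t.1.label with
    | none => .inl ⟨s, t.2.lt_of_ne fun he => by
        have := t.1.label_isSome.2 (partitionKey_injective he)
        simp [h] at this⟩
    | some c => .inr (⟨s, t.1.label_isSome.1 (by simp [h])⟩, c)
  invFun x :=
    match x with
    | .inl s => ⟨⟨s.1.ν, s.1.μ₁, s.1.μ₂, by have := s.1.size_eq; omega, by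
        have := s.1.size_eq
        have := fst_le_of_partitionKey_le s.2.le
        omega, by have := s.1.size_eq; omega, s.1.μ₁_regular, s.1.μ₂_regular, none, by
        have := s.2
        simp only [Option.isSome_none, Bool.false_eq_true, false_iff]
        rintro h
        rw [h] at this
        exact lt_irrefl _ this⟩, s.2.le⟩
    | .inr (s, c) => ⟨⟨s.1.ν, s.1.μ₁, s.1.μ₂, by have := s.1.size_eq; omega, by
        have := s.1.size_eq
        have := congrArg Sigma.fst s.2
        omega, by have := s.1.size_eq; omega, s.1.μ₁_regular, s.1.μ₂_regular, some c, by
        simpa using s.2⟩, by dsimp only; rw [s.2]⟩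
  left_inv t := by
    obtain ⟨⟨ν, μ₁, μ₂, _, _, _, _, _, label, _⟩, _⟩ := t
    cases label <;> rfl
  right_inv x := by
    rcases x with s | ⟨s, c⟩ <;> rfl

/-- Splitting the ordered triples by the comparison of the keys. -/
theorem card_orderedTriple_eq (N : ℕ) : Nat.card (OrderedTriple N) =
    2 * Nat.card {s : OrderedTriple N // partitionKey s.μ₁ < partitionKey s.μ₂} +
      Nat.card {s : OrderedTriple N // s.μ₁ = s.μ₂} := by
  classical
  let _ := Fintype.ofFinite (OrderedTriple N)
  have h1 : Nat.card {s : OrderedTriple N // partitionKey s.μ₂ < partitionKey s.μ₁} =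
      Nat.card {s : OrderedTriple N // partitionKey s.μ₁ < partitionKey s.μ₂} :=
    Nat.card_congr
      ⟨fun s => ⟨s.1.swap, s.2⟩, fun s => ⟨s.1.swap, s.2⟩, fun _ => rfl, fun _ => rfl⟩
  rw [two_mul]
  nth_rw 2 [← h1]
  simp only [Nat.card_eq_fintype_card, Fintype.card_subtype]
  rw [← Finset.card_univ, ← Finset.card_union_of_disjoint, ← Finset.card_union_of_disjoint]
  · congr 1
    symm
    rw [Finset.eq_univ_iff_forall]
    intro s
    simp only [Finset.mem_union, Finset.mem_filter_univ]
    rcases lt_trichotomy (partitionKey s.μ₁) (partitionKey s.μ₂) with h | h | h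
    · exact .inl (.inl h)
    · exact .inr (partitionKey_injective h)
    · exact .inl (.inr h)
  · rw [Finset.disjoint_left]
    intro s hs hs'
    simp only [Finset.mem_union, Finset.mem_filter_univ] at hs hs'
    rw [hs'] at hs
    exact hs.elim (lt_irrefl _) (lt_irrefl _)
  · rw [Finset.disjoint_left]
    intro s hs hs'
    simp only [Finset.mem_filter_univ] at hs hs'
    exact lt_asymm hs hs'

theorem card_label : Nat.card Label = 2 := by
  rw [Nat.card_congr (β := Bool) ⟨fun c => match c with | .I => true | .II => false,
    fun b => bif b then .I else .II, by rintro (_ | _) <;> rfl, by rintro (_ | _) <;> rfl⟩,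
    Nat.card_eq_fintype_card, Fintype.card_bool]

instance : Finite Label := Nat.finite_of_card_ne_zero (by rw [card_label]; exact two_ne_zero)

/-- Off-diagonal ordered triples contribute half their number and diagonal ones twice theirs, giving
weights 1 and 4 after doubling. -/
theorem two_mul_card_sigmaSet (N : ℕ) : 2 * Nat.card (SigmaSet N) =
    Nat.card (OrderedTriple N) + 3 * Nat.card {s : OrderedTriple N // s.μ₁ = s.μ₂} := by
  have h : Nat.card (SigmaSet N) = _ :=
    (Nat.card_eq_of_bijective _ (bijective_mk_of_partitionKey_le N)).symm
  rw [h, Nat.card_congr (labelledEquivSum N), Nat.card_sum, Nat.card_prod, card_label,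
    card_orderedTriple_eq]
  ring

/-- The convolution is symmetric with an even number of terms, so it splits into two equal halves.
-/
theorem sum_antidiagonal_odd (k : ℕ) :
    ∑ a ∈ antidiagonal (2 * k + 1), q a.1 * q a.2 = 2 * d k := by
  rw [Finset.Nat.sum_antidiagonal_eq_sum_range_succ (fun i j => q i * q j),
    show (2 * k + 1).succ = (k + 1) + (k + 1) by omega, Finset.sum_range_add, two_mul (d k), d]
  refine congrArg₂ (· + ·) rfl ?_
  rw [← Finset.sum_range_reflect]
  refine Finset.sum_congr rfl fun s hs => ?_
  rw [Finset.mem_range] at hs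
  rw [show k + 1 + (k + 1 - 1 - s) = 2 * k + 1 - s by omega,
    show 2 * k + 1 - (2 * k + 1 - s) = s by omega, mul_comm]

/-- Here the middle term `q k ^ 2` is fixed by the symmetry, and it combines with `3 * q k` into the
halved term of `e`. -/
theorem sum_antidiagonal_even (k : ℕ) :
    ∑ a ∈ antidiagonal (2 * k), q a.1 * q a.2 + 3 * q k = 2 * e k := by
  rw [Finset.Nat.sum_antidiagonal_eq_sum_range_succ (fun i j => q i * q j),
    show (2 * k).succ = (k + 1) + k by omega, Finset.sum_range_add, Finset.sum_range_succ, e]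
  have h1 : ∑ s ∈ Finset.range k, q (k + 1 + s) * q (2 * k - (k + 1 + s)) =
      ∑ s ∈ Finset.range k, q s * q (2 * k - s) := by
    rw [← Finset.sum_range_reflect]
    refine Finset.sum_congr rfl fun s hs => ?_
    rw [Finset.mem_range] at hs
    rw [show k + 1 + (k - 1 - s) = 2 * k - s by omega,
      show 2 * k - (2 * k - s) = s by omega, mul_comm]
  -- The division is exact because `q k * (q k + 1)` is even.
  have h2 : 2 * ((q k ^ 2 + 3 * q k) / 2) = q k ^ 2 + 3 * q k := by
    refine Nat.mul_div_cancel' ?_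
    have h : q k ^ 2 + 3 * q k = q k * (q k + 1) + 2 * q k := by ring
    rw [h]
    exact dvd_add (Nat.even_mul_succ_self _).two_dvd (dvd_mul_right _ _)
  rw [h1, mul_add, h2, show 2 * k - k = k by omega]
  ring

theorem sum_odd_eq (n : ℕ) : ∑ m ∈ Finset.range ((2 * n + 1) / 2 + 1), p m *
    ∑ a ∈ antidiagonal (2 * n + 1 - 2 * m), q a.1 * q a.2 =
      2 * ∑ k ∈ Finset.range (n + 1), p (n - k) * d k := by
  rw [show (2 * n + 1) / 2 = n by omega, Finset.mul_sum, ← Finset.sum_range_reflect]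
  refine Finset.sum_congr rfl fun k hk => ?_
  rw [Finset.mem_range] at hk
  rw [show 2 * n + 1 - 2 * (n + 1 - 1 - k) = 2 * k + 1 by omega, sum_antidiagonal_odd,
    show n + 1 - 1 - k = n - k by omega]
  ring

theorem sum_even_eq (n : ℕ) : ∑ m ∈ Finset.range (2 * n / 2 + 1), p m *
    ∑ a ∈ antidiagonal (2 * n - 2 * m), q a.1 * q a.2 +
      3 * ∑ a ∈ antidiagonal n, p a.1 * q a.2 =
      2 * ∑ k ∈ Finset.range (n + 1), p (n - k) * e k := by
  rw [show 2 * n / 2 = n by omega, Finset.Nat.sum_antidiagonal_eq_sum_range_succ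
    (fun i j => p i * q j), Finset.mul_sum, Finset.mul_sum, ← Finset.sum_add_distrib,
    ← Finset.sum_range_reflect]
  refine Finset.sum_congr rfl fun k hk => ?_
  rw [Finset.mem_range] at hk
  rw [show 2 * n - 2 * (n + 1 - 1 - k) = 2 * k by omega, show n + 1 - 1 - k = n - k by omega,
    show n - (n - k) = k by omega, mul_left_comm 2, ← sum_antidiagonal_even]
  ring

end SigmaCount

/-! ### Comparison of the two counts. -/

theorem ncard_nilpotentOrbitalComplexes_odd (n : ℕ) :
    (nilpotentOrbitalComplexes (2 * n + 1)).ncard =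
      ∑ k ∈ Finset.range (n + 1), p (n - k) * d k := by
  have h := two_mul_ncard_nilpotentOrbitalComplexes (2 * n).succ_pos
  rw [Nat.succ_eq_add_one, sum_two_pow_eq, sum_odd_eq, sum_even_two_pow_of_odd] at h
  omega

theorem ncard_nilpotentOrbitalComplexes_even {n : ℕ} (hn : 1 ≤ n) :
    (nilpotentOrbitalComplexes (2 * n)).ncard =
      ∑ k ∈ Finset.range (n + 1), p (n - k) * e k := by
  have h := two_mul_ncard_nilpotentOrbitalComplexes (N := 2 * n) (by omega)
  rw [sum_two_pow_eq, sum_even_two_pow, sum_even_eq] at h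
  omega

theorem card_sigmaSet_odd (n : ℕ) :
    ∑ k ∈ Finset.range (n + 1), p (n - k) * d k = Nat.card (SigmaSet (2 * n + 1)) := by
  have h := two_mul_card_sigmaSet (2 * n + 1)
  rw [OrderedTriple.card_eq, OrderedTriple.card_diagonal_of_odd, sum_odd_eq] at h
  omega

theorem card_sigmaSet_even (n : ℕ) :
    ∑ k ∈ Finset.range (n + 1), p (n - k) * e k = Nat.card (SigmaSet (2 * n)) := by
  have h := two_mul_card_sigmaSet (2 * n)
  rw [OrderedTriple.card_eq, OrderedTriple.card_diagonal, sum_even_eq] at h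
  omega

end NilpotentOrbitalComplexes

end

theorem mainTheorem10 :
    (∀ n : ℕ,
      (NilpotentOrbitalComplexes.nilpotentOrbitalComplexes (2 * n + 1)).ncard =
          ∑ k ∈ Finset.range (n + 1),
            NilpotentOrbitalComplexes.p (n - k) * NilpotentOrbitalComplexes.d k ∧
        ∑ k ∈ Finset.range (n + 1),
            NilpotentOrbitalComplexes.p (n - k) * NilpotentOrbitalComplexes.d k =
          Nat.card (NilpotentOrbitalComplexes.SigmaSet (2 * n + 1))) ∧
    (∀ n : ℕ, 1 ≤ n →
      (NilpotentOrbitalComplexes.nilpotentOrbitalComplexes (2 * n)).ncard =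
          ∑ k ∈ Finset.range (n + 1),
            NilpotentOrbitalComplexes.p (n - k) * NilpotentOrbitalComplexes.e k ∧
        ∑ k ∈ Finset.range (n + 1),
            NilpotentOrbitalComplexes.p (n - k) * NilpotentOrbitalComplexes.e k =
          Nat.card (NilpotentOrbitalComplexes.SigmaSet (2 * n))) :=
  ⟨fun n => ⟨NilpotentOrbitalComplexes.ncard_nilpotentOrbitalComplexes_odd n,
    NilpotentOrbitalComplexes.card_sigmaSet_odd n⟩,
   fun n hn => ⟨NilpotentOrbitalComplexes.ncard_nilpotentOrbitalComplexes_even hn,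
    NilpotentOrbitalComplexes.card_sigmaSet_even n⟩⟩
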